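/- Let $R>0$, and let $f:\mathbb{R}^2\to\mathbb{R}$ vanish outside the closed disk $|x|\le R$. Let $u$ be a classical solution of $$u_{tt}=\Delta u\ \text{ on } \mathbb{R}^2\times[0,\infty),\qquad u(x,0)=f(x),\qquad u_t(x,0)=0,$$ that is, $u$ is real-valued and $C^2$ on $\mathbb{R}^2\times[0,\infty)$, up to $t=0$ (so that $f$ is $C^2$). Write $y_\varphi=R(\cos\varphi,\sin\varphi)$, let $P(y_\varphi,t)=u(y_\varphi,t)$ for $t\ge 0$ and $P(y_\varphi,t)=0$ for $t<0$, and put $$\hat P(y_\varphi,\lambda)=\int_{\mathbb{R}}P(y_\varphi,t)e^{it\lambda}\,dt,\qquad \hat P_k(\lambda)=\frac1{2\pi}\int_0^{2\pi}\hat P(y_\varphi,\lambda)e^{-ik\varphi}\,d\varphi\quad(k\in\mathbb{Z}),$$ $$\hat f(\Lambda)=\frac1{2\pi}\int_{\mathbb{R}^2}f(x)e^{-ix\cdot\Lambda}\,dx,\qquad S(\lambda,\varphi)=\sum_{k=-\infty}^{\infty}\frac{(-i)^{|k|}\hat P_k(\lambda)}{\lambda H^{(1)}_{|k|}(\lambda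 R)}e^{ik\varphi}\quad(\lambda>0),$$ where $H^{(1)}_n=J_n+iY_n$ is the Hankel function of the first kind. Then: 1. $P(y_\varphi,\cdot)$ is integrable over $\mathbb{R}$ for every $\varphi$; for every $\lambda>0$ the function $\varphi\mapsto\hat P(y_\varphi,\lambda)$ is integrable on $[0,2\pi]$, and $H^{(1)}_{|k|}(\lambda R)\ne0$ for all $k\in\mathbb{Z}$. 2. For all $\lambda>0$ and all $\varphi$, the series $S(\lambda,\varphi)$ converges absolutely, and for $\Lambda=\lambda(\cos\varphi,\sin\varphi)$ $$\hat f(\Lambda)=\frac2\pi\,S(\lambda,\varphi)=\frac{2}{\pi}\sum_{k=-\infty}^{\infty}\frac{(-i)^{|k|}\hat P_k(\lambda)}{\lambda H^{(1)}_{|k|}(\lambda R)}e^{ik\varphi}.$$ 3. For all $r\ge0$ and all $\theta$, $$f(r\cos\theta,r\sin\theta)=\frac1{\pi^2}\int_0^\infty\int_0^{2\pi}S(\lambda,\varphi)\,e^{i\lambda r\cos(\theta-\varphi)}\,d\varphi\,\lambda\,d\lambda,$$ where the double integral converges absolutely. 4. At the origin, $$\hat f(0)=\int_0^\infty\frac{2\hat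 P_0(\lambda)}{\pi\lambda H^{(1)}_0(\lambda R)}\,R\,J_1(\lambda R)\,d\lambda,$$ where the integral converges absolutely. -/

import Mathlib

open MeasureTheory Set
open scoped Laplacian

noncomputable section

namespace TAT

/-- The plane `ℝ²` with its Euclidean norm. -/
abbrev Plane : Type := EuclideanSpace ℝ (Fin 2)

/-- The unit vector `(cos φ, sin φ)`. -/
def dir (φ : ℝ) : Plane := !₂[Real.cos φ, Real.sin φ]

/-- The Bessel function of the first kind `J_n(x)`, of integer order `n ≥ 0`
(Bessel's integral). -/
def besselJ (n : ℕ) (x : ℝ) : ℝ :=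
  1 / Real.pi * ∫ θ in (0 : ℝ)..Real.pi, Real.cos (n * θ - x * Real.sin θ)

/-- The Bessel function of the second kind `Y_n(x)`, of integer order `n ≥ 0`, for `x > 0`
(Schläfli's integral; both integrals converge absolutely for `x > 0`). -/
def besselY (n : ℕ) (x : ℝ) : ℝ :=
  1 / Real.pi * (∫ θ in (0 : ℝ)..Real.pi, Real.sin (x * Real.sin θ - n * θ))
    - 1 / Real.pi * ∫ t in Ioi (0 : ℝ),
        (Real.exp (n * t) + (-1) ^ n * Real.exp (-(n * t))) * Real.exp (-(x * Real.sinh t))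

/-- The Hankel function of the first kind `H_n^{(1)}(x) = J_n(x) + i Y_n(x)`, for `x > 0`. -/
def hankel1 (n : ℕ) (x : ℝ) : ℂ := (besselJ n x : ℂ) + Complex.I * (besselY n x : ℂ)

/-- `u` is a classical solution of `u_tt = Δu` on `ℝ² × [0, ∞)` with `u(x,0) = f(x)` and
`u_t(x,0) = 0`. It is twice continuously differentiable up to `t = 0`, where the time derivatives
are one-sided; the values `u x t` with `t < 0` play no role. -/
structure IsWaveSolution (f : Plane → ℝ) (u : Plane → ℝ → ℝ) : Prop where
  contDiffOn : ContDiffOn ℝ 2 (fun p : Plane × ℝ => u p.1 p.2) (univ ×ˢ Ici 0)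
  wave_eq : ∀ x : Plane, ∀ t : ℝ, 0 ≤ t →
    iteratedDerivWithin 2 (u x) (Ici 0) t = Δ (fun z : Plane => u z t) x
  initial_value : ∀ x : Plane, u x 0 = f x
  initial_velocity : ∀ x : Plane, derivWithin (u x) (Ici 0) 0 = 0

/-- The detector data `P(y, t) = u(y, t)`, `t ≥ 0`, at the point `y = R (cos φ, sin φ)` of the
circle of radius `R`, extended by zero to `t < 0`. -/
def detectorData (R : ℝ) (u : Plane → ℝ → ℝ) (φ t : ℝ) : ℝ :=
  if 0 ≤ t then u (R • dir φ) t else 0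

/-- The time-Fourier transform `P̂(y, l) = ∫ P(y, t) e^{i t l} dt`, `y = R (cos φ, sin φ)`. -/
def dataHat (R : ℝ) (u : Plane → ℝ → ℝ) (φ l : ℝ) : ℂ :=
  ∫ t : ℝ, (detectorData R u φ t : ℂ) * Complex.exp (Complex.I * t * l)

/-- The angular Fourier coefficient
`P̂_k(l) = (1/2π) ∫_0^{2π} P̂(R (cos φ, sin φ), l) e^{-i k φ} dφ`. -/
def dataCoeff (R : ℝ) (u : Plane → ℝ → ℝ) (k : ℤ) (l : ℝ) : ℂ :=
  1 / (2 * Real.pi) *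
    ∫ φ in (0 : ℝ)..(2 * Real.pi), dataHat R u φ l * Complex.exp (-(Complex.I * k * φ))

/-- The term `(-i)^{|k|} P̂_k(l) e^{i k φ} / (l H_{|k|}^{(1)}(l R))`. -/
def seriesTerm (R : ℝ) (u : Plane → ℝ → ℝ) (l φ : ℝ) (k : ℤ) : ℂ :=
  (-Complex.I) ^ k.natAbs * dataCoeff R u k l / (l * hankel1 k.natAbs (l * R))
    * Complex.exp (Complex.I * k * φ)

/-- The two-dimensional Fourier transform `f̂(Λ) = (1/2π) ∫ f(x) e^{-i x·Λ} dx`. -/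
def fourier2 (f : Plane → ℝ) (Λ : Plane) : ℂ :=
  1 / (2 * Real.pi) * ∫ x : Plane, (f x : ℂ) * Complex.exp (-(Complex.I * (inner ℝ x Λ : ℝ)))

end TAT

end

/-! Everything reduces to one identity between angular modes. Let `f_k(r)` be the integral of `f(r
cos α, r sin α) e^{-ikα}` over a period. Then, for real `l > 0`, `P̂_k(l) = (l/4) H_{|k|}(lR) ∫_0^R
r f_k(r) J_{|k|}(lr) dr` (`dataCoeff_eq`). Expanding plane waves in Bessel functions, the same
radial integral times `(-i)^{|k|}` is the `k`-th angular integral of `f̂` on the circle of radius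
`l` (`integral_fourier2_mul_exp`). Dividing by the Hankel function therefore turns `S(l, ·)` into
the Fourier series of `(π/2) f̂(l ·)`.

To get the identity, take `l` with positive real and imaginary parts and transform the solution in
time over `[0, T]`. The `k`-th angular mode `w` satisfies `(r w')' = (k²/r - l² r) w + r (B_T + i l
f_k)`, where `B_T` comes from the cut at time `T`. Green's identity is applied with `J_{|k|}(lr)` on
`[0, R]`, and with `H_{|k|}(lr)` from `R` to a radius that the wave has not reached by time `T`.
Eliminating `w'(R)` between the two leaves `w(R)` times the Wronskian `2i/π`
(`modeTrunc_mul_wronskian`). As `T → ∞` the terms with `B_T` vanish, since the solution and its time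
derivative grow at most linearly while `e^{iTl}` decays exponentially (`tendsto_modeTrunc`). Then
the imaginary part of `l` tends to zero; dominated convergence applies because the data decay like
`t⁻²` (`integral_angMode_mul_exp`). Finite speed, decay and growth are all read off Poisson's
formula (`IsExtendedWave.poisson`).

The Wronskian also shows that the Hankel functions have no positive zeros: `J_n` is real there, so a
zero of `H_n` would be a zero of `J_n`. The series converges absolutely because `k² |J_k(x)| ≤ x² +
|x|`. The plane wave formula is Fourier inversion in polar coordinates; `f̂` is integrable because
`(1 + |Λ|²) f̂` and `(1 + |Λ|²)⁻¹` are both square integrable in the plane. At the origin, `f` is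
integrated over the disk, inversion is inserted, and the transform of the disk, `2πR J_1(lR)/l`,
appears. -/

namespace TAT

open Filter Topology

/-! ### Parametric interval integrals -/

section Parametric

variable {E : Type*} [NormedAddCommGroup E] [NormedSpace ℝ E]

/-- Differentiation under an interval integral, for integrands that are jointly continuous together
with their derivative in the parameter. -/
theorem hasDerivAt_intervalIntegral_of_continuous {𝕜 : Type*} [RCLike 𝕜] [NormedSpace 𝕜 E]
    {F F' : 𝕜 → ℝ → E} (hF : Continuous (Function.uncurry F))
    (hF' : Continuous (Function.uncurry F')) {a b : ℝ} (hab : a ≤ b) {V : Set 𝕜} (hV : IsOpen V)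
    (hd : ∀ x ∈ V, ∀ s ∈ Ioo a b, HasDerivAt (fun x => F x s) (F' x s) x) {x₀ : 𝕜} (hx₀ : x₀ ∈ V) :
    HasDerivAt (fun x => ∫ s in a..b, F x s) (∫ s in a..b, F' x₀ s) x₀ := by
  obtain ⟨δ, hδ, hball⟩ := Metric.isOpen_iff.1 hV x₀ hx₀
  obtain ⟨C, hC⟩ := ((isCompact_closedBall x₀ δ).prod (isCompact_Icc (a := a) (b := b))).exists_bound_of_continuousOn
    hF'.continuousOn
  -- The right endpoint is a null set, so the derivative is needed only at interior `s`. This is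
  -- what admits time integrals over `[0, T]` of functions differentiable only for `t > 0`.
  have hIoo : ∀ᵐ s : ℝ ∂volume, s ∈ uIoc a b → s ∈ Ioo a b := by
    have : ∀ᵐ s : ℝ ∂volume, s ≠ b := by simp [ae_iff]
    filter_upwards [this] with s hs hs'
    rw [uIoc_of_le hab] at hs'
    exact ⟨hs'.1, lt_of_le_of_ne hs'.2 hs⟩
  refine (intervalIntegral.hasDerivAt_integral_of_dominated_loc_of_deriv_le
    (bound := fun _ => C) (Metric.ball_mem_nhds x₀ hδ) ?_ ?_ ?_ ?_ ?_ ?_).2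
  · exact Eventually.of_forall fun x => (hF.comp (by fun_prop : Continuous fun s : ℝ => (x, s))).aestronglyMeasurable
  · exact (hF.comp (by fun_prop : Continuous fun s : ℝ => (x₀, s))).intervalIntegrable _ _
  · exact (hF'.comp (by fun_prop : Continuous fun s : ℝ => (x₀, s))).aestronglyMeasurable
  · refine Eventually.of_forall fun s hs x hx => ?_
    rw [uIoc_of_le hab] at hs
    exact hC (x, s) ⟨Metric.ball_subset_closedBall hx, hs.1.le, hs.2⟩
  · exact intervalIntegrable_const
  · filter_upwards [hIoo] with s hs hs' x hx
    exact hd x (hball hx) s (hs hs')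

theorem continuous_intervalIntegral {X : Type*} [TopologicalSpace X] {f : X → ℝ → E}
    (hf : Continuous (Function.uncurry f)) (a b : ℝ) : Continuous fun x => ∫ t in a..b, f x t :=
  intervalIntegral.continuous_parametric_intervalIntegral_of_continuous' hf a b

/-- Differentiation under an iterated interval integral. -/
theorem hasDerivAt_intervalIntegral₂_of_continuous {F F' : ℝ → ℝ → ℝ → E}
    (hF : Continuous fun p : ℝ × ℝ × ℝ => F p.1 p.2.1 p.2.2)
    (hF' : Continuous fun p : ℝ × ℝ × ℝ => F' p.1 p.2.1 p.2.2) {a b c d : ℝ} (hab : a ≤ b)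
    (hcd : c ≤ d) {V : Set ℝ} (hV : IsOpen V)
    (hd : ∀ x ∈ V, ∀ s ∈ Ioo a b, ∀ t ∈ Ioo c d, HasDerivAt (fun x => F x s t) (F' x s t) x)
    {x₀ : ℝ} (hx₀ : x₀ ∈ V) :
    HasDerivAt (fun x => ∫ s in a..b, ∫ t in c..d, F x s t)
      (∫ s in a..b, ∫ t in c..d, F' x₀ s t) x₀ := by
  refine hasDerivAt_intervalIntegral_of_continuous (F := fun x s => ∫ t in c..d, F x s t)
    (F' := fun x s => ∫ t in c..d, F' x s t) ?_ ?_ hab hV ?_ hx₀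
  · exact continuous_intervalIntegral (f := fun (p : ℝ × ℝ) t => F p.1 p.2 t)
      (hF.comp (by fun_prop : Continuous fun q : (ℝ × ℝ) × ℝ => (q.1.1, q.1.2, q.2))) c d
  · exact continuous_intervalIntegral (f := fun (p : ℝ × ℝ) t => F' p.1 p.2 t)
      (hF'.comp (by fun_prop : Continuous fun q : (ℝ × ℝ) × ℝ => (q.1.1, q.1.2, q.2))) c d
  · intro x hx s hs
    refine hasDerivAt_intervalIntegral_of_continuous (F := fun x t => F x s t)
      (F' := fun x t => F' x s t) ?_ ?_ hcd hV (fun x hx t ht => hd x hx s hs t ht) hx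
    · exact hF.comp (by fun_prop : Continuous fun q : ℝ × ℝ => (q.1, s, q.2))
    · exact hF'.comp (by fun_prop : Continuous fun q : ℝ × ℝ => (q.1, s, q.2))

theorem intervalIntegral_swap_of_continuous {F : ℝ → ℝ → E}
    (hF : Continuous (Function.uncurry F)) (a b c d : ℝ) :
    ∫ x in a..b, ∫ y in c..d, F x y = ∫ y in c..d, ∫ x in a..b, F x y := by
  apply intervalIntegral_intervalIntegral_swap
  refine (hF.continuousOn.integrableOn_compact
    (isCompact_uIcc (a := a) (b := b) |>.prod (isCompact_uIcc (a := c) (b := d)))).mono_set ?_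
  exact prod_mono uIoc_subset_uIcc uIoc_subset_uIcc

theorem norm_intervalIntegral₂_le {F : ℝ → ℝ → E} {a b c d C : ℝ} (hab : a ≤ b) (hcd : c ≤ d)
    (h : ∀ s ∈ Ioc a b, ∀ t ∈ Ioc c d, ‖F s t‖ ≤ C) :
    ‖∫ s in a..b, ∫ t in c..d, F s t‖ ≤ C * (d - c) * (b - a) := by
  have := intervalIntegral.norm_integral_le_of_norm_le_const (a := a) (b := b)
    (f := fun s => ∫ t in c..d, F s t) (C := C * (d - c)) ?_
  · rwa [abs_of_nonneg (sub_nonneg.2 hab)] at this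
  · intro s hs
    rw [uIoc_of_le hab] at hs
    have := intervalIntegral.norm_integral_le_of_norm_le_const (a := c) (b := d)
      (f := fun t => F s t) (C := C) ?_
    · rwa [abs_of_nonneg (sub_nonneg.2 hcd)] at this
    · intro t ht
      rw [uIoc_of_le hcd] at ht
      exact h s hs t ht

end Parametric

/-! ### Polar coordinates on the plane -/

@[fun_prop]
theorem continuous_dir : Continuous dir := by
  unfold dir; fun_prop

theorem dir_apply_zero (φ : ℝ) : dir φ 0 = Real.cos φ := rfl

theorem dir_apply_one (φ : ℝ) : dir φ 1 = Real.sin φ := rfl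

theorem norm_dir (φ : ℝ) : ‖dir φ‖ = 1 := by
  rw [EuclideanSpace.norm_eq]
  simp [Fin.sum_univ_two, dir_apply_zero, dir_apply_one]

theorem norm_smul_dir {r : ℝ} (hr : 0 ≤ r) (φ : ℝ) : ‖r • dir φ‖ = r := by
  rw [norm_smul, norm_dir, Real.norm_of_nonneg hr, mul_one]

theorem inner_dir (α φ : ℝ) : inner ℝ (dir α) (dir φ) = Real.cos (α - φ) := by
  rw [PiLp.inner_apply]
  simp [Fin.sum_univ_two, dir_apply_zero, dir_apply_one, Real.cos_sub]
  ring

theorem dir_add_pi (φ : ℝ) : dir (φ + Real.pi) = - dir φ := by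
  ext i; fin_cases i <;> simp [dir]

theorem dir_add_two_pi (φ : ℝ) : dir (φ + 2 * Real.pi) = dir φ := by
  ext i; fin_cases i <;> simp [dir]

theorem hasDerivAt_dir (φ : ℝ) : HasDerivAt dir (dir (φ + Real.pi / 2)) φ := by
  have h : HasDerivAt (fun φ : ℝ => ![Real.cos φ, Real.sin φ])
      ![Real.cos (φ + Real.pi / 2), Real.sin (φ + Real.pi / 2)] φ := by
    rw [hasDerivAt_pi]
    intro i
    fin_cases i
    · simpa [Real.cos_add_pi_div_two] using Real.hasDerivAt_cos φ
    · simpa [Real.sin_add_pi_div_two] using Real.hasDerivAt_sin φ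
  exact ((PiLp.continuousLinearEquiv 2 ℝ (fun _ : Fin 2 => ℝ)).symm.toContinuousLinearMap.hasFDerivAt.comp_hasDerivAt
    φ h)

/-- The sector `r > 0`, `0 < φ ≤ 2π` of polar coordinates. -/
def polarSet : Set (ℝ × ℝ) := Ioi 0 ×ˢ Ioc 0 (2 * Real.pi)

theorem measurableSet_polarSet : MeasurableSet polarSet := measurableSet_Ioi.prod measurableSet_Ioc

/-- `polarCoord` uses angles in `(-π, π)`. Since `dir (φ + π) = -dir φ`, the reflection `x ↦ -x`
combined with a shift of the angle by `π` moves the sector to `(0, 2π]`. -/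
theorem lintegral_plane_polar (F : Plane → ENNReal) :
    ∫⁻ x, F x = ∫⁻ p in polarSet, ENNReal.ofReal p.1 * F (p.1 • dir p.2) := by
  have hneg : ∫⁻ x, F x = ∫⁻ x, F (-x) :=
    ((Measure.measurePreserving_neg (volume : Measure Plane)).lintegral_comp_emb
      (MeasurableEquiv.neg Plane).measurableEmbedding F).symm
  have h1 : ∫⁻ x : Plane, F (-x) = ∫⁻ p : ℝ × ℝ, F (-!₂[p.1, p.2]) := by
    have e1 : MeasurePreserving (MeasurableEquiv.finTwoArrow (α := ℝ)).symm :=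
      (volume_preserving_finTwoArrow ℝ).symm _
    have e2 := e1.lintegral_comp_emb (MeasurableEquiv.finTwoArrow (α := ℝ)).symm.measurableEmbedding
      (fun q => F (-(WithLp.toLp 2 q)))
    have e3 := (PiLp.volume_preserving_toLp (Fin 2)).lintegral_comp_emb
      (MeasurableEquiv.toLp 2 (Fin 2 → ℝ)).measurableEmbedding (fun x => F (-x))
    rw [← e3, ← e2]
    rfl
  have hset : polarCoord.target = (fun p : ℝ × ℝ => p + (0, Real.pi)) ⁻¹'
      (Ioi 0 ×ˢ Ioo 0 (2 * Real.pi)) := by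
    ext p
    simp only [polarCoord_target, mem_prod, mem_Ioi, mem_Ioo, mem_preimage, Prod.fst_add,
      Prod.snd_add, add_zero]
    constructor <;> rintro ⟨h1, h2, h3⟩ <;> exact ⟨h1, by linarith, by linarith⟩
  rw [hneg, h1, ← lintegral_comp_polarCoord_symm, hset]
  have h2 := (measurePreserving_add_right (volume : Measure (ℝ × ℝ)) (0, Real.pi)).setLIntegral_comp_preimage_emb
    (measurableEmbedding_addRight _) (fun p : ℝ × ℝ => ENNReal.ofReal p.1 * F (p.1 • dir p.2))
    (Ioi 0 ×ˢ Ioo 0 (2 * Real.pi))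
  have h3 : ∫⁻ p in polarSet, ENNReal.ofReal p.1 * F (p.1 • dir p.2)
      = ∫⁻ p in Ioi 0 ×ˢ Ioo 0 (2 * Real.pi), ENNReal.ofReal p.1 * F (p.1 • dir p.2) := by
    refine setLIntegral_congr ?_
    rw [polarSet, Measure.volume_eq_prod]
    exact Measure.set_prod_ae_eq (ae_eq_refl _) Ioo_ae_eq_Ioc.symm
  rw [h3, ← h2]
  refine lintegral_congr fun p => ?_
  simp only [Prod.fst_add, add_zero, Prod.snd_add, dir_add_pi, smul_eq_mul]
  congr 2
  ext i; fin_cases i <;> simp [dir, polarCoord]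

/-- Written as a push-forward, the polar formula transfers both integrability and Bochner integrals
of vector-valued functions. -/
theorem volume_plane_eq_map_polar :
    (volume : Measure Plane) = Measure.map (fun p : ℝ × ℝ => p.1 • dir p.2)
      ((volume.restrict polarSet).withDensity fun p => ENNReal.ofReal p.1) := by
  have hm : Measurable fun p : ℝ × ℝ => p.1 • dir p.2 := by
    have := continuous_dir
    exact (by fun_prop : Continuous fun p : ℝ × ℝ => p.1 • dir p.2).measurable
  ext s hs
  rw [Measure.map_apply hm hs, withDensity_apply _ (hm hs), ← lintegral_indicator_one hs,
    lintegral_plane_polar, ← lintegral_indicator (hm hs)]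
  refine lintegral_congr fun p => ?_
  by_cases h : p.1 • dir p.2 ∈ s
  · simp [indicator, h]
  · simp [indicator, h]

variable {E : Type*} [NormedAddCommGroup E] [NormedSpace ℝ E]

theorem integrable_plane_iff_polar {F : Plane → E} (hF : AEStronglyMeasurable F) :
    Integrable F ↔ IntegrableOn (fun p : ℝ × ℝ => p.1 • F (p.1 • dir p.2)) polarSet := by
  have hm : Measurable fun p : ℝ × ℝ => p.1 • dir p.2 := by
    have := continuous_dir
    exact (by fun_prop : Continuous fun p : ℝ × ℝ => p.1 • dir p.2).measurable
  have hF' := hF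
  rw [volume_plane_eq_map_polar] at hF' ⊢
  rw [integrable_map_measure hF' hm.aemeasurable,
    integrable_withDensity_iff_integrable_smul' (by fun_prop) (by simp), IntegrableOn]
  refine integrable_congr ?_
  filter_upwards [ae_restrict_mem measurableSet_polarSet] with p hp
  simp [ENNReal.toReal_ofReal (le_of_lt hp.1)]

theorem integral_plane_polar {F : Plane → E} (hF : AEStronglyMeasurable F) :
    ∫ x, F x = ∫ p in polarSet, p.1 • F (p.1 • dir p.2) := by
  have hm : Measurable fun p : ℝ × ℝ => p.1 • dir p.2 := by
    have := continuous_dir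
    exact (by fun_prop : Continuous fun p : ℝ × ℝ => p.1 • dir p.2).measurable
  have hF' := hF
  rw [volume_plane_eq_map_polar] at hF'
  rw [volume_plane_eq_map_polar, integral_map hm.aemeasurable hF',
    integral_withDensity_eq_integral_toReal_smul (by fun_prop) (by simp)]
  refine integral_congr_ae ?_
  filter_upwards [ae_restrict_mem measurableSet_polarSet] with p hp
  simp [ENNReal.toReal_ofReal (le_of_lt hp.1)]

theorem integral_plane_polar_iterated {F : Plane → E} (hF : Integrable F) :
    ∫ x, F x = ∫ r in Ioi (0 : ℝ), r • ∫ φ in (0 : ℝ)..(2 * Real.pi), F (r • dir φ) := by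
  rw [integral_plane_polar hF.1, polarSet, Measure.volume_eq_prod, setIntegral_prod]
  · refine setIntegral_congr_fun measurableSet_Ioi fun r _ => ?_
    simp only [intervalIntegral.integral_of_le Real.two_pi_pos.le]
    exact integral_smul _ _
  · exact (integrable_plane_iff_polar hF.1).1 hF


/-! ### Integrability of the Fourier transform -/

section Fourier

open scoped FourierTransform SchwartzMap

variable {V : Type*} [NormedAddCommGroup V] [InnerProductSpace ℝ V] [FiniteDimensional ℝ V]
  [MeasurableSpace V] [BorelSpace V]

theorem continuous_fourier_of_integrable {g : V → ℂ} (hg : Integrable g) : Continuous (𝓕 g) :=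
  VectorFourier.fourierIntegral_continuous Real.continuous_fourierChar
    (by exact continuous_inner) hg

/-- The Fourier integral of an integrable and square integrable function is square integrable. -/
theorem memLp_two_fourier {g : V → ℂ} (hg : Integrable g) (hg2 : MemLp g 2) : MemLp (𝓕 g) 2 := by
  -- The integral transform and the `L²` transform coincide as distributions: moving the transform
  -- onto a test function gives the same pairing for both.
  have key : ∀ᵐ x, 𝓕 g x = (𝓕 (hg2.toLp g) : Lp ℂ 2 (volume : Measure V)) x := by
    refine ae_eq_of_integral_contDiff_smul_eq
      (continuous_fourier_of_integrable hg).locallyIntegrable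
      ((Lp.memLp _).locallyIntegrable (by norm_num)) fun φ hφ hφc => ?_
    set ψ : 𝓢(V, ℂ) := (hφc.comp_left (g := ((↑) : ℝ → ℂ)) Complex.ofReal_zero).toSchwartzMap
      (Complex.ofRealCLM.contDiff.comp hφ) with hψ
    have hψφ : ∀ x, ψ x = (φ x : ℂ) := fun x => rfl
    have h1 := congrArg (fun T => T ψ) (Lp.fourier_toTemperedDistribution_eq (hg2.toLp g))
    simp only [TemperedDistribution.fourier_apply, Lp.toTemperedDistribution_apply] at h1
    have h2 : ∫ x, (𝓕 ψ) x • (hg2.toLp g) x = ∫ x, 𝓕 (ψ : V → ℂ) x • g x := by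
      refine integral_congr_ae ?_
      filter_upwards [hg2.coeFn_toLp] with x hx
      rw [hx, SchwartzMap.fourier_coe]
    have h3 : ∫ x, 𝓕 (ψ : V → ℂ) x • g x = ∫ x, ψ x • 𝓕 g x := by
      have := VectorFourier.integral_fourierIntegral_smul_eq_flip (L := innerₗ V)
        Real.continuous_fourierChar (by exact continuous_inner) (ψ.integrable (μ := volume)) hg
      rwa [flip_innerₗ] at this
    rw [h2, h3] at h1
    simpa only [hψφ, Complex.real_smul, smul_eq_mul] using h1
  exact (memLp_congr_ae key).2 (Lp.memLp _)

theorem fourier_fderiv_apply {f : V → ℂ} (hf : ContDiff ℝ 1 f) (hfc : HasCompactSupport f)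
    (e w : V) : 𝓕 (fun x => fderiv ℝ f x e) w = 2 * Real.pi * Complex.I * (inner ℝ e w : ℝ) * 𝓕 f w := by
  have hc := hf.continuous_fderiv one_ne_zero
  have hi : Integrable (fderiv ℝ f) := hc.integrable_of_hasCompactSupport (hfc.fderiv ℝ)
  have h := congrFun (Real.fourier_fderiv (hf.continuous.integrable_of_hasCompactSupport hfc)
    (hf.differentiable one_ne_zero) hi) w
  have h2 := Real.fourier_continuousLinearMap_apply (f := fderiv ℝ f) (a := e) (v := w) hi
  rw [← h2, h, real_inner_comm]
  simp
  rw [innerSL_apply_apply]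
  ring

/-- The Fourier transform of a compactly supported `C²` function on the plane is integrable. -/
theorem integrable_fourier_of_contDiff_two {f : Plane → ℂ} (hf : ContDiff ℝ 2 f)
    (hfc : HasCompactSupport f) : Integrable (𝓕 f) := by
  have hmem : ∀ g : Plane → ℂ, Continuous g → HasCompactSupport g → MemLp (𝓕 g) 2 :=
    fun g hg hgc => memLp_two_fourier (hg.integrable_of_hasCompactSupport hgc)
      (hg.memLp_of_hasCompactSupport hgc)
  have hD : ∀ e : Plane, MemLp (fun w : Plane => (((inner ℝ e w : ℝ) ^ 2 : ℝ) : ℂ) * 𝓕 f w) 2 := by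
    intro e
    have hc1 : ContDiff ℝ 1 (fun x => fderiv ℝ f x e) :=
      (hf.fderiv_right (m := 1) (by norm_num)).clm_apply contDiff_const
    have hs1 : HasCompactSupport (fun x => fderiv ℝ f x e) := hfc.fderiv_apply ℝ e
    -- Two derivatives along `e` multiply the transform by `(2πi ⟨e, w⟩)² = -4π² ⟨e, w⟩²`; the
    -- constant divides this out.
    have h2 := (hmem (fun x => fderiv ℝ (fun x => fderiv ℝ f x e) x e)
      ((hc1.continuous_fderiv one_ne_zero).clm_apply continuous_const)
      (hs1.fderiv_apply ℝ e)).const_mul (-(4 * (Real.pi : ℂ) ^ 2)⁻¹)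
    refine (memLp_congr_ae (Eventually.of_forall fun w => ?_)).1 h2
    have hpi : (Real.pi : ℂ) ≠ 0 := by exact_mod_cast Real.pi_ne_zero
    rw [fourier_fderiv_apply hc1 hs1, fourier_fderiv_apply (hf.of_le (by norm_num)) hfc]
    push_cast
    field_simp
    rw [Complex.I_sq]
    ring
  have hsum : MemLp (fun w : Plane => ((1 + ‖w‖ ^ 2 : ℝ) : ℂ) * 𝓕 f w) 2 := by
    refine (memLp_congr_ae (Eventually.of_forall fun w => ?_)).1
      (((hmem f hf.continuous hfc).add (hD (EuclideanSpace.single 0 1))).add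
        (hD (EuclideanSpace.single 1 1)))
    simp only [Pi.add_apply, EuclideanSpace.norm_sq_eq, Fin.sum_univ_two,
      EuclideanSpace.inner_single_left]
    simp
    ring
  have hw : MemLp (fun w : Plane => (((1 + ‖w‖ ^ 2)⁻¹ : ℝ) : ℂ)) 2 := by
    have hc : Continuous fun w : Plane => (((1 + ‖w‖ ^ 2)⁻¹ : ℝ) : ℂ) := by
      refine Complex.continuous_ofReal.comp (Continuous.inv₀ (by fun_prop) fun w => by positivity)
    rw [memLp_two_iff_integrable_sq_norm hc.aestronglyMeasurable]
    -- The exponent `r = 4` exceeds the dimension 2, and `(1 + |w|²)^{-4/2}` is the square of the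
    -- weight.
    have := integrable_rpow_neg_one_add_norm_sq (E := Plane) (μ := volume) (r := 4) (by simp; norm_num)
    refine this.congr (Eventually.of_forall fun w => ?_)
    have hp : (0 : ℝ) < 1 + ‖w‖ ^ 2 := by positivity
    simp only [Complex.norm_real, norm_inv, Real.norm_of_nonneg hp.le]
    rw [show (-4 / 2 : ℝ) = -(2 : ℕ) by norm_num, Real.rpow_neg hp.le, Real.rpow_natCast, inv_pow]
  refine (hw.integrable_mul hsum).congr (Eventually.of_forall fun w => ?_)
  have hp : ((1 + ‖w‖ ^ 2 : ℝ) : ℂ) ≠ 0 := by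
    exact_mod_cast (by positivity : (0 : ℝ) < 1 + ‖w‖ ^ 2).ne'
  simp only [Pi.mul_apply, Complex.ofReal_inv]
  rw [inv_mul_cancel_left₀ hp]

/-- Mathlib's transform carries `2π` in the exponent, whence the rescaled frequency. -/
theorem fourier2_eq_fourier (f : Plane → ℝ) (Λ : Plane) :
    fourier2 f Λ = (2 * Real.pi : ℂ)⁻¹ * 𝓕 (fun x => (f x : ℂ)) ((2 * Real.pi)⁻¹ • Λ) := by
  rw [fourier2, Real.fourier_eq', one_div]
  congr 1
  refine integral_congr_ae (Eventually.of_forall fun x => ?_)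
  simp only [inner_smul_right, smul_eq_mul]
  rw [mul_comm]
  congr 2
  push_cast
  have hpi : (Real.pi : ℂ) ≠ 0 := by exact_mod_cast Real.pi_ne_zero
  field_simp

variable {f : Plane → ℝ}

theorem contDiff_ofReal_comp (hf : ContDiff ℝ 2 f) : ContDiff ℝ 2 fun x => (f x : ℂ) :=
  Complex.ofRealCLM.contDiff.comp hf

theorem hasCompactSupport_ofReal_comp (hfc : HasCompactSupport f) :
    HasCompactSupport fun x => (f x : ℂ) :=
  hfc.comp_left (g := ((↑) : ℝ → ℂ)) Complex.ofReal_zero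

theorem continuous_fourier2 (hf : ContDiff ℝ 2 f) (hfc : HasCompactSupport f) :
    Continuous (fourier2 f) := by
  have h := continuous_fourier_of_integrable
    ((contDiff_ofReal_comp hf).continuous.integrable_of_hasCompactSupport
      (hasCompactSupport_ofReal_comp hfc))
  rw [show fourier2 f = _ from funext (fourier2_eq_fourier f)]
  fun_prop

theorem integrable_fourier2 (hf : ContDiff ℝ 2 f) (hfc : HasCompactSupport f) :
    Integrable (fourier2 f) := by
  rw [show fourier2 f = _ from funext (fourier2_eq_fourier f)]
  exact ((integrable_fourier_of_contDiff_two (contDiff_ofReal_comp hf)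
    (hasCompactSupport_ofReal_comp hfc)).comp_smul (by positivity)).const_mul _

/-- Fourier inversion on the plane, with the normalisation of `fourier2`. -/
theorem eq_integral_fourier2 (hf : ContDiff ℝ 2 f) (hfc : HasCompactSupport f) (x : Plane) :
    (f x : ℂ) = 1 / (2 * Real.pi) *
      ∫ Λ : Plane, fourier2 f Λ * Complex.exp (Complex.I * (inner ℝ x Λ : ℝ)) := by
  have hc := contDiff_ofReal_comp hf
  have hs := hasCompactSupport_ofReal_comp hfc
  have hpi : (Real.pi : ℂ) ≠ 0 := by exact_mod_cast Real.pi_ne_zero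
  have h := congrFun (hc.continuous.fourierInv_fourier_eq
    (hc.continuous.integrable_of_hasCompactSupport hs) (integrable_fourier_of_contDiff_two hc hs)) x
  rw [← h, Real.fourierInv_eq']
  have h2 := Measure.integral_comp_smul (volume : Measure Plane)
    (fun Λ => fourier2 f Λ * Complex.exp (Complex.I * (inner ℝ x Λ : ℝ))) (2 * Real.pi)
  simp only [finrank_euclideanSpace, Fintype.card_fin] at h2
  rw [abs_of_pos (by positivity), eq_inv_smul_iff₀ (by positivity)] at h2
  rw [← h2, Complex.real_smul, ← mul_assoc, ← integral_const_mul]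
  refine integral_congr_ae (Eventually.of_forall fun ξ => ?_)
  simp only [fourier2_eq_fourier, smul_smul, inner_smul_right]
  rw [inv_mul_cancel₀ (by positivity), one_smul, real_inner_comm, smul_eq_mul]
  push_cast
  rw [show Complex.I * (2 * Real.pi * (inner ℝ x ξ : ℝ)) = 2 * Real.pi * (inner ℝ x ξ : ℝ) * Complex.I by ring]
  field_simp

end Fourier


/-! ### Bessel and Hankel functions of integer order and complex argument -/

/-- The integral `∫_a^b e^{i (z sin s - n s)} ds`. -/
noncomputable def oscInt (a b : ℝ) (n : ℤ) (z : ℂ) : ℂ :=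
  ∫ s in a..b, Complex.exp (Complex.I * (z * Real.sin s - n * s))

/-- The integral `∫_0^∞ e^{m t - z sinh t} dt`, for `0 < re z`. -/
noncomputable def expInt (m : ℤ) (z : ℂ) : ℂ :=
  ∫ t in Ioi (0 : ℝ), Complex.exp (m * t - z * Real.sinh t)

/-- The Bessel function `J_n(z)`. -/
noncomputable def besselJC (n : ℤ) (z : ℂ) : ℂ :=
  1 / (2 * Real.pi) * oscInt (-Real.pi) Real.pi n z

/-- The Hankel function `H_n^{(1)}(z)`, for `0 < re z`. -/
noncomputable def hankelC (n : ℤ) (z : ℂ) : ℂ :=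
  1 / Real.pi * (oscInt 0 Real.pi n z - Complex.I * (expInt n z + (-1) ^ n * expInt (-n) z))

theorem hasDerivAt_oscInt {a b : ℝ} (hab : a ≤ b) (n : ℤ) (z : ℂ) :
    HasDerivAt (oscInt a b n) ((oscInt a b (n - 1) z - oscInt a b (n + 1) z) / 2) z := by
  have hs : ∀ s : ℝ, Complex.exp (Complex.I * (z * Real.sin s - n * s)) * (Complex.I * Real.sin s)
      = (Complex.exp (Complex.I * (z * Real.sin s - (n - 1 : ℤ) * s))
        - Complex.exp (Complex.I * (z * Real.sin s - (n + 1 : ℤ) * s))) / 2 := by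
    intro s
    have e1 : Complex.I * (z * Real.sin s - (n - 1 : ℤ) * s)
        = Complex.I * (z * Real.sin s - n * s) + s * Complex.I := by push_cast; ring
    have e2 : Complex.I * (z * Real.sin s - (n + 1 : ℤ) * s)
        = Complex.I * (z * Real.sin s - n * s) + -s * Complex.I := by push_cast; ring
    rw [e1, e2, Complex.exp_add, Complex.exp_add]
    generalize Complex.exp (Complex.I * (z * Real.sin s - n * s)) = e
    rw [Complex.ofReal_sin, Complex.sin]
    linear_combination (e * (Complex.exp (-s * Complex.I) - Complex.exp (s * Complex.I)) / 2) *
      Complex.I_sq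
  have h := hasDerivAt_intervalIntegral_of_continuous
    (F := fun (z : ℂ) (s : ℝ) => Complex.exp (Complex.I * (z * Real.sin s - n * s)))
    (F' := fun (z : ℂ) (s : ℝ) => Complex.exp (Complex.I * (z * Real.sin s - n * s)) *
      (Complex.I * Real.sin s)) (by fun_prop) (by fun_prop) hab isOpen_univ ?_ (mem_univ z)
  · refine h.congr_deriv ?_
    rw [oscInt, oscInt, ← intervalIntegral.integral_sub
      (Continuous.intervalIntegrable (by fun_prop) _ _)
      (Continuous.intervalIntegrable (by fun_prop) _ _), ← intervalIntegral.integral_div]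
    simp only [hs]
  · intro z _ s _
    refine HasDerivAt.cexp ?_
    simpa using (((hasDerivAt_id z).mul_const (Real.sin s : ℂ)).sub_const ((n : ℂ) * s)).const_mul
      Complex.I

/-- Integrate the `s`-derivative of the integrand over `[a, b]`. The endpoint terms are kept: they
cancel by periodicity for the Bessel functions, and against those of `expInt` for the Hankel
functions. -/
theorem oscInt_recurrence (a b : ℝ) (n : ℤ) (z : ℂ) :
    z * (oscInt a b (n - 1) z + oscInt a b (n + 1) z) = 2 * n * oscInt a b n z
      - 2 * Complex.I * (Complex.exp (Complex.I * (z * Real.sin b - n * b))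
        - Complex.exp (Complex.I * (z * Real.sin a - n * a))) := by
  have hd : ∀ s : ℝ, HasDerivAt (fun s : ℝ => Complex.exp (Complex.I * (z * Real.sin s - n * s)))
      (Complex.exp (Complex.I * (z * Real.sin s - n * s)) *
        (Complex.I * (z * Real.cos s - n))) s := by
    intro s
    refine HasDerivAt.cexp (HasDerivAt.const_mul _ ?_)
    refine HasDerivAt.sub ((Real.hasDerivAt_sin s).ofReal_comp.const_mul z) ?_
    simpa using (hasDerivAt_id s).ofReal_comp.const_mul (n : ℂ)
  have h := intervalIntegral.integral_eq_sub_of_hasDerivAt (a := a) (b := b)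
    (fun s _ => hd s) (Continuous.intervalIntegrable (by fun_prop) _ _)
  rw [← h, oscInt, oscInt, oscInt, ← intervalIntegral.integral_add
      (Continuous.intervalIntegrable (by fun_prop) _ _)
      (Continuous.intervalIntegrable (by fun_prop) _ _), ← intervalIntegral.integral_const_mul,
      ← intervalIntegral.integral_const_mul, ← intervalIntegral.integral_const_mul,
      ← intervalIntegral.integral_sub
      (Continuous.intervalIntegrable (by fun_prop) _ _)
      (Continuous.intervalIntegrable (by fun_prop) _ _)]
  refine intervalIntegral.integral_congr fun s _ => ?_
  have e1 : Complex.I * (z * Real.sin s - (n - 1 : ℤ) * s)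
      = Complex.I * (z * Real.sin s - n * s) + s * Complex.I := by push_cast; ring
  have e2 : Complex.I * (z * Real.sin s - (n + 1 : ℤ) * s)
      = Complex.I * (z * Real.sin s - n * s) + -s * Complex.I := by push_cast; ring
  rw [e1, e2, Complex.exp_add, Complex.exp_add, Complex.ofReal_cos, Complex.cos]
  linear_combination (2 * (z * (Complex.exp (s * Complex.I) + Complex.exp (-s * Complex.I)) / 2 - n) *
    Complex.exp (Complex.I * (z * Real.sin s - n * s))) * Complex.I_sq

theorem sq_div_four_le_sinh {t : ℝ} (ht : 0 ≤ t) : t ^ 2 / 4 ≤ Real.sinh t := by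
  have h1 := Real.quadratic_le_exp_of_nonneg ht
  have h2 : Real.exp (-t) ≤ 1 := Real.exp_le_one_iff.2 (by linarith)
  rw [Real.sinh_eq]
  linarith

/-- By `sinh t ≥ t²/4` and completing the square, `m t - δ sinh t ≤ -t + (m+1)²/δ`, so a multiple of
`e^{-t}` dominates. -/
theorem integrableOn_exp_sub_sinh (m : ℝ) {δ : ℝ} (hδ : 0 < δ) :
    IntegrableOn (fun t : ℝ => Real.exp (m * t - δ * Real.sinh t)) (Ioi 0) := by
  have hi : IntegrableOn (fun t : ℝ => Real.exp ((m + 1) ^ 2 / δ) * Real.exp (-t)) (Ioi 0) :=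
    (integrableOn_exp_neg_Ioi 0).const_mul _
  refine Integrable.mono' hi (by fun_prop) ?_
  filter_upwards [ae_restrict_mem measurableSet_Ioi] with t ht
  rw [Real.norm_of_nonneg (Real.exp_pos _).le, ← Real.exp_add, Real.exp_le_exp]
  have h1 := mul_le_mul_of_nonneg_left (sq_div_four_le_sinh (le_of_lt ht)) hδ.le
  have h2 : 0 ≤ (δ * t / 2 - (m + 1)) ^ 2 / δ := by positivity
  have h3 : (δ * t / 2 - (m + 1)) ^ 2 / δ = δ * (t ^ 2 / 4) - (m + 1) * t + (m + 1) ^ 2 / δ := by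
    field_simp; ring
  linarith

theorem norm_exp_sub_sinh (m : ℤ) (z : ℂ) (t : ℝ) :
    ‖Complex.exp (m * t - z * Real.sinh t)‖ = Real.exp (m * t - z.re * Real.sinh t) := by
  rw [Complex.norm_exp]
  congr 1
  rw [Complex.sub_re, Complex.re_mul_ofReal, Complex.re_mul_ofReal, Complex.intCast_re]

theorem integrableOn_cexp_sub_sinh (m : ℤ) {z : ℂ} (hz : 0 < z.re) :
    IntegrableOn (fun t : ℝ => Complex.exp (m * t - z * Real.sinh t)) (Ioi 0) := by
  refine Integrable.mono' (integrableOn_exp_sub_sinh m hz) (by fun_prop)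
    (Eventually.of_forall fun t => ?_)
  rw [norm_exp_sub_sinh]

theorem cexp_shift (m : ℤ) (z : ℂ) (t : ℝ) :
    Complex.exp ((m + 1 : ℤ) * t - z * Real.sinh t)
      = Complex.exp (m * t - z * Real.sinh t) * Complex.exp t ∧
    Complex.exp ((m - 1 : ℤ) * t - z * Real.sinh t)
      = Complex.exp (m * t - z * Real.sinh t) * Complex.exp (-t) := by
  constructor
  · rw [← Complex.exp_add]; push_cast; ring_nf
  · rw [← Complex.exp_add]; push_cast; ring_nf

theorem hasDerivAt_expInt (m : ℤ) {z : ℂ} (hz : 0 < z.re) :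
    HasDerivAt (expInt m) ((expInt (m - 1) z - expInt (m + 1) z) / 2) z := by
  have hs : ∀ (z : ℂ) (t : ℝ), Complex.exp (m * t - z * Real.sinh t) * -(Real.sinh t : ℂ)
      = (Complex.exp ((m - 1 : ℤ) * t - z * Real.sinh t)
        - Complex.exp ((m + 1 : ℤ) * t - z * Real.sinh t)) / 2 := by
    intro z t
    rw [(cexp_shift m z t).1, (cexp_shift m z t).2, Complex.ofReal_sinh, Complex.sinh]
    ring
  have h := (hasDerivAt_integral_of_dominated_loc_of_deriv_le (μ := volume.restrict (Ioi (0 : ℝ)))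
    (F := fun (z : ℂ) (t : ℝ) => Complex.exp (m * t - z * Real.sinh t))
    (F' := fun (z : ℂ) (t : ℝ) => Complex.exp (m * t - z * Real.sinh t) * -(Real.sinh t : ℂ))
    (x₀ := z) (s := {w : ℂ | z.re / 2 < w.re})
    (bound := fun t => (Real.exp ((m - 1 : ℤ) * t - z.re / 2 * Real.sinh t)
      + Real.exp ((m + 1 : ℤ) * t - z.re / 2 * Real.sinh t)) / 2)
    ((isOpen_lt continuous_const Complex.continuous_re).mem_nhds (by simp; linarith))
    (Eventually.of_forall fun w => by fun_prop) (integrableOn_cexp_sub_sinh m hz)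
    (by fun_prop) ?_ ?_ ?_).2
  · refine h.congr_deriv ?_
    rw [expInt, expInt, ← integral_sub (integrableOn_cexp_sub_sinh _ hz)
      (integrableOn_cexp_sub_sinh _ hz), ← integral_div]
    simp only [hs]
  · filter_upwards [ae_restrict_mem measurableSet_Ioi] with t ht w hw
    have hsinh : 0 ≤ Real.sinh t := Real.sinh_nonneg_iff.2 (le_of_lt ht)
    have hw' : z.re / 2 ≤ w.re := le_of_lt hw
    rw [hs, norm_div, Complex.norm_two]
    gcongr
    refine (norm_sub_le _ _).trans ?_
    rw [norm_exp_sub_sinh, norm_exp_sub_sinh]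
    gcongr
  · exact ((integrableOn_exp_sub_sinh _ (by linarith)).add
      (integrableOn_exp_sub_sinh _ (by linarith))).div_const 2
  · refine Eventually.of_forall fun t w _ => HasDerivAt.cexp ?_
    simpa using ((hasDerivAt_id w).mul_const (Real.sinh t : ℂ)).const_sub ((m : ℂ) * t)

theorem tendsto_cexp_sub_sinh (m : ℤ) {z : ℂ} (hz : 0 < z.re) :
    Tendsto (fun t : ℝ => Complex.exp (m * t - z * Real.sinh t)) atTop (𝓝 0) := by
  rw [tendsto_zero_iff_norm_tendsto_zero]
  have h1 : Tendsto (fun t : ℝ => Real.exp ((m + 1) ^ 2 / z.re) * Real.exp (-t)) atTop (𝓝 0) := by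
    simpa using (Real.tendsto_exp_neg_atTop_nhds_zero).const_mul (Real.exp ((m + 1) ^ 2 / z.re))
  refine squeeze_zero' (Eventually.of_forall fun t => norm_nonneg _) ?_ h1
  filter_upwards [eventually_ge_atTop 0] with t ht
  rw [norm_exp_sub_sinh, ← Real.exp_add, Real.exp_le_exp]
  have h1 := mul_le_mul_of_nonneg_left (sq_div_four_le_sinh ht) hz.le
  have h2 : 0 ≤ (z.re * t / 2 - (m + 1)) ^ 2 / z.re := by positivity
  have h3 : (z.re * t / 2 - (m + 1)) ^ 2 / z.re
      = z.re * (t ^ 2 / 4) - (m + 1) * t + (m + 1) ^ 2 / z.re := by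
    field_simp; ring
  linarith

/-- The `t`-derivative of the integrand integrates to `-1`, its limit at infinity being 0 and its
value at `t = 0` being 1; this is the source of the inhomogeneous term `2`. -/
theorem expInt_recurrence (m : ℤ) {z : ℂ} (hz : 0 < z.re) :
    z * (expInt (m - 1) z + expInt (m + 1) z) = 2 * m * expInt m z + 2 := by
  have hd : ∀ t ∈ Ici (0 : ℝ), HasDerivAt (fun t : ℝ => Complex.exp (m * t - z * Real.sinh t))
      (Complex.exp (m * t - z * Real.sinh t) * (m - z * Real.cosh t)) t := by
    intro t _
    refine HasDerivAt.cexp (HasDerivAt.sub ?_ ((Real.hasDerivAt_sinh t).ofReal_comp.const_mul z))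
    simpa using (hasDerivAt_id t).ofReal_comp.const_mul (m : ℂ)
  have hs : ∀ t : ℝ, Complex.exp (m * t - z * Real.sinh t) * (m - z * Real.cosh t)
      = m * Complex.exp (m * t - z * Real.sinh t)
        - z / 2 * (Complex.exp ((m - 1 : ℤ) * t - z * Real.sinh t)
        + Complex.exp ((m + 1 : ℤ) * t - z * Real.sinh t)) := by
    intro t
    rw [(cexp_shift m z t).1, (cexp_shift m z t).2, Complex.ofReal_cosh, Complex.cosh]
    ring
  have i0 := (integrableOn_cexp_sub_sinh m hz).const_mul (m : ℂ)
  have i1 := integrableOn_cexp_sub_sinh (m - 1) hz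
  have i2 := integrableOn_cexp_sub_sinh (m + 1) hz
  have i3 : IntegrableOn (fun t : ℝ => z / 2 * (Complex.exp ((m - 1 : ℤ) * t - z * Real.sinh t)
      + Complex.exp ((m + 1 : ℤ) * t - z * Real.sinh t))) (Ioi 0) := (i1.add i2).const_mul (z / 2)
  have h := integral_Ioi_of_hasDerivAt_of_tendsto' hd
    (by simp only [hs]; exact i0.sub i3) (tendsto_cexp_sub_sinh m hz)
  simp only [hs] at h
  have h' : ∫ t in Ioi (0 : ℝ), (m * Complex.exp (m * t - z * Real.sinh t)
        - z / 2 * (Complex.exp ((m - 1 : ℤ) * t - z * Real.sinh t)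
        + Complex.exp ((m + 1 : ℤ) * t - z * Real.sinh t)))
      = m * expInt m z - z / 2 * (expInt (m - 1) z + expInt (m + 1) z) := by
    rw [integral_sub i0 i3, integral_const_mul, integral_const_mul, integral_add i1 i2]
    rfl
  rw [h'] at h
  simp at h
  linear_combination (-2) * h


/-! ### Contiguity relations, Bessel's equation and the Wronskian -/

/-- Families of cylinder functions on the right half-plane: the two contiguity relations of the
Bessel functions hold. -/
structure IsCylinder (C : ℤ → ℂ → ℂ) : Prop where
  hasDerivAt : ∀ n z, 0 < z.re → HasDerivAt (C n) ((C (n - 1) z - C (n + 1) z) / 2) z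
  recurrence : ∀ n z, 0 < z.re → z * (C (n - 1) z + C (n + 1) z) = 2 * n * C n z

theorem besselJC_hasDerivAt (n : ℤ) (z : ℂ) :
    HasDerivAt (besselJC n) ((besselJC (n - 1) z - besselJC (n + 1) z) / 2) z := by
  refine ((hasDerivAt_oscInt (by linarith [Real.pi_pos]) n z).const_mul
    (1 / (2 * Real.pi) : ℂ)).congr_deriv ?_
  rw [besselJC, besselJC]
  ring

theorem continuous_besselJC (n : ℤ) : Continuous (besselJC n) :=
  continuous_iff_continuousAt.2 fun z => (besselJC_hasDerivAt n z).continuousAt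

theorem cexp_int_pi (n : ℤ) (z : ℂ) :
    Complex.exp (Complex.I * (z * Real.sin Real.pi - n * Real.pi)) = (-1) ^ n := by
  rw [Real.sin_pi, show Complex.I * (z * (0 : ℝ) - n * Real.pi) = (-n : ℤ) * (Real.pi * Complex.I) by
    push_cast; ring, Complex.exp_int_mul, Complex.exp_pi_mul_I, zpow_neg, ← inv_zpow, inv_neg_one]

theorem besselJC_recurrence (n : ℤ) (z : ℂ) :
    z * (besselJC (n - 1) z + besselJC (n + 1) z) = 2 * n * besselJC n z := by
  have h := oscInt_recurrence (-Real.pi) Real.pi n z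
  have h2 : Complex.exp (Complex.I * (z * Real.sin (-Real.pi) - n * (-Real.pi : ℝ))) = (-1) ^ n := by
    have := cexp_int_pi (-n) z
    rw [zpow_neg, ← inv_zpow, inv_neg_one] at this
    rw [← this, Real.sin_neg, Real.sin_pi]
    push_cast
    ring_nf
  rw [cexp_int_pi, h2] at h
  rw [besselJC, besselJC, besselJC]
  linear_combination (1 / (2 * Real.pi) : ℂ) * h

theorem isCylinder_besselJC : IsCylinder besselJC :=
  ⟨fun n z _ => besselJC_hasDerivAt n z, fun n z _ => besselJC_recurrence n z⟩

theorem neg_one_zpow_add_sub (n : ℤ) :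
    (-1 : ℂ) ^ (n - 1) = -(-1) ^ n ∧ (-1 : ℂ) ^ (n + 1) = -(-1) ^ n := by
  constructor
  · rw [zpow_sub₀ (by norm_num)]; simp [div_neg]
  · rw [zpow_add₀ (by norm_num)]; simp

/-- The finite-interval and the half-line integrals each fail the homogeneous recurrence by endpoint
terms at `s = 0`, `s = π` and `t = 0`; in this combination the defects cancel. -/
theorem isCylinder_hankelC : IsCylinder hankelC := by
  refine ⟨fun n z hz => ?_, fun n z hz => ?_⟩
  · have h1 := hasDerivAt_oscInt Real.pi_pos.le n z
    have h2 := (hasDerivAt_expInt n hz).add ((hasDerivAt_expInt (-n) hz).const_mul ((-1 : ℂ) ^ n))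
    refine ((h1.sub (h2.const_mul Complex.I)).const_mul (1 / Real.pi : ℂ)).congr_deriv ?_
    rw [hankelC, hankelC, (neg_one_zpow_add_sub n).1, (neg_one_zpow_add_sub n).2,
      show -(n - 1) = -n + 1 by ring, show -(n + 1) = -n - 1 by ring]
    ring
  · have h1 := oscInt_recurrence 0 Real.pi n z
    have h2 := expInt_recurrence n hz
    have h3 := expInt_recurrence (-n) hz
    rw [cexp_int_pi] at h1
    simp only [Real.sin_zero, Complex.ofReal_zero, mul_zero, sub_zero, Complex.exp_zero] at h1
    rw [hankelC, hankelC, hankelC, (neg_one_zpow_add_sub n).1, (neg_one_zpow_add_sub n).2,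
      show -(n - 1) = -n + 1 by ring, show -(n + 1) = -n - 1 by ring]
    push_cast at h3
    linear_combination (1 / Real.pi : ℂ) * h1 - (1 / Real.pi : ℂ) * Complex.I * h2
      + (1 / Real.pi : ℂ) * Complex.I * (-1) ^ n * h3

/-- The quantity `z C_n'(z)` for a family of cylinder functions. -/
noncomputable def eulerDeriv (C : ℤ → ℂ → ℂ) (n : ℤ) (z : ℂ) : ℂ := z * C (n - 1) z - n * C n z

namespace IsCylinder

variable {C : ℤ → ℂ → ℂ}

theorem hasDerivAt_eulerDeriv (hC : IsCylinder C) (n : ℤ) {z : ℂ} (hz : 0 < z.re) : HasDerivAt (C n) (eulerDeriv C n z / z) z := by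
  have hz0 : z ≠ 0 := by rintro rfl; simp at hz
  refine (hC.hasDerivAt n z hz).congr_deriv ?_
  have h := hC.recurrence n z hz
  rw [eulerDeriv, eq_div_iff hz0]
  linear_combination (-1 / 2 : ℂ) * h

/-- Bessel's equation in the form `(z C')' = (n²/z - z) C`, obtained from the contiguity relations
at `n` and `n - 1`. -/
theorem eulerDeriv_hasDerivAt (hC : IsCylinder C) (n : ℤ) {z : ℂ} (hz : 0 < z.re) :
    HasDerivAt (eulerDeriv C n) (((n : ℂ) ^ 2 / z - z) * C n z) z := by
  have hz0 : z ≠ 0 := by rintro rfl; simp at hz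
  have h := ((hasDerivAt_id z).mul (hC.hasDerivAt (n - 1) z hz)).sub
    ((hC.hasDerivAt n z hz).const_mul (n : ℂ))
  refine h.congr_deriv ?_
  have h1 := hC.recurrence n z hz
  have h2 := hC.recurrence (n - 1) z hz
  rw [show n - 1 + 1 = n by ring] at h2 ⊢
  push_cast at h2
  simp only [id]
  field_simp
  linear_combination (n : ℂ) * h1 + z * h2

end IsCylinder

/-- The Wronskian of the Bessel and the Hankel functions. -/
noncomputable def wronskian (n : ℤ) (z : ℂ) : ℂ :=
  besselJC n z * eulerDeriv hankelC n z - eulerDeriv besselJC n z * hankelC n z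

theorem wronskian_add_one (n : ℤ) {z : ℂ} (hz : 0 < z.re) : wronskian (n + 1) z = wronskian n z := by
  have h1 := isCylinder_besselJC.recurrence n z hz
  have h2 := isCylinder_hankelC.recurrence n z hz
  simp only [wronskian, eulerDeriv, add_sub_cancel_right]
  linear_combination hankelC n z * h1 - besselJC n z * h2

theorem wronskian_eq_zero_index (n : ℤ) {z : ℂ} (hz : 0 < z.re) : wronskian n z = wronskian 0 z := by
  induction n using Int.induction_on with
  | zero => rfl
  | succ k ih => rw [wronskian_add_one _ hz, ih]
  | pred k ih => rw [← ih, ← wronskian_add_one _ hz, sub_add_cancel]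

theorem wronskian_hasDerivAt (n : ℤ) {z : ℂ} (hz : 0 < z.re) : HasDerivAt (wronskian n) 0 z := by
  refine (((isCylinder_besselJC.hasDerivAt_eulerDeriv n hz).mul
    (isCylinder_hankelC.eulerDeriv_hasDerivAt n hz)).sub
    ((isCylinder_besselJC.eulerDeriv_hasDerivAt n hz).mul
    (isCylinder_hankelC.hasDerivAt_eulerDeriv n hz))).congr_deriv ?_
  ring

/-- Both factors solve the same self-adjoint equation, so the derivative vanishes on the connected
half-plane. -/
theorem wronskian_eq_of_re_pos (n : ℤ) {z w : ℂ} (hz : 0 < z.re) (hw : 0 < w.re) :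
    wronskian n z = wronskian n w := by
  have ho : IsOpen {z : ℂ | 0 < z.re} := isOpen_lt continuous_const Complex.continuous_re
  have hc : Convex ℝ {z : ℂ | 0 < z.re} := convex_halfSpace_re_gt 0
  exact ho.is_const_of_deriv_eq_zero hc.isPreconnected
    (fun v hv => (wronskian_hasDerivAt n hv).differentiableAt.differentiableWithinAt)
    (fun v hv => (wronskian_hasDerivAt n hv).deriv) hz hw

theorem norm_expInt_le (m : ℤ) {δ : ℝ} (hδ : 0 < δ) {z : ℂ} (hz : δ ≤ z.re) :
    ‖expInt m z‖ ≤ ∫ t in Ioi (0 : ℝ), Real.exp (m * t - δ * Real.sinh t) := by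
  refine norm_integral_le_of_norm_le (integrableOn_exp_sub_sinh m hδ) ?_
  filter_upwards [ae_restrict_mem measurableSet_Ioi] with t ht
  rw [norm_exp_sub_sinh]
  have hsinh : 0 ≤ Real.sinh t := Real.sinh_nonneg_iff.2 (le_of_lt ht)
  gcongr

theorem norm_oscInt_le {b : ℝ} (hb : 0 ≤ b) (hb' : b ≤ Real.pi) (n : ℤ) {z : ℂ} (hz : 0 ≤ z.im) :
    ‖oscInt 0 b n z‖ ≤ b := by
  have := intervalIntegral.norm_integral_le_of_norm_le_const (a := 0) (b := b)
    (f := fun s : ℝ => Complex.exp (Complex.I * (z * Real.sin s - n * s))) (C := 1) ?_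
  · rwa [sub_zero, abs_of_nonneg hb, one_mul] at this
  · intro s hs
    rw [uIoc_of_le hb] at hs
    rw [Complex.norm_exp, Real.exp_le_one_iff]
    have : 0 ≤ Real.sin s := Real.sin_nonneg_of_nonneg_of_le_pi hs.1.le (hs.2.trans hb')
    simp [Complex.mul_im, Complex.mul_re, -Complex.ofReal_sin]
    positivity

/-- In the upper half-plane the oscillating integrand has modulus at most 1 on `[0, π]`, and the
exponential integrals are largest at the smallest real part. Uniformity in `z` is needed because the
outer radius in Green's identity grows with `T`. -/
theorem exists_norm_hankelC_le (n : ℤ) {δ : ℝ} (hδ : 0 < δ) :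
    ∃ M, ∀ z : ℂ, δ ≤ z.re → 0 ≤ z.im → ‖hankelC n z‖ ≤ M := by
  refine ⟨1 / Real.pi * (Real.pi + ((∫ t in Ioi (0 : ℝ), Real.exp (n * t - δ * Real.sinh t))
    + ∫ t in Ioi (0 : ℝ), Real.exp ((-n : ℤ) * t - δ * Real.sinh t))), fun z hz hz' => ?_⟩
  rw [hankelC, norm_mul]
  have e1 : ‖(1 / Real.pi : ℂ)‖ = 1 / Real.pi := by
    simp [abs_of_pos Real.pi_pos]
  rw [e1]
  have := Real.pi_pos
  gcongr
  refine (norm_sub_le _ _).trans (add_le_add (norm_oscInt_le Real.pi_pos.le le_rfl n hz') ?_)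
  rw [norm_mul, Complex.norm_I, one_mul]
  refine (norm_add_le _ _).trans (add_le_add (norm_expInt_le n hδ hz) ?_)
  rw [norm_mul, norm_zpow, norm_neg, norm_one, one_zpow, one_mul]
  exact norm_expInt_le (-n) hδ hz

theorem norm_expInt_neg_one_le {x : ℝ} (hx : 0 < x) : ‖expInt (-1) x‖ ≤ 1 := by
  have h0 : IntegrableOn (fun t : ℝ => Real.exp (-t)) (Ioi 0) := integrableOn_exp_neg_Ioi 0
  have h : ‖expInt (-1) x‖ ≤ ∫ t in Ioi (0 : ℝ), Real.exp (-t) := by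
    refine norm_integral_le_of_norm_le h0 ?_
    filter_upwards [ae_restrict_mem measurableSet_Ioi] with t ht
    rw [norm_exp_sub_sinh, Complex.ofReal_re, Real.exp_le_exp]
    have hsinh : 0 ≤ Real.sinh t := Real.sinh_nonneg_iff.2 (le_of_lt ht)
    have := mul_nonneg hx.le hsinh
    push_cast
    linarith
  rwa [integral_exp_neg_Ioi_zero] at h

theorem norm_mul_expInt_zero_le {x : ℝ} (hx : 0 < x) : ‖(x : ℂ) * expInt 0 x‖ ≤ 1 := by
  have h0 : IntegrableOn (fun t : ℝ => Real.exp (-x * t)) (Ioi 0) := integrableOn_exp_mul_Ioi (by linarith) 0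
  have h : ‖expInt 0 x‖ ≤ ∫ t in Ioi (0 : ℝ), Real.exp (-x * t) := by
    refine norm_integral_le_of_norm_le h0 ?_
    filter_upwards [ae_restrict_mem measurableSet_Ioi] with t ht
    rw [norm_exp_sub_sinh, Complex.ofReal_re, Real.exp_le_exp]
    have hsinh : t ≤ Real.sinh t := Real.self_le_sinh_iff.2 (le_of_lt ht)
    have := mul_le_mul_of_nonneg_left hsinh hx.le
    push_cast
    linarith
  rw [integral_exp_mul_Ioi (by linarith)] at h
  rw [norm_mul, Complex.norm_real, Real.norm_of_nonneg hx.le]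
  have h2 := mul_le_mul_of_nonneg_left h hx.le
  refine h2.trans (le_of_eq ?_)
  simp
  field_simp

theorem besselJC_zero_zero : besselJC 0 0 = 1 := by
  have hpi : (Real.pi : ℂ) ≠ 0 := by exact_mod_cast Real.pi_ne_zero
  simp [besselJC, oscInt]
  field_simp
  norm_num

theorem besselJC_neg_one_zero : besselJC (-1) 0 = 0 := by
  have h := besselJC_recurrence (-1) 0
  push_cast at h
  linear_combination (1 / 2 : ℂ) * h

/-- Being independent of `n` and `z`, the Wronskian is computed for `n = 0` as `x → 0+`, where `J_0
→ 1` and `J_{-1} → 0`. The only singular contribution is that of `x · expInt 1 x`, which tends to 2.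
-/
theorem wronskian_eq (n : ℤ) {z : ℂ} (hz : 0 < z.re) : wronskian n z = 2 * Complex.I / Real.pi := by
  rw [wronskian_eq_zero_index n hz]
  have hpi : (Real.pi : ℂ) ≠ 0 := by exact_mod_cast Real.pi_ne_zero
  have hofReal : Tendsto (fun x : ℝ => (x : ℂ)) (𝓝[>] 0) (𝓝 0) :=
    (Complex.continuous_ofReal.tendsto' 0 0 (by simp)).mono_left nhdsWithin_le_nhds
  have hbdd : ∀ (g : ℝ → ℂ) (M : ℝ), (∀ x : ℝ, 0 < x → ‖g x‖ ≤ M) →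
      IsBoundedUnder (· ≤ ·) (𝓝[>] (0 : ℝ)) (norm ∘ g) := fun g M hg =>
    isBoundedUnder_of_eventually_le (a := M) (eventually_mem_nhdsWithin.mono fun x hx => hg x hx)
  have hosc : ∀ n : ℤ, Tendsto (fun x : ℝ => (x : ℂ) * oscInt 0 Real.pi n x) (𝓝[>] 0) (𝓝 0) :=
    fun n => hofReal.zero_mul_isBoundedUnder_le (hbdd _ Real.pi fun x _ =>
      norm_oscInt_le Real.pi_pos.le le_rfl n (by simp))
  have hK : Tendsto (fun x : ℝ => (x : ℂ) * expInt (-1) x) (𝓝[>] 0) (𝓝 0) :=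
    hofReal.zero_mul_isBoundedUnder_le (hbdd _ 1 fun x hx => norm_expInt_neg_one_le hx)
  have hJ0 : Tendsto (fun x : ℝ => besselJC 0 x) (𝓝[>] 0) (𝓝 1) := by
    have := ((continuous_besselJC 0).tendsto 0).comp hofReal
    rwa [besselJC_zero_zero] at this
  have hJ1 : Tendsto (fun x : ℝ => besselJC (-1) x) (𝓝[>] 0) (𝓝 0) := by
    have := ((continuous_besselJC (-1)).tendsto 0).comp hofReal
    rwa [besselJC_neg_one_zero] at this
  have hJK : Tendsto (fun x : ℝ => besselJC (-1) x * (x * expInt 0 x)) (𝓝[>] 0) (𝓝 0) :=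
    hJ1.zero_mul_isBoundedUnder_le (hbdd _ 1 fun x hx => norm_mul_expInt_zero_le hx)
  -- Here `x · expInt 1 x` has been replaced by `2 - x · expInt (-1) x` through the recurrence at
  -- index 0, so that every remaining factor has an evident limit or bound.
  have hlim : Tendsto (fun x : ℝ => besselJC 0 x * (1 / Real.pi * (x * oscInt 0 Real.pi (-1) x
      - Complex.I * (2 * (x * expInt (-1) x) - 2)))
      - 1 / Real.pi * (besselJC (-1) x * (x * oscInt 0 Real.pi 0 x)
        - 2 * Complex.I * (besselJC (-1) x * (x * expInt 0 x)))) (𝓝[>] 0)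
      (𝓝 (1 * (1 / Real.pi * (0 - Complex.I * (2 * 0 - 2)))
        - 1 / Real.pi * (0 * 0 - 2 * Complex.I * 0))) :=
    (hJ0.mul (((hosc (-1)).sub (((hK.const_mul 2).sub_const 2).const_mul _)).const_mul _)).sub
      (((hJ1.mul (hosc 0)).sub (hJK.const_mul _)).const_mul _)
  have hconst : Tendsto (fun _ : ℝ => wronskian 0 z) (𝓝[>] 0) (𝓝 (wronskian 0 z)) :=
    tendsto_const_nhds
  rw [tendsto_nhds_unique (hconst.congr' ?_) hlim]
  · ring
  · filter_upwards [self_mem_nhdsWithin] with x hx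
    have hx' : 0 < (x : ℂ).re := hx
    rw [wronskian_eq_of_re_pos 0 hz hx']
    have h := expInt_recurrence 0 hx'
    simp only [wronskian, eulerDeriv, hankelC]
    simp only [Int.cast_zero, zero_mul, zero_sub, zero_add, neg_neg, neg_zero, zpow_zero, one_mul,
      mul_zero, sub_zero] at h ⊢
    rw [show ((-1 : ℂ) ^ (-1 : ℤ)) = -1 by norm_num]
    linear_combination (besselJC 0 x * (1 / Real.pi) * Complex.I) * h


/-! ### Real arguments -/

theorem besselJC_natCast_ofReal (n : ℕ) (x : ℝ) : besselJC n x = besselJ n x := by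
  have hc : Continuous fun s : ℝ => Complex.exp (Complex.I * (x * Real.sin s - (n : ℤ) * s)) := by
    fun_prop
  have h1 : oscInt (-Real.pi) Real.pi n x
      = ∫ s in (0 : ℝ)..Real.pi, (2 * Real.cos (n * s - x * Real.sin s) : ℝ) := by
    rw [oscInt, ← intervalIntegral.integral_add_adjacent_intervals (b := 0)
      (hc.intervalIntegrable _ _) (hc.intervalIntegrable _ _)]
    have h2 := intervalIntegral.integral_comp_neg (a := 0) (b := Real.pi)
      fun s : ℝ => Complex.exp (Complex.I * (x * Real.sin s - (n : ℤ) * s))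
    rw [neg_zero] at h2
    rw [← h2, ← intervalIntegral.integral_add (Continuous.intervalIntegrable (by fun_prop) _ _)
      (Continuous.intervalIntegrable (by fun_prop) _ _), ← intervalIntegral.integral_ofReal]
    refine intervalIntegral.integral_congr fun s _ => ?_
    simp only [Real.sin_neg]
    push_cast
    rw [Complex.cos]
    ring_nf
  rw [besselJC, h1, besselJ, intervalIntegral.integral_const_mul]
  push_cast
  ring

theorem hankelC_natCast_ofReal (n : ℕ) {x : ℝ} (hx : 0 < x) : hankelC n x = hankel1 n x := by
  have h1 : oscInt 0 Real.pi n x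
      = (∫ s in (0 : ℝ)..Real.pi, Real.cos (n * s - x * Real.sin s) : ℝ)
        + Complex.I * (∫ s in (0 : ℝ)..Real.pi, Real.sin (x * Real.sin s - n * s) : ℝ) := by
    rw [oscInt, ← intervalIntegral.integral_ofReal, ← intervalIntegral.integral_ofReal,
      ← intervalIntegral.integral_const_mul, ← intervalIntegral.integral_add
      (Continuous.intervalIntegrable (by fun_prop) _ _)
      (Continuous.intervalIntegrable (by fun_prop) _ _)]
    refine intervalIntegral.integral_congr fun s _ => ?_
    have e : Complex.I * (x * Real.sin s - (n : ℤ) * s)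
      = ((x * Real.sin s - n * s : ℝ) : ℂ) * Complex.I := by push_cast; ring
    rw [e, Complex.exp_mul_I, ← Complex.ofReal_cos, ← Complex.ofReal_sin,
      ← Real.cos_neg (x * Real.sin s - n * s), neg_sub]
    ring
  have hx' : 0 < (x : ℂ).re := hx
  have h2 : expInt n x + (-1) ^ (n : ℤ) * expInt (-n) x
      = (∫ t in Ioi (0 : ℝ), (Real.exp (n * t) + (-1) ^ n * Real.exp (-(n * t)))
        * Real.exp (-(x * Real.sinh t)) : ℝ) := by
    rw [expInt, expInt, ← integral_const_mul, ← integral_add (integrableOn_cexp_sub_sinh _ hx')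
      ((integrableOn_cexp_sub_sinh _ hx').const_mul _), ← integral_complex_ofReal]
    refine integral_congr_ae (Eventually.of_forall fun t => ?_)
    simp only [zpow_natCast]
    push_cast
    rw [add_mul, mul_assoc, ← Complex.exp_add, ← Complex.exp_add]
    ring_nf
  rw [hankelC, h1, h2, hankel1, besselJ, besselY]
  push_cast
  ring

/-- `J_n(x)` is the real part of `H_n(x)`. If the latter vanished, both would, and so would the
Wronskian. -/
theorem hankel1_ne_zero (n : ℕ) {x : ℝ} (hx : 0 < x) : hankel1 n x ≠ 0 := by
  intro h
  have hx' : 0 < (x : ℂ).re := hx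
  have hJ : besselJ n x = 0 := by
    have := congrArg Complex.re h
    simpa [hankel1] using this
  have hW := wronskian_eq n hx'
  rw [wronskian, hankelC_natCast_ofReal n hx, h, besselJC_natCast_ofReal, hJ] at hW
  have hpi : (Real.pi : ℂ) ≠ 0 := by exact_mod_cast Real.pi_ne_zero
  field_simp at hW
  simp at hW

theorem norm_besselJC_ofReal_le_one (n : ℤ) (x : ℝ) : ‖besselJC n x‖ ≤ 1 := by
  have := intervalIntegral.norm_integral_le_of_norm_le_const (a := -Real.pi) (b := Real.pi)
    (f := fun s : ℝ => Complex.exp (Complex.I * (x * Real.sin s - n * s))) (C := 1) ?_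
  · rw [besselJC, oscInt, norm_mul]
    refine (mul_le_mul_of_nonneg_left this (norm_nonneg _)).trans (le_of_eq ?_)
    have h0 := Real.pi_pos
    simp [abs_of_pos h0]
    rw [abs_of_pos (by linarith)]
    field_simp
    norm_num
  · intro s _
    have e : Complex.I * (x * Real.sin s - n * s)
      = ((x * Real.sin s - n * s : ℝ) : ℂ) * Complex.I := by push_cast; ring
    rw [e, Complex.norm_exp_ofReal_mul_I]

/-- Applying `2n J_n = x (J_{n-1} + J_{n+1})` twice expresses `n² J_n` by neighbouring Bessel
functions, each bounded by 1. Two powers of `n` suffice for absolute convergence of the series. -/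
theorem sq_mul_norm_besselJC_le (n : ℤ) (x : ℝ) :
    (n : ℝ) ^ 2 * ‖besselJC n x‖ ≤ x ^ 2 + |x| := by
  have h0 := besselJC_recurrence n x
  have h1 := besselJC_recurrence (n - 1) x
  have h2 := besselJC_recurrence (n + 1) x
  rw [sub_add_cancel] at h1
  rw [add_sub_cancel_right] at h2
  push_cast at h1 h2
  have h : (n : ℂ) ^ 2 * besselJC n x = (x : ℂ) ^ 2 / 4 * (besselJC (n - 1 - 1) x + besselJC n x
      + besselJC n x + besselJC (n + 1 + 1) x) + x / 2 * (besselJC (n - 1) x - besselJC (n + 1) x) := by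
    linear_combination (-(n : ℂ) / 2) * h0 - (x / 4 : ℂ) * h1 - (x / 4 : ℂ) * h2
  have hb := fun m => norm_besselJC_ofReal_le_one m x
  have e1 : ‖(n : ℂ) ^ 2 * besselJC n x‖ = (n : ℝ) ^ 2 * ‖besselJC n x‖ := by
    rw [norm_mul, norm_pow]; simp
  rw [← e1, h]
  refine (norm_add_le _ _).trans (add_le_add ?_ ?_)
  · rw [norm_mul]
    have : ‖(x : ℂ) ^ 2 / 4‖ = x ^ 2 / 4 := by simp
    rw [this]
    have h4 : ‖besselJC (n - 1 - 1) x + besselJC n x + besselJC n x + besselJC (n + 1 + 1) x‖ ≤ 4 := by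
      refine (norm_add_le _ _).trans ?_
      refine (add_le_add_left (norm_add_le _ _) _).trans ?_
      refine (add_le_add_left (add_le_add_left (norm_add_le _ _) _) _).trans ?_
      linarith [hb (n - 1 - 1), hb n, hb (n + 1 + 1)]
    nlinarith [sq_nonneg x]
  · rw [norm_mul]
    have : ‖(x : ℂ) / 2‖ = |x| / 2 := by simp
    rw [this]
    have h2 : ‖besselJC (n - 1) x - besselJC (n + 1) x‖ ≤ 2 := by
      refine (norm_sub_le _ _).trans ?_
      linarith [hb (n - 1), hb (n + 1)]
    nlinarith [abs_nonneg x]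

theorem oscInt_period (n : ℤ) (z : ℂ) (a : ℝ) :
    oscInt a (a + 2 * Real.pi) n z = 2 * Real.pi * besselJC n z := by
  have hp : Function.Periodic (fun s : ℝ => Complex.exp (Complex.I * (z * Real.sin s - n * s)))
      (2 * Real.pi) := by
    intro s
    simp only [Real.sin_add_two_pi]
    rw [show Complex.I * (z * Real.sin s - n * ((s + 2 * Real.pi : ℝ) : ℂ))
      = Complex.I * (z * Real.sin s - n * s) + (-n : ℤ) * (2 * Real.pi * Complex.I) by push_cast; ring,
      Complex.exp_add, Complex.exp_int_mul_two_pi_mul_I, mul_one]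
  have h := hp.intervalIntegral_add_eq a (-Real.pi)
  rw [show -Real.pi + 2 * Real.pi = Real.pi by ring] at h
  have hpi : (Real.pi : ℂ) ≠ 0 := by exact_mod_cast Real.pi_ne_zero
  rw [besselJC, oscInt, h, ← oscInt]
  field_simp

theorem besselJC_neg (n : ℤ) (z : ℂ) : besselJC (-n) z = (-1) ^ n * besselJC n z := by
  have hpi : (Real.pi : ℂ) ≠ 0 := by exact_mod_cast Real.pi_ne_zero
  have h := oscInt_period (-n) z 0
  have h2 : oscInt 0 (0 + 2 * Real.pi) (-n) z
      = (-1) ^ n * oscInt (-Real.pi) Real.pi n z := by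
    have h3 := intervalIntegral.integral_comp_sub_left (a := 0) (b := 2 * Real.pi)
      (fun s : ℝ => Complex.exp (Complex.I * (z * Real.sin s - n * s))) Real.pi
    rw [show Real.pi - 2 * Real.pi = -Real.pi by ring, sub_zero] at h3
    rw [zero_add, oscInt, oscInt, ← h3, ← intervalIntegral.integral_const_mul]
    refine intervalIntegral.integral_congr fun s _ => ?_
    simp only [Real.sin_pi_sub]
    have e := cexp_int_pi (-n) 0
    rw [zpow_neg, ← inv_zpow, inv_neg_one] at e
    rw [← e, ← Complex.exp_add]
    push_cast
    ring_nf
  rw [h2] at h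
  have h4 : oscInt (-Real.pi) Real.pi n z = 2 * Real.pi * besselJC n z := by
    rw [besselJC]; field_simp
  rw [h4] at h
  have hpi2 : (2 * Real.pi : ℂ) ≠ 0 := by simp [hpi]
  apply mul_left_cancel₀ hpi2
  linear_combination -h

/-- The sign in `J_{-n} = (-1)^n J_n` is absorbed by `(-i)^{-n} = (-1)^n (-i)^n`; this is why only
`|k|` appears in the series. -/
theorem neg_I_zpow_mul_besselJC (k : ℤ) (z : ℂ) :
    (-Complex.I) ^ k * besselJC k z = (-Complex.I) ^ k.natAbs * besselJC k.natAbs z := by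
  rcases Int.natAbs_eq k with h | h
  · conv_lhs => rw [h]
    rw [zpow_natCast]
  · conv_lhs => rw [h]
    rw [besselJC_neg, ← mul_assoc, zpow_neg, ← inv_zpow, ← mul_zpow, zpow_natCast]
    congr 2
    simp

/-- The angular Fourier coefficients of a plane wave are Bessel functions. -/
theorem integral_planeWave_mul_exp (k : ℤ) (x α : ℝ) :
    ∫ φ in (0 : ℝ)..(2 * Real.pi), Complex.exp (-(Complex.I * (x * Real.cos (α - φ))))
        * Complex.exp (-(Complex.I * k * φ))
      = 2 * Real.pi * ((-Complex.I) ^ k.natAbs * besselJC k.natAbs x) * Complex.exp (-(Complex.I * k * α)) := by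
  -- Shifting the angle by `α + π/2` turns the cosine of the plane wave into the sine of Bessel's
  -- integral and produces the phase `(-i)^k e^{-ikα}`.
  have h3 := intervalIntegral.integral_comp_sub_right (a := 0) (b := 2 * Real.pi)
      (fun s : ℝ => Complex.exp (Complex.I * (x * Real.sin s - k * s))) (α + Real.pi / 2)
  rw [← neg_I_zpow_mul_besselJC]
  have h4 := oscInt_period k x (0 - (α + Real.pi / 2))
  rw [oscInt, show 0 - (α + Real.pi / 2) + 2 * Real.pi = 2 * Real.pi - (α + Real.pi / 2) by ring, ← h3] at h4
  have h5 : (-Complex.I) ^ k = Complex.exp (-(Complex.I * k * (Real.pi / 2))) := by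
    rw [show -(Complex.I * k * (Real.pi / 2)) = k * (-(Real.pi / 2) * Complex.I) by ring,
      Complex.exp_int_mul]
    congr 1
    rw [show (-(Real.pi / 2) * Complex.I : ℂ) = -(Real.pi / 2 * Complex.I) by ring, Complex.exp_neg,
      Complex.exp_pi_div_two_mul_I, Complex.inv_I]
  rw [show 2 * Real.pi * ((-Complex.I) ^ k * besselJC k x) * Complex.exp (-(Complex.I * k * α))
    = (-Complex.I) ^ k * Complex.exp (-(Complex.I * k * α)) * (2 * Real.pi * besselJC k x) by ring,
    ← h4, h5, ← Complex.exp_add, ← intervalIntegral.integral_const_mul]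
  refine intervalIntegral.integral_congr fun φ _ => ?_
  rw [← Complex.exp_add, ← Complex.exp_add, show φ - (α + Real.pi / 2) = -(α - φ + Real.pi / 2) by ring, Real.sin_neg,
    Real.sin_add_pi_div_two]
  push_cast
  ring_nf

theorem integral_mul_besselJC_zero {l R : ℝ} (hl : 0 < l) :
    ∫ r in (0 : ℝ)..R, (r : ℂ) * besselJC 0 (l * r) = R * besselJC 1 (l * R) / l := by
  have hl' : (l : ℂ) ≠ 0 := by exact_mod_cast hl.ne'
  have hc := continuous_besselJC 0
  have hd : ∀ r : ℝ, HasDerivAt (fun r : ℝ => (r : ℂ) * besselJC 1 (l * r) / l)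
      ((r : ℂ) * besselJC 0 (l * r)) r := by
    intro r
    have h1 : HasDerivAt (fun z : ℂ => z * besselJC 1 (l * z) / l) (r * besselJC 0 (l * r)) (r : ℂ) := by
      have h2 : HasDerivAt (fun z : ℂ => besselJC 1 (l * z)) _ (r : ℂ) :=
        (besselJC_hasDerivAt 1 (l * r)).comp (r : ℂ) ((hasDerivAt_id (r : ℂ)).const_mul (l : ℂ))
      refine (((hasDerivAt_id (r : ℂ)).mul h2).div_const (l : ℂ)).congr_deriv ?_
      have := besselJC_recurrence 1 (l * r)
      rw [sub_self, show (1 : ℤ) + 1 = 2 by norm_num] at this ⊢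
      simp only [id, mul_one, one_mul]
      push_cast at this
      field_simp
      linear_combination (-1 : ℂ) * this
    exact h1.comp_ofReal
  rw [intervalIntegral.integral_eq_sub_of_hasDerivAt (fun r _ => hd r)
    (Continuous.intervalIntegrable (by fun_prop) _ _)]
  simp


/-! ### Continuous extension of a classical solution to negative times -/

/-- A solution of the wave equation with its first two derivatives, all of them continuous on the
whole space-time, the equation being satisfied for positive times. -/
structure IsExtendedWave (f : Plane → ℝ) (v : Plane × ℝ → ℝ) (D : Plane × ℝ → Plane × ℝ →L[ℝ] ℝ)
    (D₂ : Plane × ℝ → Plane × ℝ →L[ℝ] Plane × ℝ →L[ℝ] ℝ) : Prop where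
  continuous : Continuous v
  continuous_deriv : Continuous D
  continuous_deriv₂ : Continuous D₂
  hasFDerivAt : ∀ x t, 0 < t → HasFDerivAt v (D (x, t)) (x, t)
  hasFDerivAt_deriv : ∀ x t, 0 < t → HasFDerivAt D (D₂ (x, t)) (x, t)
  wave_eq : ∀ x t, 0 < t → D₂ (x, t) (0, 1) (0, 1)
    = D₂ (x, t) (dir 0, 0) (dir 0, 0) + D₂ (x, t) (dir (Real.pi / 2), 0) (dir (Real.pi / 2), 0)
  initial_value : ∀ x, v (x, 0) = f x
  initial_deriv : ∀ x, HasFDerivAt f ((D (x, 0)).comp (ContinuousLinearMap.inl ℝ Plane ℝ)) x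
  initial_velocity : ∀ x, D (x, 0) (0, 1) = 0

theorem basisFun_eq_dir (i : Fin 2) :
    EuclideanSpace.basisFun (Fin 2) ℝ i = if i = 0 then dir 0 else dir (Real.pi / 2) := by
  fin_cases i
  · ext j; fin_cases j <;> simp [dir]
  · ext j; fin_cases j <;> simp [dir]

theorem laplacian_eq_of_hasFDerivAt {g : Plane → ℝ} {G : Plane → Plane →L[ℝ] ℝ}
    {G' : Plane →L[ℝ] Plane →L[ℝ] ℝ} {x : Plane} (hg : ∀ z, HasFDerivAt g (G z) z)
    (hG : HasFDerivAt G G' x) :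
    Δ g x = G' (dir 0) (dir 0) + G' (dir (Real.pi / 2)) (dir (Real.pi / 2)) := by
  have h : fderiv ℝ g = G := funext fun z => (hg z).fderiv
  rw [InnerProductSpace.laplacian_eq_iteratedFDeriv_orthonormalBasis g
    (EuclideanSpace.basisFun (Fin 2) ℝ)]
  simp only [iteratedFDeriv_two_apply, h, hG.fderiv, Fin.sum_univ_two, basisFun_eq_dir]
  simp

/-- Composing `u` and its within-derivatives with the clamp `t ↦ max t 0` gives functions continuous
on the whole space-time. The later integrals then have globally continuous integrands, while
differentiability is only claimed for `t > 0`. -/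
theorem IsWaveSolution.exists_isExtendedWave {f : Plane → ℝ} {u : Plane → ℝ → ℝ}
    (hu : IsWaveSolution f u) : ∃ v D D₂, IsExtendedWave f v D D₂ ∧
      ∀ x t, 0 ≤ t → v (x, t) = u x t := by
  set S : Set (Plane × ℝ) := univ ×ˢ Ici 0 with hS
  set v₀ : Plane × ℝ → ℝ := fun p => u p.1 p.2 with hv₀
  set D := fderivWithin ℝ v₀ S with hD
  set D₂ := fderivWithin ℝ D S with hD₂
  have huS : UniqueDiffOn ℝ S := uniqueDiffOn_univ.prod (uniqueDiffOn_Ici 0)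
  have hc : ContDiffOn ℝ 2 v₀ S := hu.contDiffOn
  have hc1 : ContDiffOn ℝ 1 D S := hc.fderivWithin huS (by norm_num)
  have hc2 : ContinuousOn D₂ S := hc1.continuousOn_fderivWithin huS le_rfl
  set π : Plane × ℝ → Plane × ℝ := fun p => (p.1, max p.2 0) with hπ
  have hπc : Continuous π := by fun_prop
  have hπS : ∀ p, π p ∈ S := fun p => ⟨mem_univ _, mem_Ici.2 (le_max_right p.2 0)⟩
  have hπid : ∀ x t, 0 ≤ t → π (x, t) = (x, t) := fun x t ht => by simp [hπ, ht]
  have hnhds : ∀ x t, 0 < t → S ∈ 𝓝 (x, t) := fun x t ht =>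
    prod_mem_nhds univ_mem (Ici_mem_nhds ht)
  have hevπ : ∀ x t, 0 < t → ∀ᶠ p in 𝓝 (x, t), π p = p := fun x t ht => by
    filter_upwards [hnhds x t ht] with p hp
    exact hπid p.1 p.2 hp.2
  have hD1 : ∀ x t, 0 < t → HasFDerivAt v₀ (D (x, t)) (x, t) := fun x t ht =>
    ((hc.differentiableOn (by norm_num) (x, t) ⟨mem_univ _, ht.le⟩).hasFDerivWithinAt).hasFDerivAt
      (hnhds x t ht)
  have hD2 : ∀ x t, 0 < t → HasFDerivAt D (D₂ (x, t)) (x, t) := fun x t ht =>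
    ((hc1.differentiableOn (by norm_num) (x, t) ⟨mem_univ _, ht.le⟩).hasFDerivWithinAt).hasFDerivAt
      (hnhds x t ht)
  have hx : ∀ x t, 0 < t → HasFDerivAt (fun z => v₀ (z, t))
      ((D (x, t)).comp (ContinuousLinearMap.inl ℝ Plane ℝ)) x := fun x t ht =>
    HasFDerivAt.comp (f := fun z : Plane => (z, t)) x (hD1 x t ht) (hasFDerivAt_prodMk_left x t)
  have ht' : ∀ x t, 0 < t → HasDerivAt (fun τ => v₀ (x, τ)) (D (x, t) (0, 1)) t := fun x t ht =>
    (hD1 x t ht).comp_hasDerivAt t ((hasDerivAt_const t x).prodMk (hasDerivAt_id t))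
  refine ⟨v₀ ∘ π, D ∘ π, D₂ ∘ π, ⟨?_, ?_, ?_, ?_, ?_, ?_, ?_, ?_, ?_⟩, ?_⟩
  · exact hc.continuousOn.comp_continuous hπc hπS
  · exact hc1.continuousOn.comp_continuous hπc hπS
  · exact hc2.comp_continuous hπc hπS
  · intro x t ht
    rw [Function.comp, hπid x t ht.le]
    exact (hD1 x t ht).congr_of_eventuallyEq ((hevπ x t ht).mono fun p hp => congrArg v₀ hp)
  · intro x t ht
    rw [Function.comp, hπid x t ht.le]
    exact (hD2 x t ht).congr_of_eventuallyEq ((hevπ x t ht).mono fun p hp => congrArg D hp)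
  · intro x t ht
    have hw := hu.wave_eq x t ht.le
    have hG : HasFDerivAt (fun z => (D (z, t)).comp (ContinuousLinearMap.inl ℝ Plane ℝ))
        (((ContinuousLinearMap.compL ℝ Plane (Plane × ℝ) ℝ).flip
          (ContinuousLinearMap.inl ℝ Plane ℝ)).comp
          ((D₂ (x, t)).comp (ContinuousLinearMap.inl ℝ Plane ℝ))) x :=
      ((ContinuousLinearMap.compL ℝ Plane (Plane × ℝ) ℝ).flip
        (ContinuousLinearMap.inl ℝ Plane ℝ)).hasFDerivAt.comp x
        (HasFDerivAt.comp (f := fun z : Plane => (z, t)) x (hD2 x t ht)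
          (hasFDerivAt_prodMk_left x t))
    have hL := laplacian_eq_of_hasFDerivAt (fun z => hx z t ht) hG
    have hI : iteratedDerivWithin 2 (u x) (Ici 0) t = D₂ (x, t) (0, 1) (0, 1) := by
      have hd1 : ∀ τ, 0 < τ → derivWithin (u x) (Ici 0) τ = D (x, τ) (0, 1) := fun τ hτ =>
        (ht' x τ hτ).hasDerivWithinAt.derivWithin (uniqueDiffOn_Ici 0 τ hτ.le)
      have hd2 : HasDerivAt (fun τ => D (x, τ) (0, 1)) (D₂ (x, t) (0, 1) (0, 1)) t := by
        have h := (hD2 x t ht).comp_hasDerivAt t ((hasDerivAt_const t x).prodMk (hasDerivAt_id t))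
        exact h.clm_apply (hasDerivAt_const t ((0 : Plane), (1 : ℝ))) |>.congr_deriv (by simp)
      rw [iteratedDerivWithin_succ, iteratedDerivWithin_one]
      refine HasDerivWithinAt.derivWithin ?_ (uniqueDiffOn_Ici 0 t ht.le)
      refine (hd2.congr_of_eventuallyEq ?_).hasDerivWithinAt
      filter_upwards [Ioi_mem_nhds ht] with τ hτ
      exact hd1 τ hτ
    rw [hI, hL] at hw
    simp only [Function.comp, hπid x t ht.le]
    simpa using hw
  · intro x
    rw [Function.comp, hπid x 0 le_rfl]
    exact hu.initial_value x
  · intro x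
    rw [Function.comp, hπid x 0 le_rfl]
    have h := (hc.differentiableOn (by norm_num) (x, 0) ⟨mem_univ _, self_mem_Ici⟩).hasFDerivWithinAt
    have h2 := HasFDerivWithinAt.comp (f := fun z : Plane => (z, (0 : ℝ))) (s := univ) x h
      (hasFDerivAt_prodMk_left x (0 : ℝ)).hasFDerivWithinAt fun z _ => ⟨mem_univ _, self_mem_Ici⟩
    rw [hasFDerivWithinAt_univ] at h2
    exact (funext hu.initial_value : (fun x => u x 0) = f) ▸ h2
  · intro x
    rw [Function.comp, hπid x 0 le_rfl]
    have h := (hc.differentiableOn (by norm_num) (x, 0) ⟨mem_univ _, self_mem_Ici⟩).hasFDerivWithinAt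
    have h2 := h.comp_hasDerivWithinAt (s := Ici 0) (0 : ℝ)
      ((hasDerivAt_const (0 : ℝ) x).prodMk (hasDerivAt_id (0 : ℝ))).hasDerivWithinAt
      fun t ht => ⟨mem_univ _, ht⟩
    have h3 := h2.derivWithin (uniqueDiffOn_Ici 0 0 self_mem_Ici)
    exact h3.symm.trans (hu.initial_velocity x)
  · intro x t ht
    rw [Function.comp, hπid x t ht]

theorem IsWaveSolution.contDiff_initial {f : Plane → ℝ} {u : Plane → ℝ → ℝ}
    (hu : IsWaveSolution f u) : ContDiff ℝ 2 f := by
  have h := hu.contDiffOn.comp (s := univ) (f := fun x : Plane => (x, (0 : ℝ)))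
    (contDiff_prodMk_left 0).contDiffOn fun x _ => ⟨mem_univ _, self_mem_Ici⟩
  rw [contDiffOn_univ] at h
  convert h using 1
  exact funext fun z => (hu.initial_value z).symm


/-! ### Poisson's formula along the backward light cone -/

namespace IsExtendedWave

variable {f : Plane → ℝ} {v : Plane × ℝ → ℝ} {D : Plane × ℝ → Plane × ℝ →L[ℝ] ℝ}
  {D₂ : Plane × ℝ → Plane × ℝ →L[ℝ] Plane × ℝ →L[ℝ] ℝ}

theorem hasDerivAt_comp (hv : IsExtendedWave f v D D₂) {c : ℝ → Plane × ℝ} {c' : Plane × ℝ}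
    {s : ℝ} (ht : 0 < (c s).2) (hc : HasDerivAt c c' s) :
    HasDerivAt (fun s => v (c s)) (D (c s) c') s :=
  (hv.hasFDerivAt (c s).1 (c s).2 ht).comp_hasDerivAt s hc

theorem hasDerivAt_deriv_comp (hv : IsExtendedWave f v D D₂) {c w : ℝ → Plane × ℝ}
    {c' w' : Plane × ℝ} {s : ℝ} (ht : 0 < (c s).2) (hc : HasDerivAt c c' s)
    (hw : HasDerivAt w w' s) :
    HasDerivAt (fun s => D (c s) (w s)) (D₂ (c s) c' (w s) + D (c s) w') s := by
  have h : HasDerivAt (fun s => D (c s)) (D₂ (c s) c') s :=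
    HasFDerivAt.comp_hasDerivAt (l := D) (f := c) s (hv.hasFDerivAt_deriv (c s).1 (c s).2 ht) hc
  exact h.clm_apply hw

theorem symm (hv : IsExtendedWave f v D D₂) {x : Plane} {t : ℝ} (ht : 0 < t) (a b : Plane × ℝ) :
    D₂ (x, t) a b = D₂ (x, t) b a := by
  refine second_derivative_symmetric_of_eventually (f := v) (f' := D) ?_
    (hv.hasFDerivAt_deriv x t ht) a b
  have : {p : Plane × ℝ | 0 < p.2} ∈ 𝓝 (x, t) :=
    (isOpen_lt continuous_const continuous_snd).mem_nhds ht
  filter_upwards [this] with p hp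
  exact hv.hasFDerivAt p.1 p.2 hp

theorem dir_eq (φ : ℝ) : dir φ = Real.cos φ • dir 0 + Real.sin φ • dir (Real.pi / 2) := by
  ext i; fin_cases i <;> simp [dir]

theorem wave_eq_dir (hv : IsExtendedWave f v D D₂) {x : Plane} {t : ℝ} (ht : 0 < t) (φ : ℝ) :
    D₂ (x, t) (0, 1) (0, 1) = D₂ (x, t) (dir φ, 0) (dir φ, 0)
      + D₂ (x, t) (dir (φ + Real.pi / 2), 0) (dir (φ + Real.pi / 2), 0) := by
  rw [hv.wave_eq x t ht]
  have e : ∀ φ, ((dir φ, 0) : Plane × ℝ)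
      = Real.cos φ • ((dir 0, 0) : Plane × ℝ) + Real.sin φ • ((dir (Real.pi / 2), 0) : Plane × ℝ) := by
    intro φ
    rw [Prod.smul_mk, Prod.smul_mk, Prod.mk_add_mk, ← dir_eq]
    simp
  rw [e φ, e (φ + Real.pi / 2), Real.cos_add_pi_div_two, Real.sin_add_pi_div_two]
  simp only [map_add, map_smul, add_apply, smul_apply, smul_eq_mul]
  have h := Real.sin_sq_add_cos_sq φ
  linear_combination (-(D₂ (x, t) (dir 0, 0) (dir 0, 0)) -
    (D₂ (x, t) (dir (Real.pi / 2), 0) (dir (Real.pi / 2), 0))) * h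

theorem hasDerivAt_dir_add (φ : ℝ) :
    HasDerivAt (fun φ => dir (φ + Real.pi / 2)) (-dir φ) φ := by
  have h := (hasDerivAt_dir (φ + Real.pi / 2)).comp_add_const φ (Real.pi / 2)
  rwa [add_assoc, add_halves, dir_add_pi] at h

/-- The derivative along a light ray of the spherical mean that defines Poisson's formula is a
divergence. -/
theorem poisson_divergence (hv : IsExtendedWave f v D D₂) (y : Plane) (σ α s τ : ℝ) (hτ : 0 < τ) :
    HasDerivAt (fun s => -(Real.sin s * Real.cos s)
        * D (y + (σ * Real.sin s) • dir α, τ) (dir α, 0))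
      (-(Real.cos s ^ 2 - Real.sin s ^ 2) * D (y + (σ * Real.sin s) • dir α, τ) (dir α, 0)
        - Real.sin s * Real.cos s * (σ * Real.cos s)
          * D₂ (y + (σ * Real.sin s) • dir α, τ) (dir α, 0) (dir α, 0)) s ∧
    HasDerivAt (fun α => D (y + (σ * Real.sin s) • dir α, τ) (dir (α + Real.pi / 2), 0))
      (σ * Real.sin s * D₂ (y + (σ * Real.sin s) • dir α, τ) (dir (α + Real.pi / 2), 0)
        (dir (α + Real.pi / 2), 0) - D (y + (σ * Real.sin s) • dir α, τ) (dir α, 0)) α := by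
  constructor
  · have hc : HasDerivAt (fun s => ((y + (σ * Real.sin s) • dir α, τ) : Plane × ℝ))
        ((σ * Real.cos s) • ((dir α, 0) : Plane × ℝ)) s := by
      have h := ((((Real.hasDerivAt_sin s).const_mul σ).smul_const (dir α)).const_add y).prodMk
        (hasDerivAt_const s τ)
      simpa using h
    have h1 := hv.hasDerivAt_deriv_comp (s := s) hτ hc (hasDerivAt_const s ((dir α, 0) : Plane × ℝ))
    refine (((Real.hasDerivAt_sin s).mul (Real.hasDerivAt_cos s)).neg.mul h1).congr_deriv ?_
    simp only [map_smul, smul_apply, map_zero, smul_eq_mul, Pi.neg_apply, Pi.mul_apply]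
    ring
  · have hc : HasDerivAt (fun α => ((y + (σ * Real.sin s) • dir α, τ) : Plane × ℝ))
        ((σ * Real.sin s) • ((dir (α + Real.pi / 2), 0) : Plane × ℝ)) α := by
      have h := (((hasDerivAt_dir α).const_smul (σ * Real.sin s)).const_add y).prodMk
        (hasDerivAt_const α τ)
      simpa using h
    have hw : HasDerivAt (fun α => ((dir (α + Real.pi / 2), 0) : Plane × ℝ)) (-(dir α, 0)) α := by
      simpa using (hasDerivAt_dir_add α).prodMk (hasDerivAt_const α (0 : ℝ))
    refine (hv.hasDerivAt_deriv_comp (s := α) hτ hc hw).congr_deriv ?_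
    simp only [map_smul, smul_apply, map_neg, smul_eq_mul]
    ring

/-- The `s`-part integrates to zero because `sin s cos s` vanishes at `0` and `π/2`, the `α`-part by
periodicity. -/
theorem integral_poisson_divergence (hv : IsExtendedWave f v D D₂) (y : Plane) (σ τ : ℝ)
    (hτ : 0 < τ) :
    ∫ α in (0 : ℝ)..(2 * Real.pi), ∫ s in (0 : ℝ)..(Real.pi / 2),
      (((-(Real.cos s ^ 2 - Real.sin s ^ 2) * D (y + (σ * Real.sin s) • dir α, τ) (dir α, 0)
        - Real.sin s * Real.cos s * (σ * Real.cos s)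
          * D₂ (y + (σ * Real.sin s) • dir α, τ) (dir α, 0) (dir α, 0)))
      - (σ * Real.sin s * D₂ (y + (σ * Real.sin s) • dir α, τ) (dir (α + Real.pi / 2), 0)
        (dir (α + Real.pi / 2), 0) - D (y + (σ * Real.sin s) • dir α, τ) (dir α, 0))) = 0 := by
  have hD := hv.continuous_deriv
  have hD₂ := hv.continuous_deriv₂
  have hI1 : ∀ α, ∫ s in (0 : ℝ)..(Real.pi / 2),
      (-(Real.cos s ^ 2 - Real.sin s ^ 2) * D (y + (σ * Real.sin s) • dir α, τ) (dir α, 0)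
        - Real.sin s * Real.cos s * (σ * Real.cos s)
          * D₂ (y + (σ * Real.sin s) • dir α, τ) (dir α, 0) (dir α, 0)) = 0 := by
    intro α
    rw [intervalIntegral.integral_eq_sub_of_hasDerivAt
      (fun s _ => (hv.poisson_divergence y σ α s τ hτ).1)
      (Continuous.intervalIntegrable (by fun_prop) _ _)]
    simp
  have hI2 : ∀ s, ∫ α in (0 : ℝ)..(2 * Real.pi),
      (σ * Real.sin s * D₂ (y + (σ * Real.sin s) • dir α, τ) (dir (α + Real.pi / 2), 0)
        (dir (α + Real.pi / 2), 0) - D (y + (σ * Real.sin s) • dir α, τ) (dir α, 0)) = 0 := by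
    intro s
    rw [intervalIntegral.integral_eq_sub_of_hasDerivAt
      (fun α _ => (hv.poisson_divergence y σ α s τ hτ).2)
      (Continuous.intervalIntegrable (by fun_prop) _ _)]
    have e1 : dir (2 * Real.pi) = dir 0 := by simpa using dir_add_two_pi 0
    have e2 : dir (2 * Real.pi + Real.pi / 2) = dir (0 + Real.pi / 2) := by
      rw [← dir_add_two_pi (0 + Real.pi / 2)]; congr 1; ring
    rw [e1, e2, sub_self]
  have hsplit : ∀ α : ℝ, ∫ s in (0 : ℝ)..(Real.pi / 2),
      (((-(Real.cos s ^ 2 - Real.sin s ^ 2) * D (y + (σ * Real.sin s) • dir α, τ) (dir α, 0)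
        - Real.sin s * Real.cos s * (σ * Real.cos s)
          * D₂ (y + (σ * Real.sin s) • dir α, τ) (dir α, 0) (dir α, 0)))
      - (σ * Real.sin s * D₂ (y + (σ * Real.sin s) • dir α, τ) (dir (α + Real.pi / 2), 0)
        (dir (α + Real.pi / 2), 0) - D (y + (σ * Real.sin s) • dir α, τ) (dir α, 0)))
      = -∫ s in (0 : ℝ)..(Real.pi / 2), (σ * Real.sin s * D₂ (y + (σ * Real.sin s) • dir α, τ)
        (dir (α + Real.pi / 2), 0) (dir (α + Real.pi / 2), 0)
        - D (y + (σ * Real.sin s) • dir α, τ) (dir α, 0)) := by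
    intro α
    rw [intervalIntegral.integral_sub (Continuous.intervalIntegrable (by fun_prop) _ _)
      (Continuous.intervalIntegrable (by fun_prop) _ _), hI1, zero_sub]
  simp only [hsplit]
  rw [intervalIntegral.integral_neg, intervalIntegral_swap_of_continuous (by fun_prop)]
  simp only [hI2]
  simp

/-- Poisson's formula. -/
theorem poisson (hv : IsExtendedWave f v D D₂) (y : Plane) {t : ℝ} (ht : 0 ≤ t) :
    v (y, t) = 1 / (2 * Real.pi) * ∫ α in (0 : ℝ)..(2 * Real.pi), ∫ s in (0 : ℝ)..(Real.pi / 2),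
      (f (y + (t * Real.sin s) • dir α)
        + t * Real.sin s * fderiv ℝ f (y + (t * Real.sin s) • dir α) (dir α)) * Real.sin s := by
  have hV := hv.continuous
  have hD := hv.continuous_deriv
  have hD₂ := hv.continuous_deriv₂
  -- This is Kirchhoff's integrand by descent: `s` and `α` parametrise a hemisphere projected to the
  -- plane, with surface element `sin s`. Its integral over the section at time `t - σ` of the
  -- backward cone from `(y, t)` does not depend on `σ`; `σ = 0` gives `2π v(y, t)` and `σ = t` the
  -- initial data.
  set F : ℝ → ℝ → ℝ → ℝ := fun σ α s => (v (y + (σ * Real.sin s) • dir α, t - σ)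
    + σ * D (y + (σ * Real.sin s) • dir α, t - σ) (Real.sin s • dir α, 1)) * Real.sin s with hF
  set F' : ℝ → ℝ → ℝ → ℝ := fun σ α s =>
    (D (y + (σ * Real.sin s) • dir α, t - σ) (Real.sin s • dir α, -1)
    + (D (y + (σ * Real.sin s) • dir α, t - σ) (Real.sin s • dir α, 1)
      + σ * D₂ (y + (σ * Real.sin s) • dir α, t - σ) (Real.sin s • dir α, -1)
        (Real.sin s • dir α, 1))) * Real.sin s with hF'
  have hFc : Continuous fun p : ℝ × ℝ × ℝ => F p.1 p.2.1 p.2.2 := by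
    simp only [hF]; fun_prop
  have hF'c : Continuous fun p : ℝ × ℝ × ℝ => F' p.1 p.2.1 p.2.2 := by
    simp only [hF']; fun_prop
  have hd : ∀ σ ∈ Iio t, ∀ α ∈ Ioo 0 (2 * Real.pi), ∀ s ∈ Ioo 0 (Real.pi / 2),
      HasDerivAt (fun σ => F σ α s) (F' σ α s) σ := by
    intro σ hσ α _ s _
    have hc : HasDerivAt (fun σ => ((y + (σ * Real.sin s) • dir α, t - σ) : Plane × ℝ))
        (Real.sin s • dir α, -1) σ := by
      have h := ((((hasDerivAt_id σ).mul_const (Real.sin s)).smul_const (dir α)).const_add y).prodMk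
        ((hasDerivAt_id σ).const_sub t)
      simpa using h
    have hpos : 0 < t - σ := sub_pos.2 hσ
    have h1 := hv.hasDerivAt_comp (s := σ) hpos hc
    have h2 := hv.hasDerivAt_deriv_comp (s := σ) hpos hc
      (hasDerivAt_const σ ((Real.sin s • dir α, 1) : Plane × ℝ))
    refine ((h1.add ((hasDerivAt_id σ).mul h2)).mul_const (Real.sin s)).congr_deriv ?_
    simp [hF']
  have hF'int : ∀ σ ∈ Iio t, ∫ α in (0 : ℝ)..(2 * Real.pi), ∫ s in (0 : ℝ)..(Real.pi / 2), F' σ α s = 0 := by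
    intro σ hσ
    have hpos : 0 < t - σ := sub_pos.2 hσ
    refine Eq.trans ?_ (hv.integral_poisson_divergence y σ (t - σ) hpos)
    refine intervalIntegral.integral_congr fun α _ => ?_
    refine intervalIntegral.integral_congr fun s _ => ?_
    have e1 : ((Real.sin s • dir α, 1) : Plane × ℝ)
      = Real.sin s • ((dir α, 0) : Plane × ℝ) + (0, 1) := by simp
    have e2 : ((Real.sin s • dir α, -1) : Plane × ℝ)
      = Real.sin s • ((dir α, 0) : Plane × ℝ) - (0, 1) := by simp
    -- The wave equation in the frame `dir α`, `dir (α + π/2)` removes the second time derivative;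
    -- symmetry of the second derivative cancels the mixed terms.
    have hw := hv.wave_eq_dir (x := y + (σ * Real.sin s) • dir α) hpos α
    have hsy := hv.symm (x := y + (σ * Real.sin s) • dir α) hpos (dir α, 0) (0, 1)
    have hcs := Real.sin_sq_add_cos_sq s
    simp only [hF', e1, e2, map_add, map_sub, map_smul, 
      sub_apply, smul_apply, smul_eq_mul]
    have hcs' : Real.cos s ^ 2 = 1 - Real.sin s ^ 2 := by linarith
    rw [hw, hsy, show Real.sin s * Real.cos s * (σ * Real.cos s) = σ * Real.sin s * Real.cos s ^ 2 by ring, hcs']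
    ring
  have hder : ∀ σ ∈ Iio t, HasDerivAt
      (fun σ => ∫ α in (0 : ℝ)..(2 * Real.pi), ∫ s in (0 : ℝ)..(Real.pi / 2), F σ α s) 0 σ := by
    intro σ hσ
    exact (hasDerivAt_intervalIntegral₂_of_continuous hFc hF'c Real.two_pi_pos.le
      (by positivity) isOpen_Iio hd hσ).congr_deriv (hF'int σ hσ)
  have hcont : Continuous
      (fun σ => ∫ α in (0 : ℝ)..(2 * Real.pi), ∫ s in (0 : ℝ)..(Real.pi / 2), F σ α s) := by
    refine continuous_intervalIntegral (f := fun σ α => ∫ s in (0 : ℝ)..(Real.pi / 2), F σ α s) ?_ _ _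
    exact continuous_intervalIntegral (f := fun (p : ℝ × ℝ) s => F p.1 p.2 s)
      (hFc.comp (by fun_prop : Continuous fun q : (ℝ × ℝ) × ℝ => (q.1.1, q.1.2, q.2))) _ _
  have heq : ∫ α in (0 : ℝ)..(2 * Real.pi), ∫ s in (0 : ℝ)..(Real.pi / 2), F 0 α s
      = ∫ α in (0 : ℝ)..(2 * Real.pi), ∫ s in (0 : ℝ)..(Real.pi / 2), F t α s := by
    rcases ht.eq_or_lt with rfl | htpos
    · rfl
    · obtain ⟨c, hc, hc'⟩ := exists_hasDerivAt_eq_slope _ (fun _ => 0) htpos hcont.continuousOn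
        fun σ hσ => hder σ hσ.2
      rw [eq_div_iff (by linarith), zero_mul] at hc'
      linarith
  have h0 : ∫ α in (0 : ℝ)..(2 * Real.pi), ∫ s in (0 : ℝ)..(Real.pi / 2), F 0 α s
      = 2 * Real.pi * v (y, t) := by
    simp [hF]
  have h1 : ∀ α s, F t α s = (f (y + (t * Real.sin s) • dir α)
        + t * Real.sin s * fderiv ℝ f (y + (t * Real.sin s) • dir α) (dir α)) * Real.sin s := by
    intro α s
    have e1 : ((Real.sin s • dir α, 1) : Plane × ℝ)
      = Real.sin s • ((dir α, 0) : Plane × ℝ) + (0, 1) := by simp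
    simp only [hF, sub_self, hv.initial_value, e1, map_add, map_smul, hv.initial_velocity,
      (hv.initial_deriv _).fderiv]
    rw [ContinuousLinearMap.comp_apply, ContinuousLinearMap.inl_apply, smul_eq_mul]
    ring
  simp only [h1] at heq
  rw [← heq, h0]
  field_simp

end IsExtendedWave


/-! ### Finite speed of propagation, decay and growth -/

section Support

variable {f : Plane → ℝ} {R : ℝ}

theorem hasCompactSupport_of_vanish (hf : ∀ x : Plane, R < ‖x‖ → f x = 0) : HasCompactSupport f := by
  refine HasCompactSupport.intro (isCompact_closedBall (0 : Plane) R) fun x hx => hf x ?_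
  simpa using hx

theorem fderiv_eq_zero_of_vanish {E : Type*} [NormedAddCommGroup E] [NormedSpace ℝ E] {g : Plane → E}
    (hg : ∀ x : Plane, R < ‖x‖ → g x = 0) (x : Plane) (hx : R < ‖x‖) : fderiv ℝ g x = 0 := by
  have : g =ᶠ[𝓝 x] fun _ => 0 := by
    filter_upwards [(isOpen_lt continuous_const continuous_norm).mem_nhds hx] with z hz
    exact hg z hz
  rw [this.fderiv_eq, fderiv_fun_const]
  rfl

theorem exists_bound_of_vanish (hc : ContDiff ℝ 2 f) (hf : ∀ x : Plane, R < ‖x‖ → f x = 0) :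
    ∃ M, 0 ≤ M ∧ (∀ x, |f x| ≤ M) ∧ (∀ x, ‖fderiv ℝ f x‖ ≤ M) ∧
      ∀ x, ‖fderiv ℝ (fderiv ℝ f) x‖ ≤ M := by
  have hs := hasCompactSupport_of_vanish hf
  have hc1 : ContDiff ℝ 1 (fderiv ℝ f) := hc.fderiv_right (by norm_num)
  obtain ⟨a, ha⟩ := hc.continuous.bounded_above_of_compact_support hs
  obtain ⟨b, hb⟩ := hc1.continuous.bounded_above_of_compact_support (hs.fderiv ℝ)
  obtain ⟨c, hc⟩ := (hc1.continuous_fderiv one_ne_zero).bounded_above_of_compact_support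
    ((hs.fderiv ℝ).fderiv ℝ)
  refine ⟨max a (max b c), (norm_nonneg _).trans ((ha 0).trans (le_max_left _ _)),
    fun x => (ha x).trans (le_max_left _ _),
    fun x => (hb x).trans ((le_max_left _ _).trans (le_max_right _ _)),
    fun x => (hc x).trans ((le_max_right _ _).trans (le_max_right _ _))⟩

end Support

namespace IsExtendedWave

variable {f : Plane → ℝ} {v : Plane × ℝ → ℝ} {D : Plane × ℝ → Plane × ℝ →L[ℝ] ℝ}
  {D₂ : Plane × ℝ → Plane × ℝ →L[ℝ] Plane × ℝ →L[ℝ] ℝ} {R : ℝ}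

/-- Finite speed of propagation. -/
theorem eq_zero_of_lt (hv : IsExtendedWave f v D D₂) (hf : ∀ x : Plane, R < ‖x‖ → f x = 0)
    {y : Plane} {t : ℝ} (ht : 0 ≤ t) (hy : R + t < ‖y‖) : v (y, t) = 0 := by
  have h : ∀ α s, R < ‖y + (t * Real.sin s) • dir α‖ := by
    intro α s
    have h1 : ‖(t * Real.sin s) • dir α‖ ≤ t := by
      rw [norm_smul, norm_dir, mul_one, Real.norm_eq_abs, abs_mul, abs_of_nonneg ht]
      exact mul_le_of_le_one_right ht (Real.abs_sin_le_one s)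
    have h2 := norm_sub_le_norm_add y ((t * Real.sin s) • dir α)
    linarith
  rw [hv.poisson y ht]
  simp [hf _ (h _ _), fderiv_eq_zero_of_vanish hf _ (h _ _)]

theorem deriv_eq_zero_of_lt (hv : IsExtendedWave f v D D₂) (hf : ∀ x : Plane, R < ‖x‖ → f x = 0)
    {y : Plane} {t : ℝ} (ht : 0 < t) (hy : R + t < ‖y‖) : D (y, t) = 0 := by
  have h : v =ᶠ[𝓝 (y, t)] fun _ => 0 := by
    have h1 : {p : Plane × ℝ | 0 < p.2} ∈ 𝓝 (y, t) :=
      (isOpen_lt continuous_const continuous_snd).mem_nhds ht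
    have h2 : {p : Plane × ℝ | R + p.2 < ‖p.1‖} ∈ 𝓝 (y, t) :=
      (isOpen_lt (by fun_prop) (by fun_prop)).mem_nhds hy
    filter_upwards [h1, h2] with p hp hp'
    exact hv.eq_zero_of_lt hf (le_of_lt hp) hp'
  exact (hv.hasFDerivAt y t ht).unique ((hasFDerivAt_const 0 (y, t)).congr_of_eventuallyEq h)

/-- Decay of the solution in the disk that contains the support of the initial value. -/
theorem exists_decay (hv : IsExtendedWave f v D D₂) (hc : ContDiff ℝ 2 f) (hR : 0 < R)
    (hf : ∀ x : Plane, R < ‖x‖ → f x = 0) :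
    ∃ C, ∀ y t, 0 < t → ‖y‖ ≤ R → |v (y, t)| ≤ C / t ^ 2 := by
  obtain ⟨M, hM, hM0, hM1, -⟩ := exists_bound_of_vanish hc hf
  refine ⟨(M + 2 * R * M) * (Real.pi * R) ^ 2, fun y t ht hy => ?_⟩
  have hpi := Real.pi_pos
  set h : ℝ → ℝ → ℝ := fun α s => (f (y + (t * Real.sin s) • dir α)
        + t * Real.sin s * fderiv ℝ f (y + (t * Real.sin s) • dir α) (dir α)) * Real.sin s with hh
  -- If `t sin s ≤ 2R`, Jordan's inequality gives `s ≤ (π/2) sin s ≤ πR/t`; for larger `t sin s` the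
  -- point lies outside the support. The surviving interval has length at most `c`, and the weight
  -- `sin s` is at most `c` there: together `c²`, of order `t⁻²`.
  set c := Real.pi * R / t with hc
  have hcpos : 0 < c := by positivity
  have hsin : ∀ s ∈ Ioc 0 (Real.pi / 2), 0 ≤ Real.sin s ∧ s ≤ Real.pi / 2 * Real.sin s := by
    intro s hs
    have := Real.mul_le_sin hs.1.le hs.2
    constructor
    · exact Real.sin_nonneg_of_nonneg_of_le_pi hs.1.le (by linarith [hs.2])
    · rw [← div_le_iff₀' (by positivity)]
      refine le_trans (le_of_eq ?_) this
      field_simp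
  have hzero : ∀ α, ∀ s ∈ Ioc 0 (Real.pi / 2), 2 * R < t * Real.sin s → h α s = 0 := by
    intro α s hs hlt
    have h1 : R < ‖y + (t * Real.sin s) • dir α‖ := by
      have h2 := norm_sub_le_norm_add ((t * Real.sin s) • dir α) y
      rw [norm_smul_dir (mul_nonneg ht.le (hsin s hs).1), add_comm _ y] at h2
      linarith
    simp [hh, hf _ h1, fderiv_eq_zero_of_vanish hf _ h1]
  have hbound : ∀ α, ∀ s ∈ Ioc 0 (Real.pi / 2), t * Real.sin s ≤ 2 * R →
      s ≤ c ∧ ‖h α s‖ ≤ (M + 2 * R * M) * c := by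
    intro α s hs hle
    obtain ⟨hs0, hs1⟩ := hsin s hs
    have hsc : s ≤ c := by
      rw [hc, le_div_iff₀ ht]
      nlinarith
    refine ⟨hsc, ?_⟩
    rw [hh, norm_mul]
    refine mul_le_mul ?_ ?_ (norm_nonneg _) (by positivity)
    · refine (norm_add_le _ _).trans (add_le_add (hM0 _) ?_)
      rw [norm_mul, Real.norm_of_nonneg (mul_nonneg ht.le hs0)]
      refine mul_le_mul hle ?_ (norm_nonneg _) (by positivity)
      refine (ContinuousLinearMap.le_opNorm _ _).trans ?_
      rw [norm_dir, mul_one]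
      exact hM1 _
    · rw [Real.norm_of_nonneg hs0]
      exact (Real.sin_le hs.1.le).trans hsc
  have hinner : ∀ α, ‖∫ s in (0 : ℝ)..(Real.pi / 2), h α s‖ ≤ (M + 2 * R * M) * c * c := by
    intro α
    have hsub : Ioc 0 (Real.pi / 2) ∩ Iic c ⊆ Ioc 0 (Real.pi / 2) := inter_subset_left
    rw [intervalIntegral.integral_of_le (by positivity),
      setIntegral_eq_of_subset_of_forall_sdiff_eq_zero measurableSet_Ioc hsub]
    · have hm : volume (Ioc 0 (Real.pi / 2) ∩ Iic c) ≤ ENNReal.ofReal c := by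
        calc volume (Ioc 0 (Real.pi / 2) ∩ Iic c) ≤ volume (Ioc 0 c) :=
              measure_mono fun s hs => ⟨hs.1.1, hs.2⟩
          _ = ENNReal.ofReal c := by simp
      refine (norm_setIntegral_le_of_norm_le_const (hm.trans_lt ENNReal.ofReal_lt_top)
        (C := (M + 2 * R * M) * c) fun s hs => ?_).trans ?_
      · by_cases hle : t * Real.sin s ≤ 2 * R
        · exact (hbound α s hs.1 hle).2
        · rw [hzero α s hs.1 (not_le.1 hle), norm_zero]
          positivity
      · refine mul_le_mul_of_nonneg_left ?_ (by positivity)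
        exact ENNReal.toReal_le_of_le_ofReal hcpos.le hm
    · intro s hs
      refine hzero α s hs.1 ?_
      by_contra hcon
      exact hs.2 ⟨hs.1, (hbound α s hs.1 (not_lt.1 hcon)).1⟩
  have hall := intervalIntegral.norm_integral_le_of_norm_le_const (a := 0) (b := 2 * Real.pi)
    (f := fun α => ∫ s in (0 : ℝ)..(Real.pi / 2), h α s) (fun α _ => hinner α)
  rw [hv.poisson y ht.le, abs_mul, abs_of_pos (by positivity)]
  rw [sub_zero, abs_of_pos (by positivity)] at hall
  calc _ ≤ 1 / (2 * Real.pi) * ((M + 2 * R * M) * c * c * (2 * Real.pi)) :=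
        mul_le_mul_of_nonneg_left hall (by positivity)
    _ = _ := by rw [hc]; field_simp

theorem abs_poisson_le {C : ℝ} {h : ℝ → ℝ → ℝ} (hh : ∀ α s, |h α s| ≤ C) :
    |1 / (2 * Real.pi) * ∫ α in (0 : ℝ)..(2 * Real.pi), ∫ s in (0 : ℝ)..(Real.pi / 2), h α s|
      ≤ 2 * C := by
  have hpi := Real.pi_pos
  have h1 := norm_intervalIntegral₂_le (F := h) Real.two_pi_pos.le (by positivity : (0 : ℝ) ≤ Real.pi / 2)
    (fun α _ s _ => hh α s)
  have hC : 0 ≤ C := (abs_nonneg _).trans (hh 0 0)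
  rw [abs_mul, abs_of_pos (by positivity)]
  calc _ ≤ 1 / (2 * Real.pi) * (C * (Real.pi / 2 - 0) * (2 * Real.pi - 0)) :=
        mul_le_mul_of_nonneg_left h1 (by positivity)
    _ = Real.pi / 2 * C := by field_simp; ring
    _ ≤ 2 * C := by
        have := Real.pi_le_four
        gcongr
        linarith

/-- At most linear growth in time of the solution and of its time derivative. -/
theorem exists_growth (hv : IsExtendedWave f v D D₂) (hc : ContDiff ℝ 2 f)
    (hf : ∀ x : Plane, R < ‖x‖ → f x = 0) :
    ∃ C, 0 ≤ C ∧ ∀ y t, 0 < t → |v (y, t)| ≤ C * (1 + t) ∧ |D (y, t) (0, 1)| ≤ C * (1 + t) := by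
  obtain ⟨M, hM, hM0, hM1, hM2⟩ := exists_bound_of_vanish hc hf
  have hc1 : ContDiff ℝ 1 (fderiv ℝ f) := hc.fderiv_right (by norm_num)
  have hcf := hc.continuous
  have hcf1 := hc1.continuous
  have hcf2 := hc1.continuous_fderiv one_ne_zero
  refine ⟨4 * M, by positivity, fun y t ht => ⟨?_, ?_⟩⟩
  · rw [hv.poisson y ht.le]
    refine (abs_poisson_le (C := M * (1 + t)) fun α s => ?_).trans (by nlinarith)
    rw [abs_mul]
    refine (mul_le_of_le_one_right (abs_nonneg _) (Real.abs_sin_le_one s)).trans ?_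
    refine (abs_add_le _ _).trans ?_
    have h1 := hM0 (y + (t * Real.sin s) • dir α)
    have h2 : |fderiv ℝ f (y + (t * Real.sin s) • dir α) (dir α)| ≤ M := by
      rw [← Real.norm_eq_abs]
      refine (ContinuousLinearMap.le_opNorm _ _).trans ?_
      rw [norm_dir, mul_one]
      exact hM1 _
    rw [abs_mul, abs_mul, abs_of_pos ht]
    have h3 : t * |Real.sin s| ≤ t := mul_le_of_le_one_right ht.le (Real.abs_sin_le_one s)
    have h4 := mul_le_mul h3 h2 (abs_nonneg _) ht.le
    linarith
  · set F : ℝ → ℝ → ℝ → ℝ := fun t α s => (f (y + (t * Real.sin s) • dir α)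
        + t * Real.sin s * fderiv ℝ f (y + (t * Real.sin s) • dir α) (dir α)) * Real.sin s with hF
    set F' : ℝ → ℝ → ℝ → ℝ := fun t α s =>
        (Real.sin s * fderiv ℝ f (y + (t * Real.sin s) • dir α) (dir α)
        + (Real.sin s * fderiv ℝ f (y + (t * Real.sin s) • dir α) (dir α)
          + t * Real.sin s * (Real.sin s * fderiv ℝ (fderiv ℝ f) (y + (t * Real.sin s) • dir α)
            (dir α) (dir α)))) * Real.sin s with hF'
    have hFc : Continuous fun p : ℝ × ℝ × ℝ => F p.1 p.2.1 p.2.2 := by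
      simp only [hF]; fun_prop
    have hF'c : Continuous fun p : ℝ × ℝ × ℝ => F' p.1 p.2.1 p.2.2 := by
      simp only [hF']; fun_prop
    have hd : ∀ t α s, HasDerivAt (fun t => F t α s) (F' t α s) t := by
      intro t α s
      have hcurve : HasDerivAt (fun t => y + (t * Real.sin s) • dir α) (Real.sin s • dir α) t := by
        have := (((hasDerivAt_id t).mul_const (Real.sin s)).smul_const (dir α)).const_add y
        simpa using this
      have h1 := ((hc.differentiable (by norm_num)) (y + (t * Real.sin s) • dir α)).hasFDerivAt.comp_hasDerivAt
        t hcurve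
      have h2 : HasDerivAt (fun t => fderiv ℝ f (y + (t * Real.sin s) • dir α))
          (fderiv ℝ (fderiv ℝ f) (y + (t * Real.sin s) • dir α) (Real.sin s • dir α)) t :=
        HasFDerivAt.comp_hasDerivAt (l := fderiv ℝ f) (f := fun t : ℝ => y + (t * Real.sin s) • dir α) t
          ((hc1.differentiable one_ne_zero) (y + (t * Real.sin s) • dir α)).hasFDerivAt hcurve
      have h3 := h2.clm_apply (hasDerivAt_const t (dir α))
      refine ((h1.add (((hasDerivAt_id t).mul_const (Real.sin s)).mul h3)).mul_const
        (Real.sin s)).congr_deriv ?_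
      simp [hF']
    have hder := (hasDerivAt_intervalIntegral₂_of_continuous hFc hF'c Real.two_pi_pos.le
      (by positivity : (0 : ℝ) ≤ Real.pi / 2) isOpen_univ (fun t _ α _ s _ => hd t α s) (mem_univ t)).const_mul
      (1 / (2 * Real.pi))
    have hder2 : HasDerivAt (fun τ => v (y, τ)) (D (y, t) (0, 1)) t :=
      hv.hasDerivAt_comp (s := t) ht ((hasDerivAt_const t y).prodMk (hasDerivAt_id t))
    have hder3 := hder.congr_of_eventuallyEq (f₁ := fun τ => v (y, τ)) (by
      filter_upwards [Ioi_mem_nhds ht] with τ hτ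
      exact hv.poisson y (le_of_lt hτ))
    -- The time derivative is identified with that of Poisson's integral, whose integrand involves
    -- at most second derivatives of `f`.
    rw [hder2.unique hder3]
    refine (abs_poisson_le (C := 2 * M * (1 + t)) fun α s => ?_).trans (by nlinarith)
    rw [hF', abs_mul]
    refine (mul_le_of_le_one_right (abs_nonneg _) (Real.abs_sin_le_one s)).trans ?_
    have h2 : |fderiv ℝ f (y + (t * Real.sin s) • dir α) (dir α)| ≤ M := by
      rw [← Real.norm_eq_abs]
      refine (ContinuousLinearMap.le_opNorm _ _).trans ?_
      rw [norm_dir, mul_one]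
      exact hM1 _
    have h3 : |fderiv ℝ (fderiv ℝ f) (y + (t * Real.sin s) • dir α) (dir α) (dir α)| ≤ M := by
      rw [← Real.norm_eq_abs]
      refine (ContinuousLinearMap.le_opNorm₂ _ _ _).trans ?_
      rw [norm_dir, mul_one, mul_one]
      exact hM2 _
    have hs := Real.abs_sin_le_one s
    have h4 : |Real.sin s * fderiv ℝ f (y + (t * Real.sin s) • dir α) (dir α)| ≤ M := by
      rw [abs_mul]
      exact (mul_le_mul hs h2 (abs_nonneg _) zero_le_one).trans (by rw [one_mul])
    have h5 : |t * Real.sin s * (Real.sin s * fderiv ℝ (fderiv ℝ f) (y + (t * Real.sin s) • dir α)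
            (dir α) (dir α))| ≤ t * M := by
      rw [abs_mul, abs_mul, abs_mul, abs_of_pos ht]
      refine mul_le_mul (mul_le_of_le_one_right ht.le hs) ?_ (by positivity) ht.le
      exact (mul_le_mul hs h3 (abs_nonneg _) zero_le_one).trans (by rw [one_mul])
    have h6 := abs_add_le (Real.sin s * fderiv ℝ f (y + (t * Real.sin s) • dir α) (dir α))
      (t * Real.sin s * (Real.sin s * fderiv ℝ (fderiv ℝ f) (y + (t * Real.sin s) • dir α)
            (dir α) (dir α)))
    refine (abs_add_le _ _).trans ?_
    nlinarith

end IsExtendedWave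


/-! ### Angular modes of the solution -/

/-- The angular integral `∫_0^{2π} g(r e(α)) e^{-i k α} dα`. -/
noncomputable def angMode (k : ℤ) (g : Plane → ℂ) (r : ℝ) : ℂ :=
  ∫ α in (0 : ℝ)..(2 * Real.pi), g (r • dir α) * Complex.exp (-(Complex.I * k * α))

/-- The angular mode of the Laplace transform in time of the solution, up to time `T`. -/
noncomputable def modeTrunc (v : Plane × ℝ → ℝ) (k : ℤ) (l : ℂ) (T r : ℝ) : ℂ :=
  ∫ α in (0 : ℝ)..(2 * Real.pi), ∫ t in (0 : ℝ)..T,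
    (v (r • dir α, t) : ℂ) * (Complex.exp (-(Complex.I * k * α)) * Complex.exp (Complex.I * t * l))

/-- The angular mode of `r ∂_r u`, transformed in time up to time `T`. -/
noncomputable def modeTruncDeriv (D : Plane × ℝ → Plane × ℝ →L[ℝ] ℝ) (k : ℤ) (l : ℂ) (T r : ℝ) : ℂ :=
  ∫ α in (0 : ℝ)..(2 * Real.pi), ∫ t in (0 : ℝ)..T,
    ((r * D (r • dir α, t) (dir α, 0) : ℝ) : ℂ)
      * (Complex.exp (-(Complex.I * k * α)) * Complex.exp (Complex.I * t * l))

/-- The boundary term at time `T` of the transformed wave equation. -/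
noncomputable def modeBdry (v : Plane × ℝ → ℝ) (D : Plane × ℝ → Plane × ℝ →L[ℝ] ℝ) (k : ℤ) (l : ℂ)
    (T r : ℝ) : ℂ :=
  angMode k (fun x => ((D (x, T) (0, 1) : ℝ) - Complex.I * l * (v (x, T) : ℝ))
    * Complex.exp (Complex.I * T * l)) r

theorem continuous_angMode (k : ℤ) {g : Plane → ℂ} (hg : Continuous g) : Continuous (angMode k g) :=
  continuous_intervalIntegral (f := fun (r : ℝ) (α : ℝ) => g (r • dir α) * Complex.exp (-(Complex.I * k * α)))
    (by fun_prop) _ _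

theorem exp_neg_int_mul_two_pi (k : ℤ) :
    Complex.exp (-(Complex.I * k * (2 * Real.pi : ℝ))) = 1 := by
  rw [show -(Complex.I * k * ((2 * Real.pi : ℝ) : ℂ)) = (-k : ℤ) * (2 * Real.pi * Complex.I) by
    push_cast; ring, Complex.exp_int_mul_two_pi_mul_I]

theorem dir_two_pi : dir (2 * Real.pi) = dir 0 := by
  simpa using dir_add_two_pi 0

theorem hasDerivAt_exp_neg_int (k : ℤ) (α : ℝ) :
    HasDerivAt (fun α : ℝ => Complex.exp (-(Complex.I * k * α)))
      (Complex.exp (-(Complex.I * k * α)) * (-(Complex.I * k))) α := by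
  have h := ((hasDerivAt_id α).ofReal_comp.const_mul (Complex.I * k)).neg
  simpa using h.cexp

theorem hasDerivAt_exp_time (l : ℂ) (t : ℝ) :
    HasDerivAt (fun t : ℝ => Complex.exp (Complex.I * t * l))
      (Complex.exp (Complex.I * t * l) * (Complex.I * l)) t := by
  have h := (((hasDerivAt_id t).ofReal_comp.const_mul Complex.I).mul_const l)
  simpa using h.cexp

namespace IsExtendedWave

variable {f : Plane → ℝ} {v : Plane × ℝ → ℝ} {D : Plane × ℝ → Plane × ℝ →L[ℝ] ℝ}
  {D₂ : Plane × ℝ → Plane × ℝ →L[ℝ] Plane × ℝ →L[ℝ] ℝ} {R : ℝ}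

theorem continuous_modeTrunc (hv : IsExtendedWave f v D D₂) (k : ℤ) (l : ℂ) (T : ℝ) :
    Continuous (modeTrunc v k l T) := by
  have hV := hv.continuous
  refine continuous_intervalIntegral (f := fun (r : ℝ) (α : ℝ) => ∫ t in (0 : ℝ)..T,
    (v (r • dir α, t) : ℂ) * (Complex.exp (-(Complex.I * k * α)) * Complex.exp (Complex.I * t * l))) ?_ _ _
  exact continuous_intervalIntegral (f := fun (p : ℝ × ℝ) t => (v (p.1 • dir p.2, t) : ℂ) *
    (Complex.exp (-(Complex.I * k * p.2)) * Complex.exp (Complex.I * t * l))) (by fun_prop) _ _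

theorem continuous_modeTruncDeriv (hv : IsExtendedWave f v D D₂) (k : ℤ) (l : ℂ) (T : ℝ) :
    Continuous (modeTruncDeriv D k l T) := by
  have hD := hv.continuous_deriv
  refine continuous_intervalIntegral (f := fun (r : ℝ) (α : ℝ) => ∫ t in (0 : ℝ)..T,
    ((r * D (r • dir α, t) (dir α, 0) : ℝ) : ℂ) *
      (Complex.exp (-(Complex.I * k * α)) * Complex.exp (Complex.I * t * l))) ?_ _ _
  exact continuous_intervalIntegral (f := fun (p : ℝ × ℝ) t =>
    ((p.1 * D (p.1 • dir p.2, t) (dir p.2, 0) : ℝ) : ℂ) *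
    (Complex.exp (-(Complex.I * k * p.2)) * Complex.exp (Complex.I * t * l))) (by fun_prop) _ _

theorem continuous_modeBdry (hv : IsExtendedWave f v D D₂) (k : ℤ) (l : ℂ) (T : ℝ) :
    Continuous (modeBdry v D k l T) := by
  have hV := hv.continuous
  have hD := hv.continuous_deriv
  exact continuous_angMode k (g := fun x => ((D (x, T) (0, 1) : ℝ) - Complex.I * l * (v (x, T) : ℝ))
    * Complex.exp (Complex.I * T * l)) (by fun_prop)

theorem hasDerivAt_radial (hv : IsExtendedWave f v D D₂) (α r : ℝ) {t : ℝ} (ht : 0 < t) :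
    HasDerivAt (fun r => v (r • dir α, t)) (D (r • dir α, t) (dir α, 0)) r ∧
    HasDerivAt (fun r => D (r • dir α, t) (dir α, 0)) (D₂ (r • dir α, t) (dir α, 0) (dir α, 0)) r := by
  have hc : HasDerivAt (fun r : ℝ => ((r • dir α, t) : Plane × ℝ)) (dir α, 0) r := by
    simpa using ((hasDerivAt_id r).smul_const (dir α)).prodMk (hasDerivAt_const r t)
  refine ⟨hv.hasDerivAt_comp (s := r) ht hc, ?_⟩
  simpa using hv.hasDerivAt_deriv_comp (s := r) ht hc (hasDerivAt_const r ((dir α, 0) : Plane × ℝ))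

theorem hasDerivAt_modeTrunc (hv : IsExtendedWave f v D D₂) (k : ℤ) (l : ℂ) {T : ℝ} (hT : 0 ≤ T)
    {r : ℝ} (hr : 0 < r) :
    HasDerivAt (modeTrunc v k l T) (modeTruncDeriv D k l T r / r) r := by
  have hV := hv.continuous
  have hD := hv.continuous_deriv
  refine (hasDerivAt_intervalIntegral₂_of_continuous (F := fun r α t => (v (r • dir α, t) : ℂ) *
      (Complex.exp (-(Complex.I * k * α)) * Complex.exp (Complex.I * t * l)))
    (F' := fun r α t => (D (r • dir α, t) (dir α, 0) : ℂ) *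
      (Complex.exp (-(Complex.I * k * α)) * Complex.exp (Complex.I * t * l)))
    (by fun_prop) (by fun_prop) Real.two_pi_pos.le hT isOpen_univ ?_ (mem_univ r)).congr_deriv ?_
  · intro r _ α _ t ht
    exact (hv.hasDerivAt_radial α r ht.1).1.ofReal_comp.mul_const _
  · have hr' : (r : ℂ) ≠ 0 := by exact_mod_cast hr.ne'
    rw [modeTruncDeriv, eq_div_iff hr', ← intervalIntegral.integral_mul_const]
    refine intervalIntegral.integral_congr fun α _ => ?_
    rw [← intervalIntegral.integral_mul_const]
    refine intervalIntegral.integral_congr fun t _ => ?_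
    push_cast
    ring

/-- The integrand is the time derivative of `(v_t - i l v) e^{itl}`. At `t = 0` the velocity
vanishes, which leaves the source `i l f`. -/
theorem integral_time (hv : IsExtendedWave f v D D₂) (x : Plane) (l : ℂ) {T : ℝ} (hT : 0 ≤ T) :
    ∫ t in (0 : ℝ)..T, ((D₂ (x, t) (0, 1) (0, 1) : ℂ) + l ^ 2 * v (x, t)) * Complex.exp (Complex.I * t * l)
      = ((D (x, T) (0, 1) : ℝ) - Complex.I * l * (v (x, T) : ℝ)) * Complex.exp (Complex.I * T * l)
        + Complex.I * l * f x := by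
  have hV := hv.continuous
  have hD := hv.continuous_deriv
  have hD₂ := hv.continuous_deriv₂
  rw [intervalIntegral.integral_eq_sub_of_hasDerivAt_of_le (f := fun t : ℝ =>
    ((D (x, t) (0, 1) : ℝ) - Complex.I * l * (v (x, t) : ℝ)) * Complex.exp (Complex.I * t * l)) hT
    (by fun_prop) ?_ (Continuous.intervalIntegrable (by fun_prop) _ _)]
  · simp [hv.initial_velocity, hv.initial_value]
  · intro t ht
    have hc : HasDerivAt (fun t : ℝ => ((x, t) : Plane × ℝ)) (0, 1) t :=
      (hasDerivAt_const t x).prodMk (hasDerivAt_id t)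
    have h1 := hv.hasDerivAt_comp (s := t) ht.1 hc
    have h2 := hv.hasDerivAt_deriv_comp (s := t) ht.1 hc (hasDerivAt_const t ((0, 1) : Plane × ℝ))
    refine ((h2.ofReal_comp.sub (h1.ofReal_comp.const_mul (Complex.I * l))).mul
      (hasDerivAt_exp_time l t)).congr_deriv ?_
    have e0 : D (x, t) (0 : Plane × ℝ) = 0 := map_zero _
    simp only [e0, add_zero, Pi.sub_apply]
    linear_combination (-(l ^ 2 * v (x, t) * Complex.exp (Complex.I * t * l))) * Complex.I_sq

/-- Two integrations by parts in the angle, condensed into one periodic primitive: the angular part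
of the Laplacian acts on the mode as `-k²/r²`. -/
theorem integral_angle (hv : IsExtendedWave f v D D₂) (k : ℤ) {r t : ℝ} (hr : 0 < r) (ht : 0 < t) :
    ∫ α in (0 : ℝ)..(2 * Real.pi), (((r * D₂ (r • dir α, t) (dir (α + Real.pi / 2), 0)
        (dir (α + Real.pi / 2), 0) - D (r • dir α, t) (dir α, 0) : ℝ) : ℂ)
        + (k : ℂ) ^ 2 / r * v (r • dir α, t)) * Complex.exp (-(Complex.I * k * α)) = 0 := by
  have hV := hv.continuous
  have hD := hv.continuous_deriv
  have hD₂ := hv.continuous_deriv₂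
  have hr' : (r : ℂ) ≠ 0 := by exact_mod_cast hr.ne'
  rw [intervalIntegral.integral_eq_sub_of_hasDerivAt (f := fun α : ℝ =>
    ((D (r • dir α, t) (dir (α + Real.pi / 2), 0) : ℝ) + Complex.I * k / r * (v (r • dir α, t) : ℝ))
      * Complex.exp (-(Complex.I * k * α))) ?_ (Continuous.intervalIntegrable (by fun_prop) _ _)]
  · have e2 : dir (2 * Real.pi + Real.pi / 2) = dir (0 + Real.pi / 2) := by
      rw [← dir_add_two_pi (0 + Real.pi / 2)]; congr 1; ring
    rw [e2, dir_two_pi, exp_neg_int_mul_two_pi]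
    simp
  · intro α _
    have hc : HasDerivAt (fun α => ((r • dir α, t) : Plane × ℝ))
        (r • ((dir (α + Real.pi / 2), 0) : Plane × ℝ)) α := by
      simpa using ((hasDerivAt_dir α).const_smul r).prodMk (hasDerivAt_const α t)
    have hw : HasDerivAt (fun α => ((dir (α + Real.pi / 2), 0) : Plane × ℝ)) (-(dir α, 0)) α := by
      simpa using (hasDerivAt_dir_add α).prodMk (hasDerivAt_const α (0 : ℝ))
    have h1 := hv.hasDerivAt_comp (s := α) ht hc
    have h2 := hv.hasDerivAt_deriv_comp (s := α) ht hc hw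
    refine ((h2.ofReal_comp.add (h1.ofReal_comp.const_mul (Complex.I * k / r))).mul
      (hasDerivAt_exp_neg_int k α)).congr_deriv ?_
    simp only [map_smul, map_neg, smul_apply, smul_eq_mul, Pi.add_apply]
    push_cast
    field_simp
    linear_combination (-((k : ℂ) ^ 2 * v (r • dir α, t))) * Complex.I_sq

/-- The radial equation for the transformed mode, Bessel's equation with a source. The wave equation
replaces the second radial derivative by the time and the tangential ones, which `integral_time` and
`integral_angle` then evaluate. -/
theorem hasDerivAt_modeTruncDeriv (hv : IsExtendedWave f v D D₂) (hfc : Continuous f) (k : ℤ) (l : ℂ)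
    {T : ℝ} (hT : 0 ≤ T) {r : ℝ} (hr : 0 < r) :
    HasDerivAt (modeTruncDeriv D k l T) (((k : ℂ) ^ 2 / r - l ^ 2 * r) * modeTrunc v k l T r
      + r * (modeBdry v D k l T r + Complex.I * l * angMode k (fun x => (f x : ℂ)) r)) r := by
  have hV := hv.continuous
  have hD := hv.continuous_deriv
  have hD₂ := hv.continuous_deriv₂
  have hr' : (r : ℂ) ≠ 0 := by exact_mod_cast hr.ne'
  set E : ℝ → ℝ → ℂ := fun α t => Complex.exp (-(Complex.I * k * α)) * Complex.exp (Complex.I * t * l)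
    with hE
  have hEc : Continuous (Function.uncurry E) := by
    simp only [hE]; fun_prop
  refine (hasDerivAt_intervalIntegral₂_of_continuous
    (F := fun r α t => ((r * D (r • dir α, t) (dir α, 0) : ℝ) : ℂ) * E α t)
    (F' := fun r α t => ((r * D₂ (r • dir α, t) (0, 1) (0, 1) - (r * D₂ (r • dir α, t)
        (dir (α + Real.pi / 2), 0) (dir (α + Real.pi / 2), 0) - D (r • dir α, t) (dir α, 0)) : ℝ) : ℂ)
        * E α t)
    (by fun_prop) (by fun_prop) Real.two_pi_pos.le hT isOpen_univ ?_ (mem_univ r)).congr_deriv ?_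
  · intro r _ α _ t ht
    have h := ((hasDerivAt_id r).mul (hv.hasDerivAt_radial α r ht.1).2).ofReal_comp.mul_const (E α t)
    refine h.congr_deriv ?_
    rw [hv.wave_eq_dir ht.1 α]
    simp only [id, one_mul]
    congr 2
    ring
  · have hA : ∫ α in (0 : ℝ)..(2 * Real.pi), ∫ t in (0 : ℝ)..T,
        (r : ℂ) * ((D₂ (r • dir α, t) (0, 1) (0, 1) : ℂ) + l ^ 2 * v (r • dir α, t)) * E α t
        = r * (modeBdry v D k l T r + Complex.I * l * angMode k (fun x => (f x : ℂ)) r) := by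
      have h1 : ∀ α : ℝ, ∫ t in (0 : ℝ)..T,
          (r : ℂ) * ((D₂ (r • dir α, t) (0, 1) (0, 1) : ℂ) + l ^ 2 * v (r • dir α, t)) * E α t
          = r * (((D (r • dir α, T) (0, 1) : ℝ) - Complex.I * l * (v (r • dir α, T) : ℝ))
            * Complex.exp (Complex.I * T * l) * Complex.exp (-(Complex.I * k * α))
            + Complex.I * l * (f (r • dir α) * Complex.exp (-(Complex.I * k * α)))) := by
        intro α
        have h2 := hv.integral_time (r • dir α) l hT
        have h3 : ∀ t : ℝ, (r : ℂ) * ((D₂ (r • dir α, t) (0, 1) (0, 1) : ℂ) + l ^ 2 * v (r • dir α, t)) * E α t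
            = r * Complex.exp (-(Complex.I * k * α)) * (((D₂ (r • dir α, t) (0, 1) (0, 1) : ℂ)
              + l ^ 2 * v (r • dir α, t)) * Complex.exp (Complex.I * t * l)) := by
          intro t; simp only [hE]; ring
        simp only [h3]
        rw [intervalIntegral.integral_const_mul, h2]
        ring
      simp only [h1]
      rw [intervalIntegral.integral_const_mul, intervalIntegral.integral_add
        (Continuous.intervalIntegrable (by fun_prop) _ _)
        (Continuous.intervalIntegrable (by fun_prop) _ _), intervalIntegral.integral_const_mul]
      rfl
    have hB : ∫ α in (0 : ℝ)..(2 * Real.pi), ∫ t in (0 : ℝ)..T,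
        (((r * D₂ (r • dir α, t) (dir (α + Real.pi / 2), 0)
        (dir (α + Real.pi / 2), 0) - D (r • dir α, t) (dir α, 0) : ℝ) : ℂ)
        + (k : ℂ) ^ 2 / r * v (r • dir α, t)) * E α t = 0 := by
      rw [intervalIntegral_swap_of_continuous (by fun_prop)]
      refine intervalIntegral.integral_zero_ae (Eventually.of_forall fun t ht => ?_)
      rw [uIoc_of_le hT] at ht
      have h1 := hv.integral_angle k hr ht.1
      simp only [hE, ← mul_assoc]
      rw [intervalIntegral.integral_mul_const, h1, zero_mul]
    have hsplit : ∀ α t : ℝ, ((r * D₂ (r • dir α, t) (0, 1) (0, 1) - (r * D₂ (r • dir α, t)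
        (dir (α + Real.pi / 2), 0) (dir (α + Real.pi / 2), 0) - D (r • dir α, t) (dir α, 0)) : ℝ) : ℂ)
        * E α t = ((r : ℂ) * ((D₂ (r • dir α, t) (0, 1) (0, 1) : ℂ) + l ^ 2 * v (r • dir α, t)) * E α t
        - (((r * D₂ (r • dir α, t) (dir (α + Real.pi / 2), 0)
        (dir (α + Real.pi / 2), 0) - D (r • dir α, t) (dir α, 0) : ℝ) : ℂ)
        + (k : ℂ) ^ 2 / r * v (r • dir α, t)) * E α t)
        + ((k : ℂ) ^ 2 / r - l ^ 2 * r) * (v (r • dir α, t) * E α t) := by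
      intro α t
      push_cast
      ring
    have hint : ∀ {g : ℝ → ℝ → ℂ}, Continuous (Function.uncurry g) → ∀ α,
        IntervalIntegrable (fun t => g α t) volume 0 T := fun {g} hg α =>
      (hg.comp (by fun_prop : Continuous fun t : ℝ => (α, t))).intervalIntegrable _ _
    simp only [hsplit]
    have hg1 : Continuous (Function.uncurry fun α t : ℝ => (r : ℂ) * ((D₂ (r • dir α, t) (0, 1) (0, 1) : ℂ) + l ^ 2 * v (r • dir α, t)) * E α t) := by fun_prop
    have hg2 : Continuous (Function.uncurry fun α t : ℝ => (((r * D₂ (r • dir α, t) (dir (α + Real.pi / 2), 0)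
        (dir (α + Real.pi / 2), 0) - D (r • dir α, t) (dir α, 0) : ℝ) : ℂ)
        + (k : ℂ) ^ 2 / r * v (r • dir α, t)) * E α t) := by fun_prop
    have hg3 : Continuous (Function.uncurry fun α t : ℝ => ((k : ℂ) ^ 2 / r - l ^ 2 * r) * (v (r • dir α, t) * E α t)) := by fun_prop
    have hg4 : Continuous (Function.uncurry fun α t : ℝ => v (r • dir α, t) * E α t) := by fun_prop
    have hin : ∀ α : ℝ, _ := fun α => (intervalIntegral.integral_add ((hint hg1 α).sub (hint hg2 α)) (hint hg3 α)).trans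
      (congrArg₂ (· + ·) (intervalIntegral.integral_sub (hint hg1 α) (hint hg2 α))
        (intervalIntegral.integral_const_mul _ _))
    simp only [hin]
    have hc1 := (continuous_intervalIntegral hg1 0 T).intervalIntegrable (μ := volume) 0 (2 * Real.pi)
    have hc2 := (continuous_intervalIntegral hg2 0 T).intervalIntegrable (μ := volume) 0 (2 * Real.pi)
    have hc3 := ((continuous_intervalIntegral hg4 0 T).const_mul ((k : ℂ) ^ 2 / r - l ^ 2 * r)).intervalIntegrable (μ := volume) 0 (2 * Real.pi)
    rw [intervalIntegral.integral_add (hc1.sub hc2) hc3, intervalIntegral.integral_sub hc1 hc2, hA, hB,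
      intervalIntegral.integral_const_mul]
    rw [modeTrunc]
    ring

end IsExtendedWave


/-! ### Green's identity and the limit of large time -/

theorem IsCylinder.radial_hasDerivAt {C : ℤ → ℂ → ℂ} (hC : IsCylinder C) (n : ℤ) {l : ℂ}
    (hl : 0 < l.re) {r : ℝ} (hr : 0 < r) :
    HasDerivAt (fun r : ℝ => C n (l * r)) (eulerDeriv C n (l * r) / r) r ∧
    HasDerivAt (fun r : ℝ => eulerDeriv C n (l * r))
      (((n : ℂ) ^ 2 / r - l ^ 2 * r) * C n (l * r)) r := by
  have hz : 0 < (l * r).re := by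
    rw [Complex.re_mul_ofReal]; positivity
  have hl0 : l ≠ 0 := by rintro rfl; simp at hl
  have hr0 : (r : ℂ) ≠ 0 := by exact_mod_cast hr.ne'
  have hm : HasDerivAt (fun z : ℂ => l * z) l (r : ℂ) := by
    simpa using (hasDerivAt_id (r : ℂ)).const_mul l
  constructor
  · refine (((hC.hasDerivAt_eulerDeriv n hz).comp (r : ℂ) hm).comp_ofReal).congr_deriv ?_
    field_simp
  · refine (((hC.eulerDeriv_hasDerivAt n hz).comp (r : ℂ) hm).comp_ofReal).congr_deriv ?_
    field_simp

theorem norm_exp_neg_int (k : ℤ) (α : ℝ) : ‖Complex.exp (-(Complex.I * k * α))‖ = 1 := by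
  rw [show -(Complex.I * k * α) = ((-(k * α) : ℝ) : ℂ) * Complex.I by push_cast; ring,
    Complex.norm_exp_ofReal_mul_I]

theorem norm_exp_time (t : ℝ) (l : ℂ) : ‖Complex.exp (Complex.I * t * l)‖ = Real.exp (-(t * l.im)) := by
  rw [Complex.norm_exp]
  congr 1
  simp [Complex.mul_re]

theorem norm_angMode_le {k : ℤ} {g : Plane → ℂ} {r B : ℝ} (hg : ∀ α, ‖g (r • dir α)‖ ≤ B) :
    ‖angMode k g r‖ ≤ 2 * Real.pi * B := by
  have h := intervalIntegral.norm_integral_le_of_norm_le_const (a := 0) (b := 2 * Real.pi)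
    (f := fun α => g (r • dir α) * Complex.exp (-(Complex.I * k * α))) (C := B) fun α _ => by
      rw [norm_mul, norm_exp_neg_int, mul_one]
      exact hg α
  rw [sub_zero, abs_of_pos Real.two_pi_pos] at h
  rw [angMode, mul_comm (2 * Real.pi)]
  exact h

namespace IsExtendedWave

variable {f : Plane → ℝ} {v : Plane × ℝ → ℝ} {D : Plane × ℝ → Plane × ℝ →L[ℝ] ℝ}
  {D₂ : Plane × ℝ → Plane × ℝ →L[ℝ] Plane × ℝ →L[ℝ] ℝ} {R : ℝ}

/-- Green's identity between the solution and a cylinder function. -/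
theorem green_identity (hv : IsExtendedWave f v D D₂) (hfc : Continuous f) (k : ℤ) {l : ℂ}
    (hl : 0 < l.re) {C : ℤ → ℂ → ℂ} (hC : IsCylinder C) {n : ℤ} (hn : (n : ℂ) ^ 2 = (k : ℂ) ^ 2)
    {T : ℝ} (hT : 0 ≤ T) {a b : ℝ} (ha : 0 ≤ a) (hab : a ≤ b)
    (hH : ContinuousOn (fun r : ℝ => C n (l * r)) (Icc a b))
    (hZ : ContinuousOn (fun r : ℝ => eulerDeriv C n (l * r)) (Icc a b)) :
    ∫ r in a..b, r * (modeBdry v D k l T r + Complex.I * l * angMode k (fun x => (f x : ℂ)) r)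
        * C n (l * r)
      = (modeTrunc v k l T a * eulerDeriv C n (l * a) - modeTruncDeriv D k l T a * C n (l * a))
        - (modeTrunc v k l T b * eulerDeriv C n (l * b) - modeTruncDeriv D k l T b * C n (l * b)) := by
  have hw := hv.continuous_modeTrunc k l T
  have hz := hv.continuous_modeTruncDeriv k l T
  have hb := hv.continuous_modeBdry k l T
  have hfk := continuous_angMode k (g := fun x => (f x : ℂ)) (by fun_prop)
  have h := intervalIntegral.integral_eq_sub_of_hasDerivAt_of_le hab
    (f := fun r : ℝ => modeTrunc v k l T r * eulerDeriv C n (l * r)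
      - modeTruncDeriv D k l T r * C n (l * r))
    (f' := fun r : ℝ => -(r * (modeBdry v D k l T r
      + Complex.I * l * angMode k (fun x => (f x : ℂ)) r) * C n (l * r)))
    ((hw.continuousOn.mul hZ).sub (hz.continuousOn.mul hH)) ?_ ?_
  · rw [intervalIntegral.integral_neg] at h
    linear_combination -h
  · intro r hr
    have hr0 : 0 < r := ha.trans_lt hr.1
    have hr' : (r : ℂ) ≠ 0 := by exact_mod_cast hr0.ne'
    obtain ⟨h1, h2⟩ := hC.radial_hasDerivAt n hl hr0
    refine (((hv.hasDerivAt_modeTrunc k l hT hr0).mul h2).sub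
      ((hv.hasDerivAt_modeTruncDeriv hfc k l hT hr0).mul h1)).congr_deriv ?_
    rw [hn]
    ring
  · refine ContinuousOn.intervalIntegrable ?_
    rw [uIcc_of_le hab]
    exact (ContinuousOn.mul (by fun_prop) hH).neg

theorem modeTrunc_eq_zero (hv : IsExtendedWave f v D D₂) (hf : ∀ x : Plane, R < ‖x‖ → f x = 0)
    (k : ℤ) (l : ℂ) {T r : ℝ} (hr0 : 0 ≤ r) (hT : 0 ≤ T) (hr : R + T < r) :
    modeTrunc v k l T r = 0 ∧ modeTruncDeriv D k l T r = 0 := by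
  have h : ∀ α t, t ≤ T → R + t < ‖r • dir α‖ := fun α t ht => by
    rw [norm_smul_dir hr0]; linarith
  constructor
  · refine intervalIntegral.integral_zero_ae (Eventually.of_forall fun α _ => ?_)
    refine intervalIntegral.integral_zero_ae (Eventually.of_forall fun t ht => ?_)
    rw [uIoc_of_le hT] at ht
    rw [hv.eq_zero_of_lt hf ht.1.le (h α t ht.2)]
    simp
  · refine intervalIntegral.integral_zero_ae (Eventually.of_forall fun α _ => ?_)
    refine intervalIntegral.integral_zero_ae (Eventually.of_forall fun t ht => ?_)
    rw [uIoc_of_le hT] at ht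
    rw [hv.deriv_eq_zero_of_lt hf ht.1 (h α t ht.2)]
    simp

theorem _root_.TAT.angMode_eq_zero (hf : ∀ x : Plane, R < ‖x‖ → f x = 0) (k : ℤ) {r : ℝ}
    (hr0 : 0 ≤ r) (hr : R < r) : angMode k (fun x => (f x : ℂ)) r = 0 := by
  refine intervalIntegral.integral_zero_ae (Eventually.of_forall fun α _ => ?_)
  simp [hf (r • dir α) (by rwa [norm_smul_dir hr0])]

/-- Multiplying the outer identity by `J(lR)`, the inner one by `H(lR)` and adding cancels the
unknown radial derivative at `R`; the coefficient left at the mode itself is the Wronskian. -/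
theorem modeTrunc_mul_wronskian (hv : IsExtendedWave f v D D₂) (hfc : Continuous f) (hR : 0 < R)
    (hf : ∀ x : Plane, R < ‖x‖ → f x = 0) (k : ℤ) {l : ℂ} (hl : 0 < l.re) {T : ℝ} (hT : 0 ≤ T) :
    modeTrunc v k l T R * (2 * Complex.I / Real.pi)
      - hankelC k.natAbs (l * R) * (Complex.I * l * ∫ r in (0 : ℝ)..R,
        r * angMode k (fun x => (f x : ℂ)) r * besselJC k.natAbs (l * r))
      = besselJC k.natAbs (l * R) * (∫ r in R..(R + T + 1), r * modeBdry v D k l T r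
          * hankelC k.natAbs (l * r))
        + hankelC k.natAbs (l * R) * ∫ r in (0 : ℝ)..R, r * modeBdry v D k l T r
          * besselJC k.natAbs (l * r) := by
  -- Only `k²` enters the radial equation, so the mode `k` can be tested against functions of order
  -- `|k|`.
  set n : ℤ := (k.natAbs : ℤ) with hn
  have hnk : (n : ℂ) ^ 2 = (k : ℂ) ^ 2 := by
    have : n ^ 2 = k ^ 2 := by rw [hn]; exact Int.natAbs_sq k
    exact_mod_cast this
  have hre : ∀ r : ℝ, 0 < r → 0 < (l * r).re := fun r hr => by
    rw [Complex.re_mul_ofReal]; positivity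
  have hJ := continuous_besselJC
  have hcH : ContinuousOn (fun r : ℝ => hankelC n (l * r)) (Icc R (R + T + 1)) := fun r hr =>
    (isCylinder_hankelC.radial_hasDerivAt n hl (hR.trans_le hr.1)).1.continuousAt.continuousWithinAt
  have hcZ : ContinuousOn (fun r : ℝ => eulerDeriv hankelC n (l * r)) (Icc R (R + T + 1)) := fun r hr =>
    (isCylinder_hankelC.radial_hasDerivAt n hl (hR.trans_le hr.1)).2.continuousAt.continuousWithinAt
  have hE := hv.green_identity hfc k hl isCylinder_hankelC hnk hT hR.le
    (by linarith : R ≤ R + T + 1) hcH hcZ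
  have hI := hv.green_identity hfc k hl isCylinder_besselJC hnk hT le_rfl hR.le
    (by have := hJ n; fun_prop) (by have := hJ n; have := hJ (n - 1); simp only [eulerDeriv]; fun_prop)
  -- The extra `1` puts the outer radius strictly beyond the reach `R + T` of the wave, so no
  -- radiation condition is needed.
  obtain ⟨h1, h2⟩ := hv.modeTrunc_eq_zero hf k l (r := R + T + 1) (by linarith) hT (by linarith)
  have hz0 : modeTruncDeriv D k l T 0 = 0 := by simp [modeTruncDeriv]
  have he0 : eulerDeriv besselJC n (l * (0 : ℝ)) = 0 := by
    have h := besselJC_recurrence n 0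
    rw [Complex.ofReal_zero, mul_zero, eulerDeriv]
    linear_combination (1 / 2 : ℂ) * h
  rw [h1, h2] at hE
  rw [hz0, he0] at hI
  have hW := wronskian_eq n (hre R hR)
  rw [wronskian] at hW
  have hb := hv.continuous_modeBdry k l T
  have hfk := continuous_angMode k (g := fun x => (f x : ℂ)) (by fun_prop)
  have hE' : ∫ r in R..(R + T + 1), r * (modeBdry v D k l T r
      + Complex.I * l * angMode k (fun x => (f x : ℂ)) r) * hankelC n (l * r)
      = ∫ r in R..(R + T + 1), r * modeBdry v D k l T r * hankelC n (l * r) := by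
    refine intervalIntegral.integral_congr_ae (Eventually.of_forall fun r hr => ?_)
    rw [uIoc_of_le (by linarith)] at hr
    rw [angMode_eq_zero hf k (hR.le.trans hr.1.le) hr.1, mul_zero, add_zero]
  have hI' : ∫ r in (0 : ℝ)..R, r * (modeBdry v D k l T r
      + Complex.I * l * angMode k (fun x => (f x : ℂ)) r) * besselJC n (l * r)
      = (∫ r in (0 : ℝ)..R, r * modeBdry v D k l T r * besselJC n (l * r))
        + Complex.I * l * ∫ r in (0 : ℝ)..R,
          r * angMode k (fun x => (f x : ℂ)) r * besselJC n (l * r) := by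
    have := hJ n
    rw [← intervalIntegral.integral_const_mul, ← intervalIntegral.integral_add
      (Continuous.intervalIntegrable (by fun_prop) _ _)
      (Continuous.intervalIntegrable (by fun_prop) _ _)]
    refine intervalIntegral.integral_congr fun r _ => ?_
    ring
  rw [hE'] at hE
  rw [hI'] at hI
  rw [← hW]
  linear_combination (-besselJC n (l * R)) * hE - hankelC n (l * R) * hI

theorem exists_norm_modeBdry_le (hv : IsExtendedWave f v D D₂) (hc : ContDiff ℝ 2 f)
    (hf : ∀ x : Plane, R < ‖x‖ → f x = 0) (k : ℤ) (l : ℂ) :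
    ∃ K, 0 ≤ K ∧ ∀ T r, 0 < T → ‖modeBdry v D k l T r‖ ≤ K * (1 + T) * Real.exp (-(T * l.im)) := by
  obtain ⟨C, hC, hb⟩ := hv.exists_growth hc hf
  refine ⟨2 * Real.pi * (C + ‖l‖ * C), by have := Real.pi_pos; positivity, fun T r hT => ?_⟩
  refine (norm_angMode_le (B := (C * (1 + T) + ‖l‖ * (C * (1 + T))) * Real.exp (-(T * l.im)))
    fun α => ?_).trans (le_of_eq (by ring))
  obtain ⟨h1, h2⟩ := hb (r • dir α) T hT
  rw [norm_mul, norm_exp_time]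
  gcongr
  refine (norm_sub_le _ _).trans (add_le_add ?_ ?_)
  · rwa [Complex.norm_real]
  · rw [norm_mul, norm_mul, Complex.norm_I, one_mul, Complex.norm_real]
    gcongr
    exact h1

theorem tendsto_modeTrunc (hv : IsExtendedWave f v D D₂) (hc : ContDiff ℝ 2 f) (hR : 0 < R)
    (hf : ∀ x : Plane, R < ‖x‖ → f x = 0) (k : ℤ) {l : ℂ} (hl : 0 < l.re) (hl' : 0 < l.im) :
    Tendsto (fun T => modeTrunc v k l T R) atTop (𝓝 (Real.pi * l / 2 * hankelC k.natAbs (l * R) *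
      ∫ r in (0 : ℝ)..R, r * angMode k (fun x => (f x : ℂ)) r * besselJC k.natAbs (l * r))) := by
  have hpi : (Real.pi : ℂ) ≠ 0 := by exact_mod_cast Real.pi_ne_zero
  set n : ℤ := (k.natAbs : ℤ) with hn
  set A := ∫ r in (0 : ℝ)..R, r * angMode k (fun x => (f x : ℂ)) r * besselJC n (l * r) with hA
  obtain ⟨K, hK, hKb⟩ := hv.exists_norm_modeBdry_le hc hf k l
  obtain ⟨M, hM⟩ := exists_norm_hankelC_le n (δ := l.re * R) (by positivity)
  have hJ := continuous_besselJC n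
  obtain ⟨N, hN⟩ := (isCompact_Icc (a := 0) (b := R)).exists_bound_of_continuousOn
    (f := fun r : ℝ => besselJC n (l * r)) (by fun_prop)
  have hM0 : 0 ≤ M := (norm_nonneg _).trans (hM (l * R) (by simp) (by simp; positivity))
  have hN0 : 0 ≤ N := (norm_nonneg _).trans (hN 0 ⟨le_rfl, hR.le⟩)
  -- For `T ≥ 1`, the outer integral has `r ≤ (2 + R) T`, boundary term at most `2KT e^{-T im l}`,
  -- Hankel factor at most `M` and length at most `2T`, hence `T³ e^{-T im l}`. The inner one needs
  -- only the first power of `T`, enlarged to `T³`.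
  set B := ‖besselJC n (l * R)‖ * ((2 + R) * 2 * K * M * 2) + ‖hankelC n (l * R)‖ * (R * 2 * K * N * R) with hB
  have hlim : Tendsto (fun T : ℝ => B * (T ^ 3 / Real.exp (l.im * T))) atTop (𝓝 0) := by
    simpa using (isLittleO_pow_exp_pos_mul_atTop 3 hl').tendsto_div_nhds_zero.const_mul B
  have hdiff : Tendsto (fun T => modeTrunc v k l T R * (2 * Complex.I / Real.pi)
      - hankelC n (l * R) * (Complex.I * l * A)) atTop (𝓝 0) := by
    refine squeeze_zero_norm' ?_ hlim
    filter_upwards [eventually_ge_atTop 1] with T hT1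
    have hT : 0 < T := by linarith
    have hbd : ∀ r, ‖modeBdry v D k l T r‖ ≤ 2 * K * T * Real.exp (-(T * l.im)) := fun r => by
      refine (hKb T r hT).trans (mul_le_mul_of_nonneg_right ?_ (Real.exp_pos _).le)
      nlinarith
    have hexp : T ^ 3 / Real.exp (l.im * T) = T ^ 3 * Real.exp (-(T * l.im)) := by
      rw [Real.exp_neg, div_eq_mul_inv, mul_comm l.im]
    rw [hv.modeTrunc_mul_wronskian hc.continuous hR hf k hl hT.le, hexp, hB, add_mul]
    refine (norm_add_le _ _).trans (add_le_add ?_ ?_)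
    · rw [norm_mul, mul_assoc]
      refine mul_le_mul_of_nonneg_left ?_ (norm_nonneg _)
      have h := intervalIntegral.norm_integral_le_of_norm_le_const (a := R) (b := R + T + 1)
        (f := fun r : ℝ => r * modeBdry v D k l T r * hankelC n (l * r))
        (C := ((2 + R) * T) * (2 * K * T * Real.exp (-(T * l.im))) * M) fun r hr => by
          rw [uIoc_of_le (by linarith)] at hr
          have hr0 : 0 < r := hR.trans hr.1
          rw [norm_mul, norm_mul, Complex.norm_real, Real.norm_of_nonneg hr0.le]
          have e1 : r ≤ (2 + R) * T := by nlinarith [hr.2]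
          have e2 : ‖hankelC n (l * r)‖ ≤ M := by
            refine hM _ ?_ ?_
            · rw [Complex.re_mul_ofReal]; gcongr; exact hr.1.le
            · rw [Complex.im_mul_ofReal]; positivity
          have e3 := hbd r
          gcongr
      refine h.trans ?_
      rw [show R + T + 1 - R = T + 1 by ring, abs_of_pos (by linarith)]
      have e4 : T + 1 ≤ 2 * T := by linarith
      calc _ ≤ ((2 + R) * T) * (2 * K * T * Real.exp (-(T * l.im))) * M * (2 * T) := by gcongr
        _ = _ := by ring
    · rw [norm_mul, mul_assoc]
      refine mul_le_mul_of_nonneg_left ?_ (norm_nonneg _)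
      have h := intervalIntegral.norm_integral_le_of_norm_le_const (a := 0) (b := R)
        (f := fun r : ℝ => r * modeBdry v D k l T r * besselJC n (l * r))
        (C := R * (2 * K * T * Real.exp (-(T * l.im))) * N) fun r hr => by
          rw [uIoc_of_le hR.le] at hr
          rw [norm_mul, norm_mul, Complex.norm_real, Real.norm_of_nonneg hr.1.le]
          have e2 := hN r ⟨hr.1.le, hr.2⟩
          have e3 := hbd r
          have e1 := hr.2
          gcongr
      refine h.trans ?_
      rw [sub_zero, abs_of_pos hR]
      have e4 : T ≤ T ^ 3 := le_self_pow₀ hT1 (by norm_num)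
      calc _ = R * 2 * K * N * R * (T * Real.exp (-(T * l.im))) := by ring
        _ ≤ R * 2 * K * N * R * (T ^ 3 * Real.exp (-(T * l.im))) := by gcongr
  have h := (hdiff.add_const (hankelC n (l * R) * (Complex.I * l * A))).const_mul (Real.pi / (2 * Complex.I))
  refine (h.congr fun T => ?_).trans_eq ?_
  · field_simp
    ring
  · congr 1
    field_simp
    ring

end IsExtendedWave


/-! ### The data on the circle and the angular modes of the initial value -/

namespace IsExtendedWave

variable {f : Plane → ℝ} {v : Plane × ℝ → ℝ} {D : Plane × ℝ → Plane × ℝ →L[ℝ] ℝ}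
  {D₂ : Plane × ℝ → Plane × ℝ →L[ℝ] Plane × ℝ →L[ℝ] ℝ} {R : ℝ}

theorem exists_abs_le_on_circle (hv : IsExtendedWave f v D D₂) (hc : ContDiff ℝ 2 f) (hR : 0 < R)
    (hf : ∀ x : Plane, R < ‖x‖ → f x = 0) :
    ∃ C, 0 ≤ C ∧ ∀ φ t, 0 < t → |v (R • dir φ, t)| ≤ C * (1 + t ^ 2)⁻¹ := by
  obtain ⟨C₁, h₁⟩ := hv.exists_decay hc hR hf
  obtain ⟨C₂, hC₂, h₂⟩ := hv.exists_growth hc hf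
  refine ⟨2 * |C₁| + 4 * C₂, by positivity, fun φ t ht => ?_⟩
  rw [← div_eq_mul_inv, le_div_iff₀ (by positivity)]
  -- The `t⁻²` bound blows up at `t = 0`; for `t ≤ 1` the growth estimate takes over.
  rcases le_total 1 t with h | h
  · have h3 := h₁ (R • dir φ) t ht (norm_smul_dir hR.le φ).le
    rw [le_div_iff₀ (by positivity)] at h3
    have h4 : 1 + t ^ 2 ≤ 2 * t ^ 2 := by nlinarith
    calc _ ≤ |v (R • dir φ, t)| * (2 * t ^ 2) := by gcongr
      _ = 2 * (|v (R • dir φ, t)| * t ^ 2) := by ring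
      _ ≤ 2 * |C₁| := by linarith [le_abs_self C₁]
      _ ≤ _ := by linarith
  · have h3 := (h₂ (R • dir φ) t ht).1
    calc _ ≤ (C₂ * (1 + 1)) * (1 + 1 ^ 2) := by
            refine mul_le_mul (h3.trans (by gcongr)) (by gcongr) (by positivity) (by positivity)
      _ ≤ _ := by linarith [abs_nonneg C₁]

theorem modeTrunc_eq (hv : IsExtendedWave f v D D₂) (k : ℤ) (l : ℂ) (T r : ℝ) :
    modeTrunc v k l T r = ∫ t in (0 : ℝ)..T,
      angMode k (fun x => (v (x, t) : ℂ)) r * Complex.exp (Complex.I * t * l) := by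
  have hvc := hv.continuous
  have hd := continuous_dir
  rw [modeTrunc, intervalIntegral_swap_of_continuous (by fun_prop)]
  refine intervalIntegral.integral_congr fun t _ => ?_
  rw [angMode, ← intervalIntegral.integral_mul_const]
  refine intervalIntegral.integral_congr fun α _ => ?_
  ring

theorem continuous_angMode_time (hv : IsExtendedWave f v D D₂) (k : ℤ) (r : ℝ) :
    Continuous fun t : ℝ => angMode k (fun x => (v (x, t) : ℂ)) r := by
  have hvc := hv.continuous
  have hd := continuous_dir
  exact continuous_intervalIntegral (f := fun (t : ℝ) (α : ℝ) =>
    (v (r • dir α, t) : ℂ) * Complex.exp (-(Complex.I * k * α))) (by fun_prop) _ _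

/-- For `im m > 0` the identity is the limit `T → ∞`. It extends to the real axis because the
integrable majorant `(1 + t²)⁻¹` does not depend on `im m ≥ 0` and the right-hand side is continuous
there. -/
theorem integral_angMode_mul_exp (hv : IsExtendedWave f v D D₂) (hc : ContDiff ℝ 2 f) (hR : 0 < R)
    (hf : ∀ x : Plane, R < ‖x‖ → f x = 0) (k : ℤ) {l : ℝ} (hl : 0 < l) :
    ∫ t in Ioi (0 : ℝ), angMode k (fun x => (v (x, t) : ℂ)) R * Complex.exp (Complex.I * t * l)
      = Real.pi * l / 2 * hankelC k.natAbs (l * R) *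
        ∫ r in (0 : ℝ)..R, r * angMode k (fun x => (f x : ℂ)) r * besselJC k.natAbs (l * r) := by
  obtain ⟨C, hC0, hC⟩ := hv.exists_abs_le_on_circle hc hR hf
  have hG := hv.continuous_angMode_time k R
  have hi : IntegrableOn (fun t : ℝ => 2 * Real.pi * (C * (1 + t ^ 2)⁻¹)) (Ioi 0) :=
    ((integrable_inv_one_add_sq.const_mul C).const_mul _).integrableOn
  have hbd : ∀ m : ℂ, 0 ≤ m.im → ∀ t ∈ Ioi (0 : ℝ),
      ‖angMode k (fun x => (v (x, t) : ℂ)) R * Complex.exp (Complex.I * t * m)‖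
        ≤ 2 * Real.pi * (C * (1 + t ^ 2)⁻¹) := fun m hm t ht => by
    rw [norm_mul, norm_exp_time]
    refine (mul_le_of_le_one_right (norm_nonneg _) ?_).trans
      (norm_angMode_le fun α => by rw [Complex.norm_real]; exact hC α t ht)
    exact Real.exp_le_one_iff.2 (neg_nonpos.2 (mul_nonneg (le_of_lt ht) hm))
  have key : ∀ m : ℂ, 0 < m.re → 0 < m.im →
      ∫ t in Ioi (0 : ℝ), angMode k (fun x => (v (x, t) : ℂ)) R * Complex.exp (Complex.I * t * m)
      = Real.pi * m / 2 * hankelC k.natAbs (m * R) *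
        ∫ r in (0 : ℝ)..R, r * angMode k (fun x => (f x : ℂ)) r * besselJC k.natAbs (m * r) := by
    intro m hm hm'
    refine tendsto_nhds_unique (intervalIntegral_tendsto_integral_Ioi 0 ?_ tendsto_id)
      ((hv.tendsto_modeTrunc hc hR hf k hm hm').congr fun T => hv.modeTrunc_eq k m T R)
    refine Integrable.mono' hi (Continuous.aestronglyMeasurable (by fun_prop)) ?_
    exact (ae_restrict_mem measurableSet_Ioi).mono (hbd m hm'.le)
  have hε : Tendsto (fun ε : ℝ => (l : ℂ) + ε * Complex.I) (𝓝[>] 0) (𝓝 (l : ℂ)) := by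
    have h : Continuous fun ε : ℝ => (l : ℂ) + ε * Complex.I := by fun_prop
    simpa using (h.tendsto 0).mono_left nhdsWithin_le_nhds
  have hL : Tendsto (fun ε : ℝ => ∫ t in Ioi (0 : ℝ), angMode k (fun x => (v (x, t) : ℂ)) R *
      Complex.exp (Complex.I * t * ((l : ℂ) + ε * Complex.I))) (𝓝[>] 0)
      (𝓝 (∫ t in Ioi (0 : ℝ), angMode k (fun x => (v (x, t) : ℂ)) R *
        Complex.exp (Complex.I * t * l))) := by
    refine tendsto_integral_filter_of_dominated_convergence _
      (Eventually.of_forall fun ε => Continuous.aestronglyMeasurable (by fun_prop)) ?_ hi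
      (Eventually.of_forall fun t => ?_)
    · filter_upwards [self_mem_nhdsWithin] with ε hε
      exact (ae_restrict_mem measurableSet_Ioi).mono
        (hbd _ (by simpa using le_of_lt hε))
    · have h : Continuous fun m : ℂ => angMode k (fun x => (v (x, t) : ℂ)) R *
        Complex.exp (Complex.I * t * m) := by fun_prop
      exact (h.tendsto (l : ℂ)).comp hε
  refine tendsto_nhds_unique hL ?_
  have hH : ContinuousAt (fun m : ℂ => hankelC k.natAbs (m * R)) (l : ℂ) := by
    have h1 := (isCylinder_hankelC.hasDerivAt k.natAbs (l * R)
      (by rw [Complex.re_mul_ofReal]; simpa using mul_pos hl hR)).continuousAt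
    exact ContinuousAt.comp (g := hankelC k.natAbs) (f := fun m : ℂ => m * R) h1 (by fun_prop)
  have hJ : Continuous fun m : ℂ => ∫ r in (0 : ℝ)..R,
      r * angMode k (fun x => (f x : ℂ)) r * besselJC k.natAbs (m * r) := by
    have hfk := continuous_angMode k (g := fun x => (f x : ℂ)) (by have := hc.continuous; fun_prop)
    have hj := continuous_besselJC k.natAbs
    exact continuous_intervalIntegral (f := fun (m : ℂ) (r : ℝ) =>
      r * angMode k (fun x => (f x : ℂ)) r * besselJC k.natAbs (m * r)) (by fun_prop) _ _
  have hRc : ContinuousAt (fun m : ℂ => Real.pi * m / 2 * hankelC k.natAbs (m * R) *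
      ∫ r in (0 : ℝ)..R, r * angMode k (fun x => (f x : ℂ)) r * besselJC k.natAbs (m * r)) (l : ℂ) :=
    (ContinuousAt.mul (by fun_prop) hH).mul hJ.continuousAt
  refine (hRc.tendsto.comp hε).congr' ?_
  filter_upwards [self_mem_nhdsWithin] with ε hε
  exact (key _ (by simpa using hl) (by simpa using hε)).symm

section Data

variable {u : Plane → ℝ → ℝ}

theorem detectorData_eq (hvu : ∀ x t, 0 ≤ t → v (x, t) = u x t) (φ : ℝ) :
    detectorData R u φ = (Ici 0).indicator fun t => v (R • dir φ, t) := by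
  ext t
  by_cases ht : 0 ≤ t
  · simp [detectorData, ht, hvu]
  · simp [detectorData, ht]

theorem integrable_detectorData (hv : IsExtendedWave f v D D₂) (hc : ContDiff ℝ 2 f) (hR : 0 < R)
    (hf : ∀ x : Plane, R < ‖x‖ → f x = 0) (hvu : ∀ x t, 0 ≤ t → v (x, t) = u x t) (φ : ℝ) :
    Integrable (detectorData R u φ) := by
  obtain ⟨C, hC0, hC⟩ := hv.exists_abs_le_on_circle hc hR hf
  have hvc := hv.continuous
  rw [detectorData_eq hvu, integrable_indicator_iff measurableSet_Ici, integrableOn_Ici_iff_integrableOn_Ioi]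
  refine Integrable.mono' (integrable_inv_one_add_sq.const_mul C).integrableOn
    (Continuous.aestronglyMeasurable (by fun_prop)) ?_
  exact (ae_restrict_mem measurableSet_Ioi).mono fun t ht => hC φ t ht

theorem dataHat_eq (hvu : ∀ x t, 0 ≤ t → v (x, t) = u x t) (φ l : ℝ) :
    dataHat R u φ l = ∫ t in Ioi (0 : ℝ), (v (R • dir φ, t) : ℂ) * Complex.exp (Complex.I * t * l) := by
  rw [← integral_Ici_eq_integral_Ioi, ← integral_indicator measurableSet_Ici, dataHat]
  congr 1 with t
  rw [detectorData_eq hvu]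
  by_cases ht : t ∈ Ici (0 : ℝ) <;> simp [ht]

theorem integrable_data_prod (hv : IsExtendedWave f v D D₂) (hc : ContDiff ℝ 2 f) (hR : 0 < R)
    (hf : ∀ x : Plane, R < ‖x‖ → f x = 0) (k : ℤ) (l : ℝ) :
    Integrable (Function.uncurry fun φ t : ℝ => (v (R • dir φ, t) : ℂ) * Complex.exp (Complex.I * t * l)
        * Complex.exp (-(Complex.I * k * φ)))
      ((volume.restrict (uIoc 0 (2 * Real.pi))).prod (volume.restrict (Ioi 0))) := by
  obtain ⟨C, hC0, hC⟩ := hv.exists_abs_le_on_circle hc hR hf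
  have hvc := hv.continuous
  have hd := continuous_dir
  have hi : Integrable (fun p : ℝ × ℝ => (1 : ℝ) * (C * (1 + p.2 ^ 2)⁻¹))
      ((volume.restrict (uIoc 0 (2 * Real.pi))).prod (volume.restrict (Ioi 0))) :=
    Integrable.mul_prod (f := fun _ : ℝ => (1 : ℝ)) (g := fun t : ℝ => C * (1 + t ^ 2)⁻¹)
      (integrableOn_const (by simp [uIoc]))
      (integrable_inv_one_add_sq.const_mul C).integrableOn
  refine hi.mono' (Continuous.aestronglyMeasurable (by fun_prop)) ?_
  rw [Measure.prod_restrict]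
  refine (ae_restrict_mem (measurableSet_uIoc.prod measurableSet_Ioi)).mono fun p hp => ?_
  rw [Function.uncurry, norm_mul, norm_mul, norm_exp_neg_int, norm_exp_time, Complex.ofReal_im, mul_zero, neg_zero,
    Real.exp_zero, mul_one, mul_one, one_mul, Complex.norm_real]
  exact hC p.1 p.2 hp.2

theorem intervalIntegrable_dataHat (hv : IsExtendedWave f v D D₂) (hc : ContDiff ℝ 2 f) (hR : 0 < R)
    (hf : ∀ x : Plane, R < ‖x‖ → f x = 0) (hvu : ∀ x t, 0 ≤ t → v (x, t) = u x t) (l : ℝ) :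
    IntervalIntegrable (fun φ => dataHat R u φ l) volume 0 (2 * Real.pi) := by
  rw [intervalIntegrable_iff]
  refine (hv.integrable_data_prod hc hR hf 0 l).integral_prod_left.congr (Eventually.of_forall fun φ => ?_)
  simp [dataHat_eq hvu]

/-- The angular coefficients of the data are those of the initial value, multiplied by a
Hankel function. -/
theorem dataCoeff_eq (hv : IsExtendedWave f v D D₂) (hc : ContDiff ℝ 2 f) (hR : 0 < R)
    (hf : ∀ x : Plane, R < ‖x‖ → f x = 0) (hvu : ∀ x t, 0 ≤ t → v (x, t) = u x t) (k : ℤ) {l : ℝ}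
    (hl : 0 < l) :
    dataCoeff R u k l = l / 4 * hankel1 k.natAbs (l * R) *
      ∫ r in (0 : ℝ)..R, r * angMode k (fun x => (f x : ℂ)) r * besselJC k.natAbs (l * r) := by
  have hpi : (Real.pi : ℂ) ≠ 0 := by exact_mod_cast Real.pi_ne_zero
  have h1 : ∫ φ in (0 : ℝ)..(2 * Real.pi), dataHat R u φ l * Complex.exp (-(Complex.I * k * φ))
      = ∫ t in Ioi (0 : ℝ), angMode k (fun x => (v (x, t) : ℂ)) R
        * Complex.exp (Complex.I * t * l) := by
    have h2 := intervalIntegral_integral_swap (hv.integrable_data_prod hc hR hf k l)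
    calc _ = ∫ φ in (0 : ℝ)..(2 * Real.pi), ∫ t in Ioi (0 : ℝ), (v (R • dir φ, t) : ℂ)
          * Complex.exp (Complex.I * t * l) * Complex.exp (-(Complex.I * k * φ)) := by
          refine intervalIntegral.integral_congr fun φ _ => ?_
          simp only [dataHat_eq hvu]
          exact (integral_mul_const _ _).symm
      _ = _ := by
          rw [h2]
          refine integral_congr_ae (Eventually.of_forall fun t => ?_)
          simp only [angMode]
          rw [← intervalIntegral.integral_mul_const]
          refine intervalIntegral.integral_congr fun α _ => ?_
          ring
  rw [dataCoeff, h1, hv.integral_angMode_mul_exp hc hR hf k hl,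
    ← hankelC_natCast_ofReal _ (mul_pos hl hR)]
  push_cast
  field_simp
  ring

end Data

end IsExtendedWave


/-! ### Fourier series on the circles of frequencies -/

/-- Passing to the circle, summable coefficients of a continuous function make its Fourier series
converge to it pointwise. -/
theorem hasSum_fourier_of_periodic {g : ℝ → ℂ} (hg : Continuous g)
    (hp : Function.Periodic g (2 * Real.pi))
    (hs : Summable fun k : ℤ => 1 / (2 * Real.pi : ℂ) *
      ∫ φ in (0 : ℝ)..(2 * Real.pi), g φ * Complex.exp (-(Complex.I * k * φ))) (φ : ℝ) :
    HasSum (fun k : ℤ => 1 / (2 * Real.pi : ℂ) *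
      (∫ ψ in (0 : ℝ)..(2 * Real.pi), g ψ * Complex.exp (-(Complex.I * k * ψ)))
        * Complex.exp (Complex.I * k * φ)) (g φ) := by
  have : Fact (0 < 2 * Real.pi) := ⟨Real.two_pi_pos⟩
  have hpi : (Real.pi : ℂ) ≠ 0 := by exact_mod_cast Real.pi_ne_zero
  let G : C(AddCircle (2 * Real.pi), ℂ) := ⟨hp.lift, continuous_coinduced_dom.2 hg⟩
  have hG : ∀ x : ℝ, G (x : AddCircle (2 * Real.pi)) = g x := fun x => rfl
  have hexp : ∀ (k : ℤ) (x : ℝ), fourier k (x : AddCircle (2 * Real.pi))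
      = Complex.exp (Complex.I * k * x) := fun k x => by
    rw [fourier_coe_apply]
    congr 1
    push_cast
    field_simp
  have hcoeff : ∀ k : ℤ, fourierCoeff G k = 1 / (2 * Real.pi : ℂ) *
      ∫ φ in (0 : ℝ)..(2 * Real.pi), g φ * Complex.exp (-(Complex.I * k * φ)) := fun k => by
    rw [fourierCoeff_eq_intervalIntegral _ _ 0, zero_add, Complex.real_smul]
    congr 1
    · push_cast; rfl
    · refine intervalIntegral.integral_congr fun x _ => ?_
      simp only [hG, hexp, smul_eq_mul]
      push_cast
      ring_nf
  have h := has_pointwise_sum_fourier_series_of_summable (f := G)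
    (hs.congr fun k => (hcoeff k).symm) (φ : AddCircle (2 * Real.pi))
  rw [hG] at h
  refine h.congr_fun fun k => ?_
  rw [hcoeff, hexp, smul_eq_mul]

theorem integral_plane_of_vanish {F : Plane → ℂ} (hF : Integrable F) {R : ℝ} (hR : 0 ≤ R)
    (h0 : ∀ x, R < ‖x‖ → F x = 0) :
    ∫ x, F x = ∫ r in (0 : ℝ)..R, r * ∫ φ in (0 : ℝ)..(2 * Real.pi), F (r • dir φ) := by
  rw [integral_plane_polar_iterated hF, intervalIntegral.integral_of_le hR]
  simp only [Complex.real_smul]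
  refine setIntegral_eq_of_subset_of_forall_sdiff_eq_zero measurableSet_Ioi
    (fun r hr => hr.1) fun r hr => ?_
  have hr0 : (0 : ℝ) < r := hr.1
  have hrR : R < r := by
    by_contra h
    exact hr.2 ⟨hr0, not_lt.1 h⟩
  rw [intervalIntegral.integral_zero_ae, mul_zero]
  exact Eventually.of_forall fun φ _ => h0 _ (by rwa [norm_smul_dir hr0.le])

variable {f : Plane → ℝ} {R : ℝ}

/-- The angular coefficients of the Fourier transform of a function supported in a disk. -/
theorem integral_fourier2_mul_exp (hc : Continuous f) (hR : 0 ≤ R)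
    (hf : ∀ x : Plane, R < ‖x‖ → f x = 0) (k : ℤ) (l : ℝ) :
    ∫ φ in (0 : ℝ)..(2 * Real.pi), fourier2 f (l • dir φ) * Complex.exp (-(Complex.I * k * φ))
      = (-Complex.I) ^ k.natAbs *
        ∫ r in (0 : ℝ)..R, r * angMode k (fun x => (f x : ℂ)) r * besselJC k.natAbs (l * r) := by
  have hpi : (Real.pi : ℂ) ≠ 0 := by exact_mod_cast Real.pi_ne_zero
  have hd := continuous_dir
  have h1 : ∀ φ : ℝ, fourier2 f (l • dir φ) = 1 / (2 * Real.pi) * ∫ r in (0 : ℝ)..R,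
      r * ∫ α in (0 : ℝ)..(2 * Real.pi), f (r • dir α)
        * Complex.exp (-(Complex.I * (((l * r : ℝ) : ℂ) * Real.cos (α - φ)))) := fun φ => by
    rw [fourier2, integral_plane_of_vanish _ hR fun x hx => by rw [hf x hx]; simp]
    · congr 1
      refine intervalIntegral.integral_congr fun r _ => ?_
      simp only [real_inner_smul_left, real_inner_smul_right, inner_dir]
      congr 1
      refine intervalIntegral.integral_congr fun α _ => ?_
      push_cast
      ring_nf
    · refine Continuous.integrable_of_hasCompactSupport (by fun_prop) ?_
      exact (hasCompactSupport_ofReal_comp (hasCompactSupport_of_vanish hf)).mul_right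
  have h2 : ∀ φ : ℝ, fourier2 f (l • dir φ) * Complex.exp (-(Complex.I * k * φ))
      = ∫ r in (0 : ℝ)..R, ∫ α in (0 : ℝ)..(2 * Real.pi), 1 / (2 * Real.pi) * r * f (r • dir α)
        * (Complex.exp (-(Complex.I * (((l * r : ℝ) : ℂ) * Real.cos (α - φ))))
          * Complex.exp (-(Complex.I * k * φ))) := fun φ => by
    rw [h1, ← intervalIntegral.integral_const_mul, ← intervalIntegral.integral_mul_const]
    refine intervalIntegral.integral_congr fun r _ => ?_
    rw [← intervalIntegral.integral_const_mul, ← intervalIntegral.integral_const_mul,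
      ← intervalIntegral.integral_mul_const]
    refine intervalIntegral.integral_congr fun α _ => ?_
    ring
  simp only [h2]
  rw [intervalIntegral_swap_of_continuous (F := fun φ r : ℝ => ∫ α in (0 : ℝ)..(2 * Real.pi),
      (1 / (2 * Real.pi) * r * f (r • dir α)
        * (Complex.exp (-(Complex.I * (((l * r : ℝ) : ℂ) * Real.cos (α - φ))))
          * Complex.exp (-(Complex.I * k * φ))) : ℂ)) (continuous_intervalIntegral (X := ℝ × ℝ)
      (f := fun (p : ℝ × ℝ) (α : ℝ) => (1 / (2 * Real.pi) * p.2 * f (p.2 • dir α)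
        * (Complex.exp (-(Complex.I * (((l * p.2 : ℝ) : ℂ) * Real.cos (α - p.1))))
          * Complex.exp (-(Complex.I * k * p.1))) : ℂ)) (by fun_prop) _ _),
    ← intervalIntegral.integral_const_mul]
  refine intervalIntegral.integral_congr fun r _ => ?_
  rw [intervalIntegral_swap_of_continuous (by fun_prop)]
  simp only [intervalIntegral.integral_const_mul, integral_planeWave_mul_exp, angMode]
  rw [← intervalIntegral.integral_const_mul, ← intervalIntegral.integral_mul_const,
    ← intervalIntegral.integral_const_mul]
  refine intervalIntegral.integral_congr fun α _ => ?_
  push_cast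
  field_simp

theorem summable_angularCoeff (hc : ContDiff ℝ 2 f) (hR : 0 ≤ R)
    (hf : ∀ x : Plane, R < ‖x‖ → f x = 0) (l : ℝ) :
    Summable fun k : ℤ => 1 / (2 * Real.pi : ℂ) * ∫ φ in (0 : ℝ)..(2 * Real.pi),
      fourier2 f (l • dir φ) * Complex.exp (-(Complex.I * k * φ)) := by
  obtain ⟨M, hM, hM0, -, -⟩ := exists_bound_of_vanish hc hf
  refine Summable.mul_left _ (Summable.of_norm_bounded_eventually
    (g := fun k : ℤ => R * (2 * Real.pi * M) * ((|l| * R) ^ 2 + |l| * R) * R * (1 / (k : ℝ) ^ 2))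
    ((Real.summable_one_div_int_pow.2 one_lt_two).mul_left _) ?_)
  -- At `k = 0` the majorant is zero by the convention `1 / 0 = 0` and bounds nothing, so this term
  -- is set aside.
  have h0 : ∀ᶠ k : ℤ in cofinite, k ≠ 0 := by
    rw [eventually_cofinite]; simp
  filter_upwards [h0] with k hk
  have hk2 : (0 : ℝ) < (k : ℝ) ^ 2 := by positivity
  rw [integral_fourier2_mul_exp hc.continuous hR hf, norm_mul, norm_pow, norm_neg, Complex.norm_I,
    one_pow, one_mul]
  have h := intervalIntegral.norm_integral_le_of_norm_le_const (a := 0) (b := R)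
    (f := fun r : ℝ => r * angMode k (fun x => (f x : ℂ)) r * besselJC k.natAbs (l * r))
    (C := R * (2 * Real.pi * M) * (((|l| * R) ^ 2 + |l| * R) * (1 / (k : ℝ) ^ 2))) fun r hr => by
      rw [uIoc_of_le hR] at hr
      have e1 : ‖angMode k (fun x => (f x : ℂ)) r‖ ≤ 2 * Real.pi * M :=
        norm_angMode_le fun α => by rw [Complex.norm_real]; exact hM0 _
      have e2 : ‖besselJC k.natAbs (l * r)‖ ≤ ((|l| * R) ^ 2 + |l| * R) * (1 / (k : ℝ) ^ 2) := by
        have h3 := sq_mul_norm_besselJC_le k.natAbs (l * r)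
        have h4 : (((k.natAbs : ℤ) : ℝ)) ^ 2 = (k : ℝ) ^ 2 := by exact_mod_cast Int.natAbs_sq k
        have h5 : |l * r| ≤ |l| * R := by
          rw [abs_mul, abs_of_pos hr.1]; exact mul_le_mul_of_nonneg_left hr.2 (abs_nonneg _)
        rw [h4] at h3
        rw [Complex.ofReal_mul] at h3
        rw [mul_one_div, le_div_iff₀ hk2, mul_comm]
        refine h3.trans (add_le_add ?_ h5)
        rw [← sq_abs (l * r)]
        gcongr
      have e3 : ‖(r : ℂ)‖ ≤ R := by
        rw [Complex.norm_real, Real.norm_of_nonneg hr.1.le]; exact hr.2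
      rw [norm_mul, norm_mul]
      gcongr
  refine h.trans (le_of_eq ?_)
  rw [sub_zero, abs_of_nonneg hR]
  ring

/-! ### Integrals of the Fourier transform -/

/-- The Fourier integral of the indicator function of a disk. -/
theorem integral_disk_exp (hR : 0 ≤ R) {l : ℝ} (hl : 0 < l) (φ : ℝ) :
    ∫ x : Plane, (Metric.closedBall (0 : Plane) R).indicator
        (fun x => Complex.exp (Complex.I * (inner ℝ x (l • dir φ) : ℝ))) x
      = 2 * Real.pi * R * besselJ 1 (l * R) / l := by
  have h1 : Integrable ((Metric.closedBall (0 : Plane) R).indicator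
      (fun x => Complex.exp (Complex.I * (inner ℝ x (l • dir φ) : ℝ)))) := by
    rw [integrable_indicator_iff Metric.isClosed_closedBall.measurableSet]
    exact ContinuousOn.integrableOn_compact (isCompact_closedBall _ _)
      (Continuous.continuousOn (by fun_prop))
  rw [integral_plane_of_vanish h1 hR fun x hx => indicator_of_notMem (by simpa using hx) _]
  have h2 : ∫ r in (0 : ℝ)..R, (r : ℂ) * ∫ α in (0 : ℝ)..(2 * Real.pi),
      (Metric.closedBall (0 : Plane) R).indicator
        (fun x => Complex.exp (Complex.I * (inner ℝ x (l • dir φ) : ℝ))) (r • dir α)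
      = 2 * Real.pi * ∫ r in (0 : ℝ)..R, (r : ℂ) * besselJC 0 (l * r) := by
    rw [← intervalIntegral.integral_const_mul]
    refine intervalIntegral.integral_congr fun r hr => ?_
    rw [uIcc_of_le hR] at hr
    -- The shift by `π` reverses the sign of the exponent, so the plane wave lemma applies with `k =
    -- 0`.
    have h3 : ∀ α : ℝ, (Metric.closedBall (0 : Plane) R).indicator
        (fun x => Complex.exp (Complex.I * (inner ℝ x (l • dir φ) : ℝ))) (r • dir α)
        = Complex.exp (-(Complex.I * (((l * r : ℝ) : ℂ) * Real.cos (φ + Real.pi - α))))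
          * Complex.exp (-(Complex.I * (0 : ℤ) * α)) := fun α => by
      rw [indicator_of_mem (by simpa [norm_smul_dir hr.1] using hr.2), ← Complex.exp_add, real_inner_smul_left,
        real_inner_smul_right, inner_dir, show φ + Real.pi - α = -(α - φ) + Real.pi by ring,
        Real.cos_add_pi, Real.cos_neg]
      congr 1
      push_cast
      ring
    simp only [h3]
    rw [integral_planeWave_mul_exp]
    simp
    ring
  rw [h2, integral_mul_besselJC_zero hl]
  have h4 := besselJC_natCast_ofReal 1 (l * R)
  push_cast at h4
  rw [h4]
  ring

/-- Justifies Fubini at the origin: the disk has finite measure, `f̂` is integrable and the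
exponential has modulus 1. -/
theorem integrable_fourier2_mul_disk (hc : ContDiff ℝ 2 f) (hf : ∀ x : Plane, R < ‖x‖ → f x = 0) :
    Integrable (Function.uncurry fun x Λ : Plane => (Metric.closedBall (0 : Plane) R).indicator
      (fun x => Complex.exp (Complex.I * (inner ℝ x Λ : ℝ))) x * fourier2 f Λ)
      (volume.prod volume) := by
  have hs := hasCompactSupport_of_vanish hf
  have hB : MeasurableSet (Metric.closedBall (0 : Plane) R) := Metric.isClosed_closedBall.measurableSet
  have h1 : Integrable ((Metric.closedBall (0 : Plane) R).indicator fun _ => (1 : ℂ)) :=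
    (integrable_indicator_iff hB).2 (integrableOn_const measure_closedBall_lt_top.ne)
  refine ((h1.mul_prod (integrable_fourier2 hc hs)).bdd_mul (c := 1)
    (f := fun p : Plane × Plane => Complex.exp (Complex.I * (inner ℝ p.1 p.2 : ℝ)))
    (Continuous.aestronglyMeasurable (by fun_prop)) (Eventually.of_forall fun p => ?_)).congr
    (Eventually.of_forall fun p => ?_)
  · rw [mul_comm, Complex.norm_exp_ofReal_mul_I]
  · by_cases hp : p.1 ∈ Metric.closedBall (0 : Plane) R
    · simp only [Function.uncurry, indicator_of_mem hp]; ring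
    · simp only [Function.uncurry, indicator_of_notMem hp]; ring

/-- The integral of a function supported in a disk, in terms of its Fourier transform. -/
theorem fourier2_zero_eq (hc : ContDiff ℝ 2 f) (hR : 0 ≤ R)
    (hf : ∀ x : Plane, R < ‖x‖ → f x = 0) :
    IntegrableOn (fun l : ℝ => (∫ φ in (0 : ℝ)..(2 * Real.pi), fourier2 f (l • dir φ))
      * (R * besselJ 1 (l * R))) (Ioi 0) ∧
    fourier2 f 0 = 1 / (2 * Real.pi) * ∫ l in Ioi (0 : ℝ),
      (∫ φ in (0 : ℝ)..(2 * Real.pi), fourier2 f (l • dir φ)) * (R * besselJ 1 (l * R)) := by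
  have hpi : (Real.pi : ℂ) ≠ 0 := by exact_mod_cast Real.pi_ne_zero
  have hs := hasCompactSupport_of_vanish hf
  have hprod := integrable_fourier2_mul_disk hc hf
  set K : Plane → ℂ := fun Λ => ∫ x : Plane, (Metric.closedBall (0 : Plane) R).indicator
    (fun x => Complex.exp (Complex.I * (inner ℝ x Λ : ℝ))) x * fourier2 f Λ with hK
  have hKi : Integrable K := hprod.integral_prod_right
  -- The polar Jacobian `l` cancels the denominator in the transform of the disk.
  have hKp : ∀ l : ℝ, 0 < l → ∀ φ : ℝ, (l : ℂ) * K (l • dir φ)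
      = 2 * Real.pi * (fourier2 f (l • dir φ) * (R * besselJ 1 (l * R))) := fun l hl φ => by
    have hl' : (l : ℂ) ≠ 0 := by exact_mod_cast hl.ne'
    rw [hK]
    simp only
    rw [integral_mul_const, integral_disk_exp hR hl]
    field_simp
  have hpol : ∀ l ∈ Ioi (0 : ℝ), ∫ φ in (0 : ℝ)..(2 * Real.pi), (l : ℂ) * K (l • dir φ)
      = 2 * Real.pi * ((∫ φ in (0 : ℝ)..(2 * Real.pi), fourier2 f (l • dir φ))
        * (R * besselJ 1 (l * R))) := fun l hl => by
    simp only [hKp l hl, intervalIntegral.integral_const_mul, intervalIntegral.integral_mul_const]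
  constructor
  · have h1 := (integrable_plane_iff_polar hKi.1).1 hKi
    rw [IntegrableOn, polarSet, Measure.volume_eq_prod, ← Measure.prod_restrict] at h1
    have h2 := (h1.integral_prod_left).const_mul (1 / (2 * Real.pi) : ℂ)
    refine h2.congr ((ae_restrict_mem measurableSet_Ioi).mono fun l hl => ?_)
    have h3 := hpol l hl
    rw [intervalIntegral.integral_of_le Real.two_pi_pos.le] at h3
    simp only [Complex.real_smul]
    rw [h3]
    field_simp
  · have h1 : fourier2 f 0 = 1 / (2 * Real.pi) * (1 / (2 * Real.pi) * ∫ Λ, K Λ) := by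
      have hswap := integral_integral_swap hprod
      rw [hK, ← hswap, fourier2]
      congr 1
      rw [← integral_const_mul]
      refine integral_congr_ae (Eventually.of_forall fun x => ?_)
      simp only [inner_zero_right, Complex.ofReal_zero, mul_zero, neg_zero, Complex.exp_zero, mul_one]
      -- Inside the disk, inversion expresses `f(x)` by `f̂`; outside, both sides vanish, so
      -- inserting the indicator costs nothing.
      by_cases hx : x ∈ Metric.closedBall (0 : Plane) R
      · simp only [indicator_of_mem hx]
        rw [eq_integral_fourier2 hc hs x]
        congr 1
        refine integral_congr_ae (Eventually.of_forall fun Λ => ?_)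
        exact mul_comm _ _
      · rw [hf x (by simpa using hx)]
        simp [indicator_of_notMem hx]
    rw [h1, integral_plane_polar_iterated hKi, ← integral_const_mul]
    congr 1
    refine setIntegral_congr_fun measurableSet_Ioi fun l hl => ?_
    have h3 := hpol l hl
    rw [intervalIntegral.integral_const_mul] at h3
    simp only [Complex.real_smul]
    rw [h3]
    field_simp


/-! ### The reconstruction formulas -/

namespace IsWaveSolution

variable {f : Plane → ℝ} {u : Plane → ℝ → ℝ} {R : ℝ}

theorem seriesTerm_eq (hu : IsWaveSolution f u) (hR : 0 < R)
    (hf : ∀ x : Plane, R < ‖x‖ → f x = 0) {l : ℝ} (hl : 0 < l) (φ : ℝ) (k : ℤ) :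
    seriesTerm R u l φ k = Real.pi / 2 * (1 / (2 * Real.pi : ℂ) *
      (∫ ψ in (0 : ℝ)..(2 * Real.pi), fourier2 f (l • dir ψ) * Complex.exp (-(Complex.I * k * ψ)))
        * Complex.exp (Complex.I * k * φ)) := by
  obtain ⟨v, D, D₂, hv, hvu⟩ := hu.exists_isExtendedWave
  have hc := hu.contDiff_initial
  have hpi : (Real.pi : ℂ) ≠ 0 := by exact_mod_cast Real.pi_ne_zero
  have hl' : (l : ℂ) ≠ 0 := by exact_mod_cast hl.ne'
  have hH := hankel1_ne_zero k.natAbs (mul_pos hl hR)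
  -- Both sides become the same radial integral of `f_k` against `J_{|k|}`; the nonvanishing Hankel
  -- factor and `l` cancel.
  rw [seriesTerm, hv.dataCoeff_eq hc hR hf hvu k hl, integral_fourier2_mul_exp hc.continuous hR.le hf]
  field_simp
  ring

/-- The Fourier transform of the initial value on a circle, as a Fourier series. -/
theorem hasSum_seriesTerm (hu : IsWaveSolution f u) (hR : 0 < R)
    (hf : ∀ x : Plane, R < ‖x‖ → f x = 0) {l : ℝ} (hl : 0 < l) (φ : ℝ) :
    HasSum (seriesTerm R u l φ) (Real.pi / 2 * fourier2 f (l • dir φ)) := by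
  have hc := hu.contDiff_initial
  have hF := continuous_fourier2 hc (hasCompactSupport_of_vanish hf)
  have hd := continuous_dir
  have h := (hasSum_fourier_of_periodic (g := fun φ => fourier2 f (l • dir φ)) (by fun_prop)
    (fun φ => by simp only [dir_add_two_pi]) (summable_angularCoeff hc hR.le hf l) φ).mul_left
    (Real.pi / 2 : ℂ)
  exact h.congr_fun fun k => hu.seriesTerm_eq hR hf hl φ k

theorem tsum_seriesTerm (hu : IsWaveSolution f u) (hR : 0 < R)
    (hf : ∀ x : Plane, R < ‖x‖ → f x = 0) {l : ℝ} (hl : 0 < l) (φ : ℝ) :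
    ∑' k : ℤ, seriesTerm R u l φ k = Real.pi / 2 * fourier2 f (l • dir φ) :=
  (hu.hasSum_seriesTerm hR hf hl φ).tsum_eq

/-- The initial value as a superposition of plane waves. -/
theorem planeWave_superposition (hu : IsWaveSolution f u) (hR : 0 < R)
    (hf : ∀ x : Plane, R < ‖x‖ → f x = 0) (r θ : ℝ) :
    IntegrableOn (fun p : ℝ × ℝ => (∑' k : ℤ, seriesTerm R u p.1 p.2 k)
      * Complex.exp (Complex.I * p.1 * r * Real.cos (θ - p.2)) * p.1) polarSet ∧
    (f (r • dir θ) : ℂ) = 1 / Real.pi ^ 2 *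
      ∫ l in Ioi (0 : ℝ), (∫ φ in (0 : ℝ)..(2 * Real.pi), (∑' k : ℤ, seriesTerm R u l φ k)
        * Complex.exp (Complex.I * l * r * Real.cos (θ - φ))) * l := by
  have hc := hu.contDiff_initial
  have hs := hasCompactSupport_of_vanish hf
  have hpi : (Real.pi : ℂ) ≠ 0 := by exact_mod_cast Real.pi_ne_zero
  set F : Plane → ℂ := fun Λ =>
    fourier2 f Λ * Complex.exp (Complex.I * (inner ℝ (r • dir θ) Λ : ℝ)) with hF
  have hFi : Integrable F := (integrable_fourier2 hc hs).mul_bdd (c := 1)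
    (Continuous.aestronglyMeasurable (by fun_prop))
    (Eventually.of_forall fun Λ => by rw [mul_comm, Complex.norm_exp_ofReal_mul_I])
  -- Summing the series first reduces both claims to the integrand of Fourier inversion;
  -- integrability of the double integral is then that of `f̂`.
  have hS : ∀ l : ℝ, 0 < l → ∀ φ : ℝ, (∑' k : ℤ, seriesTerm R u l φ k)
      * Complex.exp (Complex.I * l * r * Real.cos (θ - φ)) = Real.pi / 2 * F (l • dir φ) := by
    intro l hl φ
    rw [hu.tsum_seriesTerm hR hf hl, hF, mul_assoc]
    simp only [real_inner_smul_left, real_inner_smul_right, inner_dir]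
    push_cast
    ring_nf
  constructor
  · refine IntegrableOn.congr_fun (((integrable_plane_iff_polar hFi.1).1 hFi).const_mul
      (Real.pi / 2 : ℂ)) (fun p hp => ?_) measurableSet_polarSet
    rw [hS p.1 hp.1, Complex.real_smul]
    ring
  · rw [eq_integral_fourier2 hc hs, integral_plane_polar_iterated hFi, ← integral_const_mul,
      ← integral_const_mul]
    refine setIntegral_congr_fun measurableSet_Ioi fun l hl => ?_
    simp only [hS l hl, intervalIntegral.integral_const_mul, Complex.real_smul]
    field_simp

/-- The integral of the initial value. -/
theorem fourier2_zero_eq_integral (hu : IsWaveSolution f u) (hR : 0 < R)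
    (hf : ∀ x : Plane, R < ‖x‖ → f x = 0) :
    IntegrableOn (fun l : ℝ => 2 * dataCoeff R u 0 l / (Real.pi * l * hankel1 0 (l * R))
      * (R * besselJ 1 (l * R))) (Ioi 0) ∧
    fourier2 f 0 = ∫ l in Ioi (0 : ℝ),
      2 * dataCoeff R u 0 l / (Real.pi * l * hankel1 0 (l * R)) * (R * besselJ 1 (l * R)) := by
  have hpi : (Real.pi : ℂ) ≠ 0 := by exact_mod_cast Real.pi_ne_zero
  have h : ∀ l ∈ Ioi (0 : ℝ), 1 / (2 * Real.pi : ℂ)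
      * ((∫ φ in (0 : ℝ)..(2 * Real.pi), fourier2 f (l • dir φ)) * (R * besselJ 1 (l * R)))
      = 2 * dataCoeff R u 0 l / (Real.pi * l * hankel1 0 (l * R)) * (R * besselJ 1 (l * R)) := by
    intro l hl
    have h1 := hu.seriesTerm_eq hR hf hl 0 0
    rw [seriesTerm] at h1
    simp only [Int.cast_zero, mul_zero, zero_mul, neg_zero, Complex.exp_zero, mul_one, Int.natAbs_zero,
      pow_zero, one_mul] at h1
    have h2 : 2 * dataCoeff R u 0 l / (Real.pi * l * hankel1 0 (l * R))
        = 2 / Real.pi * (dataCoeff R u 0 l / (l * hankel1 0 (l * R))) := by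
      rw [div_mul_div_comm, mul_assoc]
    rw [h2, h1]
    field_simp
  obtain ⟨h1, h2⟩ := fourier2_zero_eq hu.contDiff_initial hR.le hf
  constructor
  · exact IntegrableOn.congr_fun (h1.const_mul (1 / (2 * Real.pi : ℂ))) h measurableSet_Ioi
  · rw [h2, ← integral_const_mul]
    exact setIntegral_congr_fun measurableSet_Ioi h

end IsWaveSolution

end TAT

theorem mainTheorem1 (R : ℝ) (hR : 0 < R)
    (f : TAT.Plane → ℝ) (hf : ∀ x : TAT.Plane, R < ‖x‖ → f x = 0)
    (u : TAT.Plane → ℝ → ℝ) (hu : TAT.IsWaveSolution f u) :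
    -- the integrals defining `P̂` and `P̂_k` converge absolutely
    (∀ φ : ℝ, Integrable (TAT.detectorData R u φ)) ∧
    (∀ l : ℝ, 0 < l →
      IntervalIntegrable (fun φ => TAT.dataHat R u φ l) volume 0 (2 * Real.pi)) ∧
    -- the denominators do not vanish
    (∀ l : ℝ, 0 < l → ∀ k : ℤ, TAT.hankel1 k.natAbs (l * R) ≠ 0) ∧
    -- the Fourier transform of `f` away from the origin
    (∀ l φ : ℝ, 0 < l →
      Summable (TAT.seriesTerm R u l φ) ∧
      TAT.fourier2 f (l • TAT.dir φ) = 2 / Real.pi * ∑' k : ℤ, TAT.seriesTerm R u l φ k) ∧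
    -- the superposition of plane waves that represents `f`
    (∀ r θ : ℝ, 0 ≤ r →
      IntegrableOn
        (fun p : ℝ × ℝ => (∑' k : ℤ, TAT.seriesTerm R u p.1 p.2 k)
          * Complex.exp (Complex.I * p.1 * r * Real.cos (θ - p.2)) * p.1)
        (Ioi 0 ×ˢ Ioc 0 (2 * Real.pi)) ∧
      (f (r • TAT.dir θ) : ℂ) = 1 / Real.pi ^ 2 *
        ∫ l in Ioi (0 : ℝ), (∫ φ in (0 : ℝ)..(2 * Real.pi),
          (∑' k : ℤ, TAT.seriesTerm R u l φ k)
            * Complex.exp (Complex.I * l * r * Real.cos (θ - φ))) * l) ∧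
    -- the Fourier transform of `f` at the origin
    (IntegrableOn
        (fun l : ℝ => 2 * TAT.dataCoeff R u 0 l / (Real.pi * l * TAT.hankel1 0 (l * R))
          * (R * TAT.besselJ 1 (l * R))) (Ioi 0) ∧
      TAT.fourier2 f 0 = ∫ l in Ioi (0 : ℝ),
        2 * TAT.dataCoeff R u 0 l / (Real.pi * l * TAT.hankel1 0 (l * R))
          * (R * TAT.besselJ 1 (l * R))) := by
  have hc := hu.contDiff_initial
  have hpi : (Real.pi : ℂ) ≠ 0 := by exact_mod_cast Real.pi_ne_zero
  obtain ⟨v, D, D₂, hv, hvu⟩ := hu.exists_isExtendedWave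
  refine ⟨hv.integrable_detectorData hc hR hf hvu,
    fun l _ => hv.intervalIntegrable_dataHat hc hR hf hvu l,
    fun l hl k => TAT.hankel1_ne_zero k.natAbs (mul_pos hl hR), fun l φ hl => ⟨?_, ?_⟩,
    fun r θ _ => hu.planeWave_superposition hR hf r θ, hu.fourier2_zero_eq_integral hR hf⟩
  · exact (hu.hasSum_seriesTerm hR hf hl φ).summable
  · rw [hu.tsum_seriesTerm hR hf hl φ]
    field_simp
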